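/- Let $\mathcal N=\mathbb N^{\mathbb N}$ be Baire space. For $x_1,\dots,x_q\in\mathcal N$ let $\langle x_1,\dots,x_q\rangle\in\mathcal N$ be the interleaving, whose entry at $qi+j-1$ is $x_j(i)$ ($1\le j\le q$); for $q=1$ it is $x_1$ and for $q=0$ it is the zero sequence. A partial function $F:\mathcal N\to\mathcal N$ is *TTE-computable* if there is an oracle machine $M$ such that for all $x,y$: $F(x)=y$ iff $M^x(i)=y(i)$ for all $i$ (so $F(x)$ is undefined iff $M^x(i)$ is undefined for some $i$). A partial function $\Psi(e;x)$ from $\mathbb N\times\mathcal N$ to $\mathcal N$ is a *universal TTE-computable function* if it is computed in this sense by an oracle machine with $e$ as an additional input, and every TTE-computable $F:\mathcal N\to\mathcal N$ is of the form $\Psi(e;\cdot)$ for some $e$. Let $\Psi$ be any universal TTE-computable function. The class of *partial recursive functions over $\mathcal N$* is the smallest class of partial functions $\mathbb N^p\times\mathcal N^q\to Y$ ($p,q\ge 0$, $Y\in\{\mathbb N,\mathcal N\}$) that contains * the zero function and the successor function $\mathbb N\to\mathbb N$, and all projections $(n_1,\dots,n_p;x_1,\dots,x_q)\mapsto n_i$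 and $\mapsto x_j$; * for every $q\ge 0$ the universal function $(e;x_1,\dots,x_q)\mapsto\Psi(e;\langle x_1,\dots,x_q\rangle)$; * the characteristic function $\chi:\mathcal N\to\mathbb N$ of $\{0_{\mathcal N}\}$, where $0_{\mathcal N}$ is the zero sequence; and that is closed under * composition $f(g_1(\vec m;\vec y),\dots,g_p(\vec m;\vec y);h_1(\vec m;\vec y),\dots,h_q(\vec m;\vec y))$ (defined iff all inner values are defined and $f$ is defined on them); * primitive recursion on $\mathbb N$: $F(0,\vec n;\vec x)=G(\vec n;\vec x)$ and $F(k+1,\vec n;\vec x)=H(k,\vec n;\vec x,F(k,\vec n;\vec x))$ if the values are in $\mathcal N$, respectively $F(k+1,\vec n;\vec x)=H(k,\vec n,F(k,\vec n;\vec x);\vec x)$ if the values are in $\mathbb N$; * the $\mu$-operator: $F(\vec n;\vec x)$ is the least $k$ such that $G(k,\vec n;\vec x)=0$ and $G(k',\vec n;\vec x)$ is defined and nonzero for all $k'<k$, and is undefined if there is no such $k$. A *master-slave machine* is a Turing machine (the master) with a finite alphabet, a finite set of standard states with a start state and a halting state, two further states $S$ (slave call) and $E$ (zero-test), an input tape,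 an output tape, a billboard tape, finitely many work tapes, and a Boolean bit that it can read. In a standard state other than the halting state, the state, the scanned symbols and the bit determine the action on each tape (write a symbol, or move left or right) and the next state, which may be $S$ or $E$; $S$ and $E$ each have one fixed successor state. Numbers are written with a distinguished non-blank symbol: the input $n_1,\dots,n_p$ is given as blocks of length $n_1+1,\dots,n_p+1$, each followed by a blank, and the number on the billboard or output tape is the number of occurrences of this symbol there. In addition there are infinitely many slaves $S_0,S_1,\dots$, universal oracle machines for $\Psi$, which share a read-only input tape, a work tape, a zero-test tape and a write-only output tape, each holding an element of $\mathcal N$. On input $(\vec n;\vec x)$, the master starts in its start state with $\vec n$ on its input tape; the input tape of the slaves holds $\langle x_1,\dots,x_q\rangle$; the bit is $0$; all else is blank, respectively zero. In state $S$, if $b$ is the number on the billboard, $x$ the content of the input tape of the slaves and $w$ that of their work tape, then slave $S_i$ computes the $i$-th entry of $\Psi(b;\langle x,w\rangle)$; if all slaves halt, the result is written as $\langle w',z',o'\rangle$ with $w'$, $z'$, $o'$ the new contents of the work, zero-test and output tape of the slaves, and otherwise the computation is undefined. In state $E$ the bit becomes $1$ if the zero-test tape holds $0_{\mathcal N}$,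 and $0$ otherwise. When the halting state is reached, the output is the number on the output tape of the master if $Y=\mathbb N$, and the sequence on the output tape of the slaves if $Y=\mathcal N$. A partial function $f:\mathbb N^p\times\mathcal N^q\to Y$ is *MS-computable over $\mathcal N$* if some master-slave machine, on every input $(\vec n;\vec x)$, halts with output $f(\vec n;\vec x)$ if this is defined, and otherwise runs forever or makes a slave call in which some slave does not halt. **Theorem.** For all $p,q\ge 0$ and $Y\in\{\mathbb N,\mathcal N\}$, a partial function $f:\mathbb N^p\times\mathcal N^q\to Y$ is MS-computable over $\mathcal N$ if and only if it is partial recursive over $\mathcal N$. -/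

import Mathlib

/-! ## Functions of mixed type over Baire space -/

/-- Baire space `ω^ω`. -/
abbrev Baire : Type := ℕ → ℕ

/-- The two possible codomains: natural numbers and Baire space. -/
inductive Codomain : Type
  | nat : Codomain
  | baire : Codomain

/-- Elements of a codomain. -/
abbrev Codomain.Elem : Codomain → Type
  | .nat => ℕ
  | .baire => Baire

/-- Partial functions `ℕ^p × Baire^q → Y`, where `Y` is `ℕ` or Baire space. -/
abbrev MixedFun (p q : ℕ) (Y : Codomain) : Type :=
  (Fin p → ℕ) → (Fin q → Baire) → Part Y.Elem

/-- The interleaving `⟨x₀, …, x_{q-1}⟩` of `q` sequences: its entry at `q * i + j` is `x_j (i)`.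
For `q = 1` this is `x₀`, for `q = 0` it is the zero sequence. -/
def interleave {q : ℕ} (x : Fin q → Baire) : Baire := fun k =>
  if h : 0 < q then x ⟨k % q, Nat.mod_lt k h⟩ (k / q) else 0

/-- The `j`-th track of a sequence that interleaves `q` sequences. -/
def track (q j : ℕ) (y : Baire) : Baire := fun i => y (q * i + j)

/-- A finite tuple of partial values is defined when every component is. -/
def Part.tuple {α : Type} {n : ℕ} (u : Fin n → Part α) : Part (Fin n → α) :=
  ⟨∀ i, (u i).Dom, fun h i => (u i).get (h i)⟩

/-! ## Computation with an oracle and TTE-computability -/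

/-- Oracle computations `x ↦ M^x`, uniformly in the oracle `x`: the uniform version of Mathlib's
`Nat.RecursiveIn`. The functional `M` assigns to each oracle `x` a partial function on `ℕ` that is
computed from `x` by one program, not depending on `x`. -/
inductive OracleComputable : (Baire → ℕ →. ℕ) → Prop
  | zero : OracleComputable fun _ _ => Part.some 0
  | succ : OracleComputable fun _ n => Part.some (n + 1)
  | left : OracleComputable fun _ n => Part.some n.unpair.1
  | right : OracleComputable fun _ n => Part.some n.unpair.2
  | oracle : OracleComputable fun x n => Part.some (x n)
  | pair {f h : Baire → ℕ →. ℕ} (hf : OracleComputable f) (hh : OracleComputable h) :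
      OracleComputable fun x n => (f x n).bind fun a => (h x n).map fun b => Nat.pair a b
  | comp {f h : Baire → ℕ →. ℕ} (hf : OracleComputable f) (hh : OracleComputable h) :
      OracleComputable fun x n => (h x n).bind (f x)
  | prec {f h : Baire → ℕ →. ℕ} (hf : OracleComputable f) (hh : OracleComputable h) :
      OracleComputable fun x n =>
        Nat.rec (f x n.unpair.1)
          (fun k ih => ih.bind fun i => h x (Nat.pair n.unpair.1 (Nat.pair k i))) n.unpair.2
  | rfind {f : Baire → ℕ →. ℕ} (hf : OracleComputable f) :
      OracleComputable fun x a => Nat.rfind fun n => (f x (Nat.pair a n)).map fun m => decide (m = 0)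

/-- `F : Baire ⇀ Baire` is TTE-computable: for some oracle computation `M`, `F x = y` iff
`M^x (i) = y (i)` for all `i`; so `F x` is undefined iff some `M^x (i)` is. -/
def TTEComputable (F : Baire →. Baire) : Prop :=
  ∃ M, OracleComputable M ∧ ∀ x y, y ∈ F x ↔ ∀ i, y i ∈ M x i

/-- `Ψ (e; x)` is a universal TTE-computable function: it is TTE-computable (with the numerical
argument `e` as an additional input of the oracle computation), and every TTE-computable
`F : Baire ⇀ Baire` is `Ψ (e; ·)` for some `e`. -/
structure IsUniversalTTE (Ψ : ℕ → Baire →. Baire) : Prop where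
  computable : ∃ M, OracleComputable M ∧ ∀ e x y, y ∈ Ψ e x ↔ ∀ i, y i ∈ M x (Nat.pair e i)
  universal : ∀ F, TTEComputable F → ∃ e, ∀ x, F x = Ψ e x

/-! ### A universal TTE-computable function exists -/

namespace OracleComputable

theorem of_partrec {g : ℕ →. ℕ} (hg : Nat.Partrec g) : OracleComputable fun _ n => g n := by
  induction hg with
  | zero => exact .zero
  | succ => exact .succ
  | left => exact .left
  | right => exact .right
  | pair _ _ h₁ h₂ =>
    convert OracleComputable.pair h₁ h₂ using 3
    simp [Seq.seq, Part.bind_map]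
  | comp _ _ h₁ h₂ => exact .comp h₁ h₂
  | prec _ _ h₁ h₂ => exact .prec h₁ h₂
  | rfind _ h => exact .rfind h

theorem of_eq {f g : Baire → ℕ →. ℕ} (hf : OracleComputable f) (h : ∀ x n, f x n = g x n) :
    OracleComputable g :=
  (funext fun x => funext fun n => h x n : f = g) ▸ hf

/-- The list `[x (n - 1), …, x 0]`. -/
def initialSegment (x : Baire) : ℕ → List ℕ
  | 0 => []
  | n + 1 => x n :: initialSegment x n

theorem length_initialSegment (x : Baire) (n : ℕ) : (initialSegment x n).length = n := by
  induction n with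
  | zero => rfl
  | succ n ih => simp [initialSegment, ih]

theorem getElem?_initialSegment (x : Baire) (n i : ℕ) :
    (initialSegment x n).reverse[i]? = if i < n then some (x i) else none := by
  induction n with
  | zero => simp [initialSegment]
  | succ n ih =>
    rw [initialSegment, List.reverse_cons, List.getElem?_append]
    simp only [List.length_reverse, length_initialSegment, ih]
    rcases lt_trichotomy i n with h | h | h
    · simp [h, Nat.lt_succ_of_lt h]
    · simp [h]
    · rw [if_neg (by omega), if_neg (by omega), List.getElem?_eq_none (by simp; omega)]

theorem computable_initialSegment :
    OracleComputable fun x n => Part.some (Encodable.encode (initialSegment x n)) := by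
  have hs : OracleComputable fun _ n => Part.some n := by
    convert OracleComputable.pair .left .right using 3
    simp
  have hr : OracleComputable fun _ n => Part.some n.unpair.2.unpair.1 := by
    convert OracleComputable.comp .left .right using 3
    simp
  have hr2 : OracleComputable fun _ n => Part.some n.unpair.2.unpair.2 := by
    convert OracleComputable.comp .right .right using 3
    simp
  have h := OracleComputable.prec .zero (.comp .succ (.pair (.comp .oracle hr) hr2))
  have h' := OracleComputable.comp h (.pair .zero hs)
  simp only [Part.bind_some, Part.map_some, Nat.unpair_pair] at h'
  refine of_eq h' fun x n => ?_
  induction n with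
  | zero => simp [initialSegment]
  | succ n ih => simp only [ih]; simp [initialSegment]

/-- `a` approximates `M` on initial segments of the oracle. -/
def Approximates (a : List ℕ → ℕ → Option ℕ) (M : Baire → ℕ →. ℕ) : Prop :=
  (∀ x i v m n, m ≤ n → a (initialSegment x m) i = some v → a (initialSegment x n) i = some v) ∧
    ∀ x i v, v ∈ M x i ↔ ∃ n, a (initialSegment x n) i = some v

theorem exists_approximation {M : Baire → ℕ →. ℕ} (hM : OracleComputable M) :
    ∃ a, Primrec₂ a ∧ Approximates a M := by
  induction hM with
  | zero => exact ⟨fun _ _ => some 0, .const _, by simp [Approximates, eq_comm]⟩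
  | succ =>
    exact ⟨fun _ n => some (n + 1), (Primrec.option_some.comp (Primrec.succ.comp .snd)).to₂, by simp [Approximates, eq_comm]⟩
  | left =>
    exact ⟨fun _ n => some n.unpair.1, (Primrec.option_some.comp ((Primrec.fst.comp .unpair).comp .snd)).to₂, by simp [Approximates, eq_comm]⟩
  | right =>
    exact ⟨fun _ n => some n.unpair.2, (Primrec.option_some.comp ((Primrec.snd.comp .unpair).comp .snd)).to₂, by simp [Approximates, eq_comm]⟩
  | oracle =>
    refine ⟨fun l i => l.reverse[i]?, Primrec.list_getElem?.comp (Primrec.list_reverse.comp .fst) .snd, ?_, ?_⟩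
    · intro x i v m n hmn
      simp only [getElem?_initialSegment]
      grind
    · intro x i v
      simp only [getElem?_initialSegment]
      constructor
      · intro h; exact ⟨i + 1, by simp at h; simp [h]⟩
      · rintro ⟨n, h⟩; simp; grind
  | @pair f h _ _ hf hh =>
    obtain ⟨a, ha, hm, hs⟩ := hf
    obtain ⟨b, hb, km, ks⟩ := hh
    refine ⟨fun l n => (a l n).bind fun u => (b l n).map fun v => Nat.pair u v, ?_, ?_, ?_⟩
    · exact Primrec.option_bind ha (Primrec.option_map (hb.comp (Primrec.fst.comp .fst) (Primrec.snd.comp .fst)) (Primrec₂.natPair.comp (Primrec.snd.comp .fst) .snd))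
    · intro x i v m n hmn h
      simp only [Option.bind_eq_some_iff, Option.map_eq_some_iff] at h ⊢
      obtain ⟨u, hu, w, hw, rfl⟩ := h
      exact ⟨u, hm _ _ _ _ _ hmn hu, w, km _ _ _ _ _ hmn hw, rfl⟩
    · intro x i v
      simp only [Part.mem_bind_iff, Part.mem_map_iff, hs, ks, Option.bind_eq_some_iff, Option.map_eq_some_iff]
      constructor
      · rintro ⟨u, ⟨n, hn⟩, w, ⟨m, hw⟩, rfl⟩
        exact ⟨max n m, u, hm _ _ _ _ _ (le_max_left _ _) hn, w, km _ _ _ _ _ (le_max_right _ _) hw, rfl⟩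
      · rintro ⟨n, u, hu, w, hw, rfl⟩
        exact ⟨u, ⟨n, hu⟩, w, ⟨n, hw⟩, rfl⟩
  | @comp f h _ _ hf hh =>
    obtain ⟨a, ha, hm, hs⟩ := hf
    obtain ⟨b, hb, km, ks⟩ := hh
    refine ⟨fun l n => (b l n).bind (a l), ?_, ?_, ?_⟩
    · exact Primrec.option_bind hb (ha.comp (Primrec.fst.comp .fst) .snd)
    · intro x i v m n hmn h
      simp only [Option.bind_eq_some_iff] at h ⊢
      obtain ⟨u, hu, hw⟩ := h
      exact ⟨u, km _ _ _ _ _ hmn hu, hm _ _ _ _ _ hmn hw⟩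
    · intro x i v
      refine Part.mem_bind_iff.trans ?_
      simp only [hs, ks, Option.bind_eq_some_iff]
      constructor
      · rintro ⟨u, ⟨n, hn⟩, ⟨m, hw⟩⟩
        exact ⟨max n m, u, km _ _ _ _ _ (le_max_left _ _) hn, hm _ _ _ _ _ (le_max_right _ _) hw⟩
      · rintro ⟨n, u, hu, hw⟩
        exact ⟨u, ⟨n, hu⟩, ⟨n, hw⟩⟩
  | @prec f h _ _ hf hh =>
    obtain ⟨a, ha, hm, hs⟩ := hf
    obtain ⟨b, hb, km, ks⟩ := hh
    let R : List ℕ → ℕ → ℕ → Option ℕ := fun l u k =>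
      Nat.rec (a l u) (fun k ih => ih.bind fun i => b l (Nat.pair u (Nat.pair k i))) k
    have R1 : ∀ x u k v m n, m ≤ n → R (initialSegment x m) u k = some v →
        R (initialSegment x n) u k = some v := by
      intro x u k v m n hmn
      induction k generalizing v with
      | zero => exact hm _ _ _ _ _ hmn
      | succ k ih =>
        intro h
        simp only [R, Option.bind_eq_some_iff] at h ih ⊢
        obtain ⟨i, hi, hv⟩ := h
        exact ⟨i, ih _ hi, km _ _ _ _ _ hmn hv⟩
    refine ⟨fun l n => R l n.unpair.1 n.unpair.2, ?_, ?_, ?_⟩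
    · refine Primrec.nat_rec' (f := fun p : List ℕ × ℕ => p.2.unpair.2) (g := fun p => a p.1 p.2.unpair.1)
        (h := fun p q => q.2.bind fun i => b p.1 (Nat.pair p.2.unpair.1 (Nat.pair q.1 i)))
        ((Primrec.snd.comp .unpair).comp .snd)
        (ha.comp .fst ((Primrec.fst.comp .unpair).comp .snd)) ?_
      refine Primrec.option_bind (Primrec.snd.comp .snd) ?_
      refine hb.comp (Primrec.fst.comp (.comp .fst .fst)) ?_
      refine Primrec₂.natPair.comp ((Primrec.fst.comp .unpair).comp (Primrec.snd.comp (.comp .fst .fst))) ?_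
      exact Primrec₂.natPair.comp (Primrec.fst.comp (Primrec.snd.comp .fst)) .snd
    · intro x i v m n hmn
      exact R1 _ _ _ _ _ _ hmn
    · intro x i v
      dsimp only
      generalize i.unpair.1 = u
      generalize i.unpair.2 = k
      induction k generalizing v with
      | zero => exact hs _ _ _
      | succ k ih =>
        simp only [Part.mem_bind_iff, ih, ks]
        constructor
        · rintro ⟨w, ⟨n, hn⟩, ⟨m, hw⟩⟩
          refine ⟨max n m, ?_⟩
          exact Option.bind_eq_some_iff.2 ⟨w, R1 _ _ _ _ _ _ (le_max_left _ _) hn, km _ _ _ _ _ (le_max_right _ _) hw⟩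
        · rintro ⟨n, h⟩
          obtain ⟨w, h1, h2⟩ := Option.bind_eq_some_iff.1 h
          exact ⟨w, ⟨n, h1⟩, n, h2⟩
  | @rfind f _ hf =>
    obtain ⟨a, ha, hm, hs⟩ := hf
    -- the search through `k` many candidates: `0` when all values were nonzero,
    -- `n + 1` when the search succeeded at `n`, and `none` when it met an undefined value
    let R : List ℕ → ℕ → ℕ → Option ℕ := fun l u k =>
      Nat.rec (some 0) (fun k ih => ih.bind fun s => if s = 0 then
        (a l (Nat.pair u k)).map fun v => if v = 0 then k + 1 else 0 else some s) k
    have Rsucc : ∀ l u k, R l u (k + 1) = (R l u k).bind fun s => if s = 0 then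
        (a l (Nat.pair u k)).map fun v => if v = 0 then k + 1 else 0 else some s := fun _ _ _ => rfl
    have R0 : ∀ l u k, R l u k = some 0 ↔ ∀ j < k, ∃ v, v ≠ 0 ∧ a l (Nat.pair u j) = some v := by
      intro l u k
      induction k with
      | zero => simp [R]
      | succ k ih =>
        rw [Rsucc, Option.bind_eq_some_iff]
        constructor
        · rintro ⟨s, h1, h2⟩
          split_ifs at h2 with h
          · subst h
            obtain ⟨v, hv, hv'⟩ := Option.map_eq_some_iff.1 h2
            intro j hj
            rcases Nat.lt_succ_iff_lt_or_eq.1 hj with hj | rfl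
            · exact ih.1 h1 j hj
            · exact ⟨v, by rintro rfl; simp at hv', hv⟩
          · simp_all
        · intro h
          refine ⟨0, ih.2 fun j hj => h j (by omega), ?_⟩
          obtain ⟨v, hv, hv'⟩ := h k (by omega)
          simp [hv', hv]
    have R1 : ∀ l u k n, R l u k = some (n + 1) ↔ n < k ∧ a l (Nat.pair u n) = some 0 ∧
        ∀ j < n, ∃ v, v ≠ 0 ∧ a l (Nat.pair u j) = some v := by
      intro l u k n
      induction k with
      | zero => simp [R]
      | succ k ih =>
        rw [Rsucc, Option.bind_eq_some_iff]
        constructor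
        · rintro ⟨s, h1, h2⟩
          split_ifs at h2 with h
          · subst h
            obtain ⟨v, hv, hv'⟩ := Option.map_eq_some_iff.1 h2
            split_ifs at hv' with h0
            · obtain rfl : k = n := by omega
              subst h0
              exact ⟨by omega, hv, (R0 _ _ _).1 h1⟩
          · obtain rfl : s = n + 1 := by simpa using h2
            exact ⟨by have := (ih.1 h1).1; omega, (ih.1 h1).2⟩
        · rintro ⟨h1, h2, h3⟩
          rcases Nat.lt_succ_iff_lt_or_eq.1 h1 with hj | rfl
          · exact ⟨n + 1, ih.2 ⟨hj, h2, h3⟩, by simp⟩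
          · exact ⟨0, (R0 _ _ _).2 h3, by simp [h2]⟩
    have key : ∀ l u n, (R l u l.length).bind (fun s => if s = 0 then none else some (s - 1))
        = some n ↔ n < l.length ∧ a l (Nat.pair u n) = some 0 ∧
          ∀ j < n, ∃ v, v ≠ 0 ∧ a l (Nat.pair u j) = some v := by
      intro l u n
      rw [← R1, Option.bind_eq_some_iff]
      constructor
      · rintro ⟨s, h1, h2⟩
        split_ifs at h2 with h
        obtain ⟨t, rfl⟩ := Nat.exists_eq_succ_of_ne_zero h
        simp at h2
        subst h2
        exact h1
      · intro h
        exact ⟨n + 1, h, by simp⟩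
    refine ⟨fun l u => (R l u l.length).bind (fun s => if s = 0 then none else some (s - 1)),
      ?_, ?_, ?_⟩
    · refine Primrec.option_bind (Primrec.nat_rec' (f := fun p : List ℕ × ℕ => p.1.length)
        (g := fun _ => some 0) (h := fun p q => q.2.bind fun s => if s = 0 then
          (a p.1 (Nat.pair p.2 q.1)).map fun v => if v = 0 then q.1 + 1 else 0 else some s)
        (Primrec.list_length.comp .fst) (.const _) ?_) ?_
      · refine Primrec.option_bind (Primrec.snd.comp .snd) ?_
        refine Primrec.ite (Primrec.eq.comp .snd (.const 0)) ?_ (Primrec.option_some.comp .snd)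
        refine Primrec.option_map (ha.comp (Primrec.fst.comp (.comp .fst .fst))
          (Primrec₂.natPair.comp (Primrec.snd.comp (.comp .fst .fst)) (Primrec.fst.comp (Primrec.snd.comp .fst)))) ?_
        exact Primrec.ite (Primrec.eq.comp .snd (.const 0))
          (Primrec.succ.comp (Primrec.fst.comp (Primrec.snd.comp (Primrec.fst.comp .fst)))) (.const 0)
      · exact Primrec.ite (Primrec.eq.comp .snd (.const 0)) (.const none)
          (Primrec.option_some.comp (Primrec.pred.comp .snd))
    · intro x i v m n hmn h
      rw [key, length_initialSegment] at h ⊢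
      refine ⟨by omega, hm _ _ _ _ _ hmn h.2.1, fun j hj => ?_⟩
      obtain ⟨w, hw, hw'⟩ := h.2.2 j hj
      exact ⟨w, hw, hm _ _ _ _ _ hmn hw'⟩
    · intro x i v
      refine Nat.mem_rfind.trans (Iff.trans ?_ (exists_congr fun n => key _ _ _).symm)
      simp only [length_initialSegment, Part.mem_map_iff, hs]
      constructor
      · rintro ⟨⟨w, ⟨n, hn⟩, hw⟩, h2⟩
        obtain rfl : w = 0 := by simpa using hw
        have : ∃ N, ∀ j < v, ∃ w, w ≠ 0 ∧ a (initialSegment x N) (Nat.pair i j) = some w := by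
          clear hn
          induction v with
          | zero => exact ⟨0, by simp⟩
          | succ v ih =>
            obtain ⟨N, hN⟩ := ih fun h => h2 (Nat.lt_succ_of_lt h)
            obtain ⟨w, ⟨m, hm'⟩, hw⟩ := h2 (Nat.lt_succ_self v)
            refine ⟨max N m, fun j hj => ?_⟩
            rcases Nat.lt_succ_iff_lt_or_eq.1 hj with hj | rfl
            · obtain ⟨w, hw, hw'⟩ := hN j hj
              exact ⟨w, hw, hm _ _ _ _ _ (le_max_left _ _) hw'⟩
            · exact ⟨w, by simpa using hw, hm _ _ _ _ _ (le_max_right _ _) hm'⟩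
        obtain ⟨N, hN⟩ := this
        refine ⟨max (v + 1) (max n N), by omega, hm _ _ _ _ _ (by omega) hn, fun j hj => ?_⟩
        obtain ⟨w, hw, hw'⟩ := hN j hj
        exact ⟨w, hw, hm _ _ _ _ _ (by omega) hw'⟩
      · rintro ⟨n, -, h1, h2⟩
        refine ⟨⟨0, ⟨n, h1⟩, by simp⟩, fun {j} hj => ?_⟩
        obtain ⟨w, hw, hw'⟩ := h2 j hj
        exact ⟨w, ⟨n, hw'⟩, by simpa using hw⟩

end OracleComputable

open OracleComputable in
theorem exists_isUniversalTTE : ∃ Ψ, IsUniversalTTE Ψ := by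
  -- `V ⟨⟨e, i⟩, s⟩` runs program `e` on the segment with code `s` and the argument `i`
  let V : ℕ →. ℕ := fun n => Nat.Partrec.Code.eval (Denumerable.ofNat _ n.unpair.1.unpair.1)
    (Nat.pair n.unpair.2 n.unpair.1.unpair.2)
  have hV : Nat.Partrec V := by
    rw [← Partrec.nat_iff]
    have h1 : Primrec fun n : ℕ => n.unpair.1.unpair := Primrec.unpair.comp (Primrec.fst.comp .unpair)
    exact Nat.Partrec.Code.eval_part.comp
      ((Computable.ofNat _).comp (Primrec.fst.comp h1).to_comp)
      (Primrec₂.natPair.comp (Primrec.snd.comp .unpair) (Primrec.snd.comp h1)).to_comp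
  have hV' : OracleComputable fun x n =>
      V (Nat.pair n.unpair.1 (Encodable.encode (initialSegment x n.unpair.2))) := by
    convert OracleComputable.comp (of_partrec hV)
      (.pair .left (.comp computable_initialSegment .right)) using 3
    simp
  have hsub : Nat.Partrec fun n => Part.some (1 - n) :=
    Partrec.nat_iff.1 (Primrec.nat_sub.comp (.const 1) .id).to_comp.partrec
  have hpred : Nat.Partrec fun n => Part.some n.pred :=
    Partrec.nat_iff.1 Primrec.pred.to_comp.partrec
  have hs : OracleComputable fun _ n => Part.some n := by
    convert OracleComputable.pair .left .right using 3
    simp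
  have hU := OracleComputable.comp (.comp (of_partrec hpred) hV')
    (.pair hs (.rfind (.comp (of_partrec hsub) hV')))
  set U : Baire → ℕ →. ℕ := _ with hUdef
  replace hU : OracleComputable U := hU
  refine ⟨fun e x => ⟨∀ i, (U x (Nat.pair e i)).Dom, fun h i => (U x (Nat.pair e i)).get (h i)⟩,
    ⟨U, hU, ?_⟩, ?_⟩
  · intro e x y
    constructor
    · rintro ⟨h, rfl⟩ i
      exact Part.get_mem (h i)
    · intro h
      exact ⟨fun i => Part.dom_iff_mem.2 ⟨_, h i⟩, funext fun i => Part.get_eq_of_mem (h i) (Part.dom_iff_mem.2 ⟨_, h i⟩)⟩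
  · rintro F ⟨M, hM, hF⟩
    obtain ⟨a, ha, hm, hs'⟩ := exists_approximation hM
    let A : ℕ → ℕ := fun n => Encodable.encode
      (((Encodable.decode (α := List ℕ) n.unpair.1).bind fun l => a l n.unpair.2))
    have hA : Nat.Partrec (A : ℕ →. ℕ) := by
      refine Partrec.nat_iff.1 (Primrec.to_comp ?_).partrec
      exact Primrec.encode.comp (Primrec.option_bind (Primrec.decode.comp (Primrec.fst.comp .unpair))
        (ha.comp .snd (Primrec.snd.comp (Primrec.unpair.comp .fst))))
    obtain ⟨c, hc⟩ := Nat.Partrec.Code.exists_code.1 hA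
    refine ⟨Encodable.encode c, fun x => ?_⟩
    have hVe : ∀ i n, V (Nat.pair (Nat.pair (Encodable.encode c) i)
        (Encodable.encode (initialSegment x n))) =
          Part.some (Encodable.encode (a (initialSegment x n) i)) := by
      intro i n
      simp [V, hc, A]
    have key : ∀ i, U x (Nat.pair (Encodable.encode c) i) = M x i := by
      intro i
      refine Part.ext fun v => ?_
      rw [hs', hUdef]
      simp only [Part.bind_some, Nat.unpair_pair, hVe, Part.map_some]
      simp only [Part.mem_bind_iff, Part.mem_map_iff]
      constructor
      · rintro ⟨w, ⟨n, hn, rfl⟩, hv⟩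
        have h1 := Nat.rfind_spec hn
        simp only [Nat.unpair_pair, hVe, Part.mem_some_iff] at hv
        simp only [Part.mem_some_iff] at h1
        refine ⟨n, ?_⟩
        rcases h : a (initialSegment x n) i with _ | t
        · simp [h] at h1
        · simp [h] at hv
          rw [hv]
      · rintro ⟨n, hn⟩
        have h1 : ∃ k, k ∈ Nat.rfind fun n =>
            Part.some (decide (1 - Encodable.encode (a (initialSegment x n) i) = 0)) := by
          obtain ⟨k, hk, -⟩ := Nat.rfind_min' (p := fun n =>
            decide (1 - Encodable.encode (a (initialSegment x n) i) = 0)) (m := n) (by simp [hn])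
          exact ⟨k, hk⟩
        obtain ⟨k, hk⟩ := h1
        refine ⟨_, ⟨k, hk, rfl⟩, ?_⟩
        have h2 := Nat.rfind_spec hk
        simp only [Part.mem_some_iff] at h2
        simp only [Nat.unpair_pair, hVe, Part.mem_some_iff]
        rcases h : a (initialSegment x k) i with _ | t
        · simp [h] at h2
        · have e1 := hm _ _ _ _ _ (le_max_left k n) h
          have e2 := hm _ _ _ _ _ (le_max_right k n) hn
          have e3 : v = t := Option.some_injective _ (e2.symm.trans e1)
          simp [e3]
    refine Part.ext fun y => ?_
    rw [hF]
    simp only [← key]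
    constructor
    · intro h
      exact ⟨fun i => Part.dom_iff_mem.2 ⟨_, h i⟩, funext fun i => Part.get_eq_of_mem (h i) (Part.dom_iff_mem.2 ⟨_, h i⟩)⟩
    · rintro ⟨h, rfl⟩ i
      exact Part.get_mem (h i)

/-! ## Partial recursive functions over Baire space -/

namespace MixedFun

variable {p q r s : ℕ} {Y : Codomain}

/-- Composition `f (g₁ (m; y), …, g_p (m; y); h₁ (m; y), …, h_q (m; y))`; it is defined when all
inner values are and `f` is defined on them. -/
def comp (f : MixedFun p q Y) (g : Fin p → MixedFun r s .nat) (h : Fin q → MixedFun r s .baire) :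
    MixedFun r s Y := fun m y =>
  (Part.tuple fun i => g i m y).bind fun a => (Part.tuple fun j => h j m y).bind fun b => f a b

/-- Primitive recursion with respect to `ℕ`, values in `ℕ`:
`F (0, n; x) = G (n; x)` and `F (k + 1, n; x) = H (k, n, F (k, n; x); x)`. -/
def primRecNat (G : MixedFun p q .nat) (H : MixedFun (p + 2) q .nat) : MixedFun (p + 1) q .nat :=
  fun m x =>
    Nat.rec (G (Fin.tail m) x)
      (fun k ih => ih.bind fun v =>
        H (Fin.cons k (Fin.snoc (Fin.tail m) v : Fin (p + 1) → ℕ) : Fin (p + 2) → ℕ) x) (m 0)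

/-- Primitive recursion with respect to `ℕ`, values in Baire space:
`F (0, n; x) = G (n; x)` and `F (k + 1, n; x) = H (k, n; x, F (k, n; x))`. -/
def primRecBaire (G : MixedFun p q .baire) (H : MixedFun (p + 1) (q + 1) .baire) :
    MixedFun (p + 1) q .baire := fun m x =>
  Nat.rec (G (Fin.tail m) x)
    (fun k ih => ih.bind fun v =>
      H (Fin.cons k (Fin.tail m) : Fin (p + 1) → ℕ) (Fin.snoc x v : Fin (q + 1) → Baire)) (m 0)

/-- The `μ`-operator with respect to `ℕ`: the least `k` with `G (k, n; x) = 0` such that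
`G (k', n; x)` is defined and nonzero for all `k' < k`. -/
def mu (G : MixedFun (p + 1) q .nat) : MixedFun p q .nat := fun n x =>
  Nat.rfind fun k => (G (Fin.cons k n : Fin (p + 1) → ℕ) x).map fun m => decide (m = 0)

end MixedFun

open Classical in
/-- The characteristic function of `{0}` in Baire space. -/
noncomputable def zeroChar (x : Baire) : ℕ := if x = 0 then 1 else 0

/-- The class of partial recursive functions over Baire space, with `Ψ` the universal TTE-computable
function. The universal function for `q` arguments in Baire space is
`Ψ (e; x₁, …, x_q) = Ψ (e; ⟨x₁, …, x_q⟩)`. -/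
inductive PartRecOverBaire (Ψ : ℕ → Baire →. Baire) :
    (p q : ℕ) → (Y : Codomain) → MixedFun p q Y → Prop
  | zero : PartRecOverBaire Ψ 1 0 .nat fun _ _ => Part.some 0
  | succ : PartRecOverBaire Ψ 1 0 .nat fun n _ => Part.some (n 0 + 1)
  | projNat (p q : ℕ) (i : Fin p) : PartRecOverBaire Ψ p q .nat fun n _ => Part.some (n i)
  | projBaire (p q : ℕ) (j : Fin q) : PartRecOverBaire Ψ p q .baire fun _ x => Part.some (x j)
  | universal (q : ℕ) : PartRecOverBaire Ψ 1 q .baire fun n x => Ψ (n 0) (interleave x)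
  | isZero : PartRecOverBaire Ψ 0 1 .nat fun _ x => Part.some (zeroChar (x 0))
  | comp {p q r s : ℕ} {Y : Codomain} {f : MixedFun p q Y} {g : Fin p → MixedFun r s .nat}
      {h : Fin q → MixedFun r s .baire} (hf : PartRecOverBaire Ψ p q Y f)
      (hg : ∀ i, PartRecOverBaire Ψ r s .nat (g i))
      (hh : ∀ j, PartRecOverBaire Ψ r s .baire (h j)) :
      PartRecOverBaire Ψ r s Y (f.comp g h)
  | primRecNat {p q : ℕ} {G : MixedFun p q .nat} {H : MixedFun (p + 2) q .nat}
      (hG : PartRecOverBaire Ψ p q .nat G) (hH : PartRecOverBaire Ψ (p + 2) q .nat H) :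
      PartRecOverBaire Ψ (p + 1) q .nat (MixedFun.primRecNat G H)
  | primRecBaire {p q : ℕ} {G : MixedFun p q .baire} {H : MixedFun (p + 1) (q + 1) .baire}
      (hG : PartRecOverBaire Ψ p q .baire G)
      (hH : PartRecOverBaire Ψ (p + 1) (q + 1) .baire H) :
      PartRecOverBaire Ψ (p + 1) q .baire (MixedFun.primRecBaire G H)
  | mu {p q : ℕ} {G : MixedFun (p + 1) q .nat} (hG : PartRecOverBaire Ψ (p + 1) q .nat G) :
      PartRecOverBaire Ψ p q .nat (MixedFun.mu G)

/-! ## Master-slave machines -/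

/-- The tapes of the master. -/
inductive MasterTape (k : ℕ) : Type
  | input : MasterTape k
  | billboard : MasterTape k
  | output : MasterTape k
  | work (i : Fin k) : MasterTape k

/-- The states of the master: the states in `Q` of a standard Turing machine, and the two special
states for calling the slaves and for the zero-test. -/
inductive MasterState (Q : Type) : Type
  | std (q : Q) : MasterState Q
  | call : MasterState Q
  | test : MasterState Q

/-- A master-slave machine, identified with the program of the master, which is a Turing machine
with finitely many tapes. In a standard state the next state, and what to do on each tape (write a
symbol, or move left or right), depend on the state, the symbols under the heads and the Boolean
bit. The states `call` and `test` each have one successor. -/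
structure MSMachine where
  /-- The standard states. -/
  Q : Type
  finQ : Finite Q
  /-- The alphabet; its default element is the blank. -/
  Γ : Type
  finΓ : Finite Γ
  blank : Inhabited Γ
  /-- The symbol in which numbers are written. -/
  one : Γ
  one_ne_blank : one ≠ default
  start : Q
  halt : Q
  /-- The number of work tapes of the master. -/
  workTapes : ℕ
  trans : Q → (MasterTape workTapes → Γ) → Bool →
    (MasterTape workTapes → Turing.TM0.Stmt Γ) × MasterState Q
  afterCall : MasterState Q
  afterTest : MasterState Q

attribute [instance] MSMachine.blank

/-- Executing a write or move command on a tape. -/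
def Turing.Tape.exec {Γ : Type} [Inhabited Γ] (T : Turing.Tape Γ) :
    Turing.TM0.Stmt Γ → Turing.Tape Γ
  | .move d => T.move d
  | .write a => T.write a

namespace MSMachine

variable (M : MSMachine)

/-- A configuration: the state, tapes and Boolean bit of the master, and the contents of the tapes
shared by the slaves. -/
structure Config where
  state : MasterState M.Q
  tape : MasterTape M.workTapes → Turing.Tape M.Γ
  bit : Bool
  slaveInput : Baire
  slaveWork : Baire
  zeroTest : Baire
  slaveOutput : Baire

/-- The number written on a tape is the number of its cells that contain `one`. -/
noncomputable def number (T : Turing.Tape M.Γ) : ℕ := Set.ncard {z : ℤ | T.nth z = M.one}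

/-- An input tuple `(n₁, …, n_p)`: blocks of `n_i + 1` symbols `one`, each followed by a blank. -/
def inputWord {p : ℕ} (n : Fin p → ℕ) : List M.Γ :=
  (List.ofFn n).flatMap fun a => List.replicate (a + 1) M.one ++ [default]

/-- The initial configuration: the numbers are on the input tape of the master, with the head on
the first symbol, the interleaved sequences are on the input tape of the slaves, and everything
else is empty. -/
def init {p q : ℕ} (n : Fin p → ℕ) (x : Fin q → Baire) : M.Config where
  state := .std M.start
  tape := fun t => match t with
    | .input => Turing.Tape.mk₁ (M.inputWord n)
    | _ => Turing.Tape.mk₁ []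
  bit := false
  slaveInput := interleave x
  slaveWork := 0
  zeroTest := 0
  slaveOutput := 0

/-- `M.Yields Ψ C D`: the configuration `C` yields `D`. A terminal configuration yields nothing.
In a slave call, the `i`-th slave computes the `i`-th entry of `Ψ (b; y)`, where `b` is the number on
the billboard and the oracle `y` interleaves the input tape and the work tape of the slaves. The
slaves thereby write the work tape, the zero-test tape and the output tape, which are the three
tracks of the result. If some slave does not halt, there is no next configuration. A zero-test
stores in the Boolean bit whether the sequence on the zero-test tape is the zero sequence. -/
inductive Yields (Ψ : ℕ → Baire →. Baire) : M.Config → M.Config → Prop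
  | std (C : M.Config) (q : M.Q) (hC : C.state = .std q) (hq : q ≠ M.halt) :
      Yields Ψ C
        { C with
          state := (M.trans q (fun t => (C.tape t).head) C.bit).2
          tape := fun t =>
            (C.tape t).exec ((M.trans q (fun t => (C.tape t).head) C.bit).1 t) }
  | call (C : M.Config) (z : Baire) (hC : C.state = .call)
      (hz : z ∈ Ψ (M.number (C.tape .billboard)) (interleave ![C.slaveInput, C.slaveWork])) :
      Yields Ψ C
        { C with
          state := M.afterCall
          slaveWork := track 3 0 z
          zeroTest := track 3 1 z
          slaveOutput := track 3 2 z }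
  | test (C : M.Config) (b : Bool) (hC : C.state = .test) (hb : b = true ↔ C.zeroTest = 0) :
      Yields Ψ C { C with state := M.afterTest, bit := b }

/-- The output of a configuration: the number on the output tape of the master, or the sequence on
the output tape of the slaves, depending on the codomain. -/
noncomputable def output (C : M.Config) : (Y : Codomain) → Y.Elem
  | .nat => M.number (C.tape .output)
  | .baire => C.slaveOutput

/-- `M` computes `f`: `f (n; x) = v` iff the computation of `M` on input `(n; x)` reaches a
terminal configuration with output `v`. Otherwise the computation is infinite, or ends in a slave
call in which some slave does not halt, and `f (n; x)` is undefined. -/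
def Computes (Ψ : ℕ → Baire →. Baire) {p q : ℕ} {Y : Codomain} (f : MixedFun p q Y) : Prop :=
  ∀ n x v, v ∈ f n x ↔
    ∃ C, Relation.ReflTransGen (M.Yields Ψ) (M.init n x) C ∧ C.state = .std M.halt ∧
      M.output C Y = v

end MSMachine

/-- `f` is MS-computable over Baire space, where the slaves are universal machines for `Ψ`. -/
def MSComputable (Ψ : ℕ → Baire →. Baire) {p q : ℕ} {Y : Codomain} (f : MixedFun p q Y) : Prop :=
  ∃ M : MSMachine, M.Computes Ψ f

/-! Both models amount to iterating TTE-computable operations on single points of Baire space, with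
the zero-test as the only discontinuous ingredient. Partial functions are treated as relations, so
that divergence is the absence of a related point.

From recursion to machines. Numbers are coded by constant sequences and argument lists by iterated
pairs; a function of mixed type becomes a relation on Baire space. By induction on the schemes,
these relations are computed by while programs that are built from oracle computations and from
loops controlled by zero-tests (`PartRecOverBaire.whileRel`); primitive recursion and the
`μ`-operator become loops with a counter coded as a constant sequence. By universality every oracle
computation has an index, so one slave call with a fixed number on the billboard executes it on the
work tape of the slaves, and the bit controls the loops (`Env.exists_implements`). The slaves also
turn the unary input into entries of a sequence, and a countdown turns a constant sequence into
unary output. Flowcharts serve as an intermediate language. Since the states `call` and `test` have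
only one successor each, the machine of a flowchart cannot remember in its state where to continue;
it keeps its control point on a work tape (`FlowChart.machine`).

From machines to recursion. State, bit and tapes of the master are a finite object, on whose Gödel
number a step of the master is primitive recursive. A configuration is therefore coded by one
sequence (`MSMachine.snapshot`), and a step is a composition of the universal function for the slave
call, of `zeroChar` for the zero-test and of a TTE-computable update (`MSMachine.exists_step`).
Iterating it by primitive recursion with values in Baire space, searching for the first halting
stage with `μ` and reading off the output gives a Kleene normal form
(`MSMachine.computes_partRecOverBaire`). Primitive recursive arithmetic need not be derived from the
schemes: a number is turned into a constant sequence, processed by the universal function, and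
recovered by a search (`PartRecOverBaire.head`). -/

/-! ## Closure properties of oracle computations -/

/-- Total oracle computations. -/
def OracleTotal (g : Baire → ℕ → ℕ) : Prop := OracleComputable fun x n => Part.some (g x n)

namespace OracleTotal

theorem of_primrec {φ : ℕ → ℕ} (h : Primrec φ) : OracleTotal fun _ n => φ n :=
  OracleComputable.of_partrec (g := fun n => Part.some (φ n)) (Partrec.nat_iff.1 h.to_comp.partrec)

theorem arg : OracleTotal fun _ n => n := of_primrec .id

theorem const (c : ℕ) : OracleTotal fun _ _ => c := of_primrec (.const c)

theorem oracle : OracleTotal fun x n => x n := OracleComputable.oracle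

theorem comp {g h : Baire → ℕ → ℕ} (hg : OracleTotal g) (hh : OracleTotal h) :
    OracleTotal fun x n => g x (h x n) := by
  have := OracleComputable.comp hg hh
  simpa [OracleTotal] using this

theorem map {φ : ℕ → ℕ} (hφ : Primrec φ) {g : Baire → ℕ → ℕ} (hg : OracleTotal g) :
    OracleTotal fun x n => φ (g x n) :=
  (of_primrec hφ).comp hg

theorem map₂ {φ : ℕ → ℕ → ℕ} (hφ : Primrec₂ φ) {g h : Baire → ℕ → ℕ} (hg : OracleTotal g)
    (hh : OracleTotal h) : OracleTotal fun x n => φ (g x n) (h x n) := by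
  have h1 : OracleTotal fun x n => Nat.pair (g x n) (h x n) := by
    have := OracleComputable.pair hg hh
    simpa [OracleTotal] using this
  have h2 : Primrec fun m : ℕ => φ m.unpair.1 m.unpair.2 :=
    hφ.comp (Primrec.fst.comp .unpair) (Primrec.snd.comp .unpair)
  simpa using map h2 h1

/-- Access to the oracle at a computable place. -/
theorem oracle_at {φ : ℕ → ℕ} (hφ : Primrec φ) : OracleTotal fun x n => x (φ n) :=
  oracle.comp (of_primrec hφ)

theorem ite {c g h : Baire → ℕ → ℕ} (hc : OracleTotal c) (hg : OracleTotal g)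
    (hh : OracleTotal h) : OracleTotal fun x n => if c x n = 0 then g x n else h x n := by
  have h1 : OracleTotal fun x n => Nat.pair (g x n) (h x n) := map₂ Primrec₂.natPair hg hh
  have h2 : Primrec₂ fun a b : ℕ => if a = 0 then b.unpair.1 else b.unpair.2 :=
    Primrec.ite (Primrec.eq.comp .fst (.const 0))
      (Primrec.fst.comp (Primrec.unpair.comp .snd)) (Primrec.snd.comp (Primrec.unpair.comp .snd))
  simpa using map₂ h2 hc h1

theorem cond (c : ℕ → Prop) [DecidablePred c] (hc : PrimrecPred c) {g h : Baire → ℕ → ℕ}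
    (hg : OracleTotal g) (hh : OracleTotal h) :
    OracleTotal fun x n => if c n then g x n else h x n := by
  have h1 : OracleTotal fun _ n => if c n then 0 else 1 :=
    of_primrec (Primrec.ite hc (.const 0) (.const 1))
  convert ite h1 hg hh using 4
  split_ifs <;> simp_all

end OracleTotal

namespace OracleComputable

/-- Substitution of a computable oracle. -/
theorem subst {M : Baire → ℕ →. ℕ} (hM : OracleComputable M) {g : Baire → ℕ → ℕ}
    (hg : OracleTotal g) : OracleComputable fun x n => M (g x) n := by
  induction hM with
  | zero => exact .zero
  | succ => exact .succ
  | left => exact .left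
  | right => exact .right
  | oracle => exact hg
  | pair _ _ h₁ h₂ => exact .pair h₁ h₂
  | comp _ _ h₁ h₂ => exact .comp h₁ h₂
  | prec _ _ h₁ h₂ => exact .prec h₁ h₂
  | rfind _ h => exact .rfind h

theorem comp_total {M : Baire → ℕ →. ℕ} (hM : OracleComputable M) {g : Baire → ℕ → ℕ}
    (hg : OracleTotal g) : OracleComputable fun x n => M x (g x n) := by
  exact of_eq (OracleComputable.comp hM hg) fun x n => Part.bind_some _ _

theorem map₂ {φ : ℕ → ℕ → ℕ} (hφ : Primrec₂ φ) {M : Baire → ℕ →. ℕ} {g : Baire → ℕ → ℕ}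
    (hM : OracleComputable M) (hg : OracleTotal g) :
    OracleComputable fun x n => (M x n).map fun a => φ a (g x n) := by
  have h2 : Primrec fun m : ℕ => φ m.unpair.1 m.unpair.2 :=
    hφ.comp (Primrec.fst.comp .unpair) (Primrec.snd.comp .unpair)
  have := OracleComputable.comp (OracleTotal.of_primrec h2) (.pair hM hg)
  refine of_eq this fun x n => ?_
  ext v
  simp [Part.mem_bind_iff, eq_comm]

end OracleComputable

theorem OracleTotal.subst {g h : Baire → ℕ → ℕ} (hg : OracleTotal g) (hh : OracleTotal h) :
    OracleTotal fun x n => g (h x) n :=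
  OracleComputable.subst hg hh

/-- The partial function on Baire space given by an oracle computation. -/
def OracleComputable.toFun (M : Baire → ℕ →. ℕ) : Baire →. Baire := fun x =>
  ⟨∀ i, (M x i).Dom, fun h i => (M x i).get (h i)⟩

theorem OracleComputable.mem_toFun {M : Baire → ℕ →. ℕ} {x y : Baire} :
    y ∈ toFun M x ↔ ∀ i, y i ∈ M x i := by
  constructor
  · rintro ⟨h, rfl⟩ i
    exact Part.get_mem (h i)
  · intro h
    exact ⟨fun i => Part.dom_iff_mem.2 ⟨_, h i⟩,
      funext fun i => Part.get_eq_of_mem (h i) (Part.dom_iff_mem.2 ⟨_, h i⟩)⟩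

/-- This is the only use of universality: through it, closure properties of oracle computations
yield indices for the billboard and for the universal function. -/
theorem IsUniversalTTE.exists_index {Ψ : ℕ → Baire →. Baire} (hΨ : IsUniversalTTE Ψ)
    {M : Baire → ℕ →. ℕ} (hM : OracleComputable M) :
    ∃ e, ∀ x y, y ∈ Ψ e x ↔ ∀ i, y i ∈ M x i := by
  obtain ⟨e, he⟩ := hΨ.universal (OracleComputable.toFun M)
    ⟨M, hM, fun x y => OracleComputable.mem_toFun⟩
  exact ⟨e, fun x y => by rw [← he, OracleComputable.mem_toFun]⟩

theorem IsUniversalTTE.exists_index_total {Ψ : ℕ → Baire →. Baire} (hΨ : IsUniversalTTE Ψ)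
    {g : Baire → ℕ → ℕ} (hg : OracleTotal g) : ∃ e, ∀ x, Ψ e x = Part.some (g x) := by
  obtain ⟨e, he⟩ := hΨ.exists_index hg
  refine ⟨e, fun x => Part.ext fun y => ?_⟩
  rw [he]
  simp [funext_iff]

/-! ## Pairs of sequences -/

/-- The pair of two sequences. -/
def bpair (a b : Baire) : Baire := interleave ![a, b]

/-- The first component of a pair. -/
def bfst (s : Baire) : Baire := track 2 0 s

/-- The second component of a pair. -/
def bsnd (s : Baire) : Baire := track 2 1 s

/-- The constant sequence, as a code of a number. -/
def hat (n : ℕ) : Baire := fun _ => n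

@[simp] theorem hat_apply (n i : ℕ) : hat n i = n := rfl

theorem hat_eq_zero {n : ℕ} : hat n = 0 ↔ n = 0 := by
  constructor
  · intro h; simpa using congrFun h 0
  · rintro rfl; rfl

theorem bpair_apply (a b : Baire) (n : ℕ) :
    bpair a b n = if n % 2 = 0 then a (n / 2) else b (n / 2) := by
  rcases Nat.mod_two_eq_zero_or_one n with h | h <;> simp [bpair, interleave, h]

theorem bfst_apply (s : Baire) (n : ℕ) : bfst s n = s (2 * n) := rfl

theorem bsnd_apply (s : Baire) (n : ℕ) : bsnd s n = s (2 * n + 1) := rfl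

@[simp] theorem bfst_bpair (a b : Baire) : bfst (bpair a b) = a := by
  funext n
  simp [bfst_apply, bpair_apply]

@[simp] theorem bsnd_bpair (a b : Baire) : bsnd (bpair a b) = b := by
  funext n
  simp [bsnd_apply, bpair_apply, Nat.mul_add_div]

@[simp] theorem bpair_bfst_bsnd (s : Baire) : bpair (bfst s) (bsnd s) = s := by
  funext n
  rw [bpair_apply, bfst_apply, bsnd_apply]
  split_ifs with h <;> congr 1 <;> omega

theorem interleave_one (x : Fin 1 → Baire) : interleave x = x 0 := by
  funext k
  simp [interleave, Fin.eq_zero, Nat.mod_one]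

theorem interleave_track {q : ℕ} (x : Fin q → Baire) (j : Fin q) :
    track q j (interleave x) = x j := by
  funext i
  have hq : 0 < q := j.pos
  have h1 : (q * i + j) % q = j := by
    rw [Nat.mul_add_mod, Nat.mod_eq_of_lt j.2]
  have h2 : (q * i + j) / q = i := by
    rw [Nat.mul_add_div hq, Nat.div_eq_of_lt j.2, Nat.add_zero]
  simp [track, interleave, hq, h1, h2]

namespace OracleTotal

theorem id : OracleTotal fun x => x := oracle

theorem bfst : OracleTotal bfst :=
  oracle_at (φ := fun n => 2 * n) (Primrec.nat_mul.comp (.const 2) .id)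

theorem bsnd : OracleTotal bsnd :=
  oracle_at (φ := fun n => 2 * n + 1) (Primrec.succ.comp (Primrec.nat_mul.comp (.const 2) .id))

theorem div_const (k : ℕ) : Primrec fun n : ℕ => n / k := Primrec.nat_div.comp .id (.const k)

theorem mod_const (k : ℕ) : Primrec fun n : ℕ => n % k := Primrec.nat_mod.comp .id (.const k)

theorem bpair {g h : Baire → Baire} (hg : OracleTotal g) (hh : OracleTotal h) :
    OracleTotal fun x => bpair (g x) (h x) := by
  have := cond (fun n => n % 2 = 0) (Primrec.eq.comp (mod_const 2) (.const 0))
    (hg.comp (of_primrec (div_const 2))) (hh.comp (of_primrec (div_const 2)))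
  convert this using 3
  rw [bpair_apply]

theorem hat {g : Baire → ℕ → ℕ} (hg : OracleTotal g) (i : ℕ) :
    OracleTotal fun x => hat (g x i) :=
  hg.comp (const i)

theorem hat_const (c : ℕ) : OracleTotal fun _ => _root_.hat c := const c

end OracleTotal

/-! ## While programs on Baire space -/

/-- The relation computed by the loop `while c do R`. -/
inductive LoopRel {D : Type} (c : D → Prop) (R : D → D → Prop) : D → D → Prop
  | done (s : D) (h : ¬ c s) : LoopRel c R s s
  | step (s u v : D) (h : c s) (hR : R s u) (hL : LoopRel c R u v) : LoopRel c R s v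

theorem loopRel_iff {D : Type} {c : D → Prop} {R : D → D → Prop} {s v : D} :
    LoopRel c R s v ↔ (¬ c s ∧ s = v) ∨ (c s ∧ ∃ u, R s u ∧ LoopRel c R u v) := by
  constructor
  · rintro (⟨_, h⟩ | ⟨_, u, _, h, hR, hL⟩)
    · exact .inl ⟨h, rfl⟩
    · exact .inr ⟨h, u, hR, hL⟩
  · rintro (⟨h, rfl⟩ | ⟨h, u, hR, hL⟩)
    · exact .done _ h
    · exact .step _ u _ h hR hL

/-- Relations on Baire space computed by while programs, whose basic instructions are oracle
computations and whose loops are controlled by zero-tests. -/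
inductive WhileRel : (Baire → Baire → Prop) → Prop
  | oracle {M : Baire → ℕ →. ℕ} (hM : OracleComputable M) : WhileRel fun s u => ∀ i, u i ∈ M s i
  | comp {R R' : Baire → Baire → Prop} (hR : WhileRel R) (hR' : WhileRel R') :
      WhileRel fun s v => ∃ u, R s u ∧ R' u v
  | loop {t : Baire → Baire} (ht : OracleTotal t) {R : Baire → Baire → Prop} (hR : WhileRel R) :
      WhileRel (LoopRel (fun s => t s ≠ 0) R)

namespace WhileRel

variable {R R' : Baire → Baire → Prop}

theorem of_iff (h : WhileRel R) (h' : ∀ s u, R s u ↔ R' s u) : WhileRel R' :=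
  (funext fun s => funext fun u => propext (h' s u) : R = R') ▸ h

theorem total {g : Baire → Baire} (hg : OracleTotal g) : WhileRel fun s u => u = g s :=
  (WhileRel.oracle hg).of_iff fun s u => by simp [funext_iff]

theorem comp_total (hR : WhileRel R) {g : Baire → Baire} (hg : OracleTotal g) :
    WhileRel fun s u => R (g s) u :=
  ((total hg).comp hR).of_iff fun s u => by simp

theorem total_comp (hR : WhileRel R) {g : Baire → Baire} (hg : OracleTotal g) :
    WhileRel fun s v => ∃ u, R s u ∧ v = g u :=
  hR.comp (total hg)

/-- A program can be run on the first component of a pair. -/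
theorem first (hR : WhileRel R) :
    WhileRel fun s u => ∃ a, R (bfst s) a ∧ u = bpair a (bsnd s) := by
  induction hR with
  | @oracle M hM =>
    -- The value at `n / 2` is computed at odd positions too and then discarded in favour of the old
    -- entry. This causes no additional divergence, because the even positions already require every
    -- value of `M (bfst s)`.
    have h1 : OracleComputable fun s n => M (bfst s) (n / 2) :=
      (hM.subst .bfst).comp_total (.of_primrec (OracleTotal.div_const 2))
    have h2 : Primrec₂ fun a b : ℕ => if b.unpair.1 % 2 = 0 then a else b.unpair.2 :=
      Primrec.ite (Primrec.eq.comp ((OracleTotal.mod_const 2).comp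
        (Primrec.fst.comp (Primrec.unpair.comp .snd))) (.const 0)) .fst
        (Primrec.snd.comp (Primrec.unpair.comp .snd))
    refine (WhileRel.oracle (OracleComputable.map₂ h2 h1
      (OracleTotal.map₂ Primrec₂.natPair .arg .oracle))).of_iff fun s u => ?_
    simp only [Nat.unpair_pair, Part.mem_map_iff]
    constructor
    · intro h
      choose a ha hau using h
      have hev : ∀ i, u (2 * i) ∈ M (bfst s) i := by
        intro i
        have h1 := ha (2 * i)
        have h2 := hau (2 * i)
        rw [if_pos (by omega)] at h2
        rw [← h2]
        convert h1 using 1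
        simp
      refine ⟨bfst u, hev, funext fun n => ?_⟩
      rw [bpair_apply]
      split_ifs with h
      · rw [bfst_apply]; congr 1; omega
      · have := hau n
        rw [if_neg h] at this
        rw [← this, bsnd_apply]; congr 1; omega
    · rintro ⟨a, ha, rfl⟩ i
      refine ⟨a (i / 2), ha _, ?_⟩
      rw [bpair_apply, bsnd_apply]
      split_ifs with h
      · rfl
      · congr 1; omega
  | comp _ _ h1 h2 =>
    refine (h1.comp h2).of_iff fun s u => ?_
    constructor
    · rintro ⟨_, ⟨a, ha, rfl⟩, b, hb, rfl⟩
      exact ⟨b, ⟨a, ha, by simpa using hb⟩, by simp⟩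
    · rintro ⟨b, ⟨a, ha, hb⟩, rfl⟩
      exact ⟨_, ⟨a, ha, rfl⟩, b, by simpa using hb, by simp⟩
  | @loop t ht R _ h =>
    refine (h.loop (ht.subst .bfst)).of_iff fun s u => ?_
    constructor
    · intro h
      induction h with
      | done s h => exact ⟨_, .done _ h, by simp⟩
      | step s u v h hR _ ih =>
        obtain ⟨a, ha, rfl⟩ := hR
        obtain ⟨b, hb, rfl⟩ := ih
        exact ⟨b, .step _ a _ h ha (by simpa using hb), by simp⟩
    · rintro ⟨a, ha, rfl⟩
      generalize hb : bfst s = b at ha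
      induction ha generalizing s with
      | done b h =>
        subst hb
        rw [bpair_bfst_bsnd]
        exact .done _ h
      | step b u v h hR _ ih =>
        subst hb
        refine .step _ (bpair u (bsnd s)) _ h ⟨u, hR, rfl⟩ ?_
        simpa using ih (bpair u (bsnd s)) (by simp)

theorem swap : WhileRel fun s u => u = bpair (bsnd s) (bfst s) :=
  total (.bpair .bsnd .bfst)

theorem second (hR : WhileRel R) :
    WhileRel fun s u => ∃ a, R (bsnd s) a ∧ u = bpair (bfst s) a :=
  ((swap.comp hR.first).comp swap).of_iff fun s u => by simp

/-- The input is duplicated, and each program runs on its own copy. -/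
theorem pair (hR : WhileRel R) (hR' : WhileRel R') :
    WhileRel fun s u => ∃ a b, R s a ∧ R' s b ∧ u = bpair a b :=
  ((hR.first.comp hR'.second).comp_total (.bpair .id .id)).of_iff fun s u => by
    simp

end WhileRel

/-! ### Tuples of sequences -/

/-- The entry of a tuple at position `j`. -/
def entry (j : ℕ) (s : Baire) : Baire := bfst (bsnd^[j] s)

/-- Tuples as iterated pairs. -/
def btuple : {m : ℕ} → (Fin m → Baire) → Baire
  | 0, _ => 0
  | _ + 1, a => bpair (a 0) (btuple (Fin.tail a))

@[simp] theorem entry_btuple {m : ℕ} (a : Fin m → Baire) (j : Fin m) :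
    entry j (btuple a) = a j := by
  induction m with
  | zero => exact j.elim0
  | succ m ih =>
    refine Fin.cases ?_ (fun j => ?_) j
    · simp [entry, btuple]
    · have := ih (Fin.tail a) j
      simpa [entry, btuple, Fin.tail] using this

theorem OracleTotal.entry (j : ℕ) : OracleTotal (entry j) := by
  have : OracleTotal fun s => _root_.bsnd^[j] s := by
    induction j with
    | zero => exact .id
    | succ j ih => exact OracleTotal.subst (h := _root_.bsnd) ih .bsnd
  exact OracleTotal.bfst.subst this

theorem OracleTotal.btuple {m : ℕ} {g : Fin m → Baire → Baire} (hg : ∀ i, OracleTotal (g i)) :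
    OracleTotal fun s => btuple fun i => g i s := by
  induction m with
  | zero => exact .const 0
  | succ m ih => exact .bpair (hg 0) (ih fun i => hg i.succ)

theorem WhileRel.tuple {m : ℕ} {R : Fin m → Baire → Baire → Prop} (hR : ∀ i, WhileRel (R i)) :
    WhileRel fun s u => ∃ a : Fin m → Baire, (∀ i, R i s (a i)) ∧ u = btuple a := by
  induction m with
  | zero => exact (total (.const 0)).of_iff fun s u => by simp [btuple]; rfl
  | succ m ih =>
    refine ((hR 0).pair (ih fun i => hR i.succ)).of_iff fun s u => ?_
    constructor
    · rintro ⟨a, _, ha, ⟨b, hb, rfl⟩, rfl⟩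
      exact ⟨Fin.cons a b, Fin.cases ha hb, by simp [btuple]⟩
    · rintro ⟨a, ha, rfl⟩
      exact ⟨a 0, _, ha 0, ⟨Fin.tail a, fun i => ha i.succ, rfl⟩, rfl⟩

/-! ### Iteration and minimization -/

/-- The `n`-th iterate of a relation. -/
def RelIter (R : Baire → Baire → Prop) : ℕ → Baire → Baire → Prop
  | 0, s, u => s = u
  | n + 1, s, u => ∃ w, R s w ∧ RelIter R n w u

/-- Splitting off the last step instead of the first matches primitive recursion, where the step is
applied to the value of the previous stage. -/
theorem relIter_succ' {R : Baire → Baire → Prop} {n : ℕ} {s u : Baire} :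
    RelIter R (n + 1) s u ↔ ∃ w, RelIter R n s w ∧ R w u := by
  induction n generalizing s with
  | zero => simp [RelIter]
  | succ n ih =>
    rw [RelIter]
    simp only [ih]
    simp only [RelIter]
    grind

namespace WhileRel

variable {R : Baire → Baire → Prop}

/-- A loop that decreases a counter. The counter is a constant sequence, which is zero exactly when
the number is, so a zero-test can control the loop. -/
theorem iterate (hR : WhileRel R) :
    WhileRel fun s u => RelIter R (bfst s 0) (bsnd s) u := by
  have hdec : OracleTotal fun s => bpair (hat ((bfst s 0).pred)) (bsnd s) :=
    .bpair ((OracleTotal.bfst.map Primrec.pred).hat 0) .bsnd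
  -- Only entry `0` of the first component matters, but the loop tests the whole sequence; hence the
  -- counter is first made constant.
  have hinit : OracleTotal fun s => bpair (hat (bfst s 0)) (bsnd s) :=
    .bpair (OracleTotal.bfst.hat 0) .bsnd
  refine (((hR.second.total_comp hdec).loop .bfst).comp_total hinit |>.total_comp .bsnd).of_iff
    fun s u => ?_
  have key : ∀ n s v, LoopRel (fun s => bfst s ≠ 0) (fun s v => ∃ u,
      (∃ a, R (bsnd s) a ∧ u = bpair (bfst s) a) ∧
        v = bpair (hat (bfst u 0).pred) (bsnd u)) (bpair (hat n) s) v ↔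
      ∃ u, RelIter R n s u ∧ v = bpair 0 u := by
    intro n
    induction n with
    | zero =>
      intro s v
      rw [loopRel_iff]
      have : hat 0 = 0 := rfl
      simp [RelIter, this, eq_comm]
    | succ n ih =>
      intro s v
      rw [loopRel_iff]
      have : hat (n + 1) ≠ 0 := by simp [hat_eq_zero]
      simp only [bfst_bpair, bsnd_bpair, this, ne_eq, not_true_eq_false, false_and, not_false_iff,
        true_and, false_or, RelIter]
      constructor
      · rintro ⟨_, ⟨_, ⟨a, ha, rfl⟩, rfl⟩, h⟩
        simp only [bfst_bpair, bsnd_bpair, hat_apply, Nat.pred_succ, ih] at h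
        obtain ⟨u, hu, rfl⟩ := h
        exact ⟨u, ⟨a, ha, hu⟩, rfl⟩
      · rintro ⟨u, ⟨a, ha, hu⟩, rfl⟩
        refine ⟨_, ⟨_, ⟨a, ha, rfl⟩, rfl⟩, ?_⟩
        simp only [bfst_bpair, bsnd_bpair, hat_apply, Nat.pred_succ, ih]
        exact ⟨u, hu, rfl⟩
  simp only [key]
  constructor
  · rintro ⟨_, ⟨u, hu, rfl⟩, rfl⟩
    simpa using hu
  · intro h
    exact ⟨_, ⟨u, h, rfl⟩, by simp⟩

/-- A loop whose body runs at most once is a conditional: from `(t s, 1)` it stops at once if `t s =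
0`, and otherwise moves to `(0, 0)` and stops there. The answer is the second component. -/
theorem zeroChar {t : Baire → Baire} (ht : OracleTotal t) :
    WhileRel fun s u => u = hat (zeroChar (t s)) := by
  have h1 : OracleTotal fun s => bpair (t s) (hat 1) := .bpair ht (.const 1)
  have h2 : OracleTotal fun _ => bpair 0 (hat 0) := .bpair (.const 0) (.const 0)
  refine (((total h2).loop .bfst).comp_total h1 |>.total_comp .bsnd).of_iff fun s u => ?_
  have key : ∀ v, LoopRel (fun s => bfst s ≠ 0) (fun _ u => u = bpair 0 (hat 0))
      (bpair (t s) (hat 1)) v ↔ v = bpair 0 (hat (_root_.zeroChar (t s))) := by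
    intro v
    rw [loopRel_iff]
    by_cases h : t s = 0
    · simp [h, _root_.zeroChar, eq_comm]
    · simp only [bfst_bpair, h, _root_.zeroChar, ne_eq, not_true_eq_false, not_false_iff, false_and,
        false_or, true_and, exists_eq_left, if_false]
      rw [loopRel_iff]
      simp [eq_comm]
  simp [key]

/-- The loop works on triples `(G k s, (k, s))` with numbers as constant sequences. It continues
while the value is nonzero, and its body passes to `k + 1` and evaluates `G` again. The value at `0`
is computed before the loop. -/
theorem rfind {G : ℕ → Baire → Part ℕ}
    (hG : WhileRel fun s u => ∃ v ∈ G (bfst s 0) (bsnd s), u = hat v) :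
    WhileRel fun s u => ∃ k ∈ Nat.rfind fun k => (G k s).map fun m => decide (m = 0), u = hat k := by
  have hP := hG.pair (total .id)
  have hinit : OracleTotal fun s => bpair (hat 0) s := .bpair (.const 0) .id
  have hinc : OracleTotal fun s => bpair (hat (bfst (bsnd s) 0 + 1)) (bsnd (bsnd s)) :=
    .bpair (((OracleTotal.bfst.subst .bsnd).map Primrec.succ).hat 0) (OracleTotal.bsnd.subst .bsnd)
  have hout : OracleTotal fun s => bfst (bsnd s) := OracleTotal.bfst.subst .bsnd
  refine (((hP.comp_total hinit).comp ((hP.comp_total hinc).loop .bfst)).total_comp hout).of_iff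
    fun s u => ?_
  simp only [bfst_bpair, bsnd_bpair, hat_apply]
  constructor
  · rintro ⟨w, ⟨_, ⟨_, _, ⟨v, hv, rfl⟩, rfl, rfl⟩, hL⟩, rfl⟩
    -- Invariant of a terminating run: the current value belongs to the current candidate, and the
    -- values at all earlier candidates are defined and nonzero.
    have key : ∀ x w, LoopRel (fun s => bfst s ≠ 0) (fun s u => ∃ a b, (∃ v ∈
        G (bfst (bsnd s) 0 + 1) (bsnd (bsnd s)), a = hat v) ∧
        b = bpair (hat (bfst (bsnd s) 0 + 1)) (bsnd (bsnd s)) ∧ u = bpair a b) x w →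
        ∀ k v, v ∈ G k s → (∀ j < k, ∃ m, m ≠ 0 ∧ m ∈ G j s) → x = bpair (hat v) (bpair (hat k) s) →
        ∃ k', w = bpair 0 (bpair (hat k') s) ∧ 0 ∈ G k' s ∧ ∀ j < k', ∃ m, m ≠ 0 ∧ m ∈ G j s := by
      intro x w h
      induction h with
      | done x h =>
        rintro k v hv hk rfl
        simp only [bfst_bpair, not_not, hat_eq_zero] at h
        subst h
        exact ⟨k, rfl, hv, hk⟩
      | step x y w h hR _ ih =>
        rintro k v hv hk rfl
        obtain ⟨_, _, ⟨v', hv', rfl⟩, rfl, rfl⟩ := hR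
        simp only [bfst_bpair, bsnd_bpair, hat_apply] at hv'
        refine ih (k + 1) v' hv' (fun j hj => ?_) (by simp)
        rcases Nat.lt_succ_iff_lt_or_eq.1 hj with hj | rfl
        · exact hk j hj
        · exact ⟨v, by simpa [hat_eq_zero] using h, hv⟩
    obtain ⟨k, rfl, h0, hk⟩ := key _ _ hL 0 v hv (by simp) rfl
    refine ⟨k, Nat.mem_rfind.2 ⟨?_, fun {j} hj => ?_⟩, by simp⟩
    · simpa using h0
    · obtain ⟨m, hm, hmj⟩ := hk j hj
      exact (Part.mem_map_iff _).2 ⟨m, hmj, by simpa using hm⟩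
  · rintro ⟨k, hk, rfl⟩
    obtain ⟨h0, hk⟩ := Nat.mem_rfind.1 hk
    have h0 : 0 ∈ G k s := by simpa using h0
    have hk : ∀ j < k, ∃ m, m ∈ G j s ∧ m ≠ 0 := fun j hj => by
      simpa using hk hj
    -- Backward induction: the loop entered with candidate `k - i` exits at `k`. The case `i = k` is
    -- the run from the start.
    have key : ∀ i, i ≤ k → ∃ v, v ∈ G (k - i) s ∧ LoopRel (fun s => bfst s ≠ 0) (fun s u =>
        ∃ a b, (∃ v ∈ G (bfst (bsnd s) 0 + 1) (bsnd (bsnd s)), a = hat v) ∧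
        b = bpair (hat (bfst (bsnd s) 0 + 1)) (bsnd (bsnd s)) ∧ u = bpair a b)
        (bpair (hat v) (bpair (hat (k - i)) s)) (bpair 0 (bpair (hat k) s)) := by
      intro i
      induction i with
      | zero =>
        intro _
        refine ⟨0, h0, ?_⟩
        exact .done _ (by simp; rfl)
      | succ i ih =>
        intro hi
        obtain ⟨v, hv, hL⟩ := ih (by omega)
        obtain ⟨m, hm, hm0⟩ := hk (k - (i + 1)) (by omega)
        refine ⟨m, hm, .step _ _ _ (by simpa [hat_eq_zero] using hm0) ⟨hat v, _, ⟨v, ?_, rfl⟩, rfl, rfl⟩ ?_⟩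
        · simpa [show k - (i + 1) + 1 = k - i by omega] using hv
        · simpa [show k - (i + 1) + 1 = k - i by omega] using hL
    obtain ⟨v, hv, hL⟩ := key k le_rfl
    simp only [Nat.sub_self] at hv hL
    exact ⟨_, ⟨_, ⟨_, _, ⟨v, hv, rfl⟩, rfl, rfl⟩, hL⟩, by simp⟩

end WhileRel

/-! ### Partial recursive functions are computed by while programs -/

/-- The code of a value: numbers become constant sequences. -/
def Codomain.code : (Y : Codomain) → Y.Elem → Baire
  | .nat => hat
  | .baire => fun x => x

/-- The inverse of `Codomain.code`. -/
def Codomain.decode : (Y : Codomain) → Baire → Y.Elem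
  | .nat => fun x => x 0
  | .baire => fun x => x

@[simp] theorem Codomain.decode_code (Y : Codomain) (v : Y.Elem) : Y.decode (Y.code v) = v := by
  cases Y <;> rfl

/-- The iterated step acts on triples of the stage, the parameter `s` and the code of the current
value. Treating both codomains at once covers the two schemes of primitive recursion. -/
theorem WhileRel.natRec {Y : Codomain} {c : Baire → Baire} (hc : OracleTotal c)
    {G : Baire → Part Y.Elem} {H : ℕ → Baire → Y.Elem → Part Y.Elem}
    (hG : WhileRel fun s u => ∃ v ∈ G s, u = Y.code v)
    (hH : WhileRel fun s u =>
      ∃ v ∈ H (bfst s 0) (bfst (bsnd s)) (Y.decode (bsnd (bsnd s))), u = Y.code v) :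
    WhileRel fun s u => ∃ v ∈ (Nat.rec (G s) (fun k ih => ih.bind (H k s)) (c s 0) : Part Y.Elem),
      u = Y.code v := by
  have hstep : WhileRel fun s u => ∃ v ∈ H (bfst s 0) (bfst (bsnd s)) (Y.decode (bsnd (bsnd s))),
      u = bpair (hat (bfst s 0 + 1)) (bpair (bfst (bsnd s)) (Y.code v)) := by
    have h1 : WhileRel fun s u => u = hat (bfst s 0 + 1) :=
      total ((OracleTotal.bfst.map Primrec.succ).hat 0)
    have h2 : WhileRel fun s u => u = bfst (bsnd s) := total (OracleTotal.bfst.subst .bsnd)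
    refine (h1.pair (h2.pair hH)).of_iff fun s u => ?_
    constructor
    · rintro ⟨_, _, rfl, ⟨_, _, rfl, ⟨v, hv, rfl⟩, rfl⟩, rfl⟩
      exact ⟨v, hv, rfl⟩
    · rintro ⟨v, hv, rfl⟩
      exact ⟨_, _, rfl, ⟨_, _, rfl, ⟨v, hv, rfl⟩, rfl⟩, rfl⟩
  have hinit : WhileRel fun s u => ∃ v ∈ G s, u = bpair (c s) (bpair (hat 0) (bpair s (Y.code v))) := by
    have h1 : WhileRel fun s u => u = hat 0 := total (OracleTotal.const 0)
    refine ((total hc).pair (h1.pair ((total .id).pair hG))).of_iff fun s u => ?_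
    constructor
    · rintro ⟨_, _, rfl, ⟨_, _, rfl, ⟨_, _, rfl, ⟨v, hv, rfl⟩, rfl⟩, rfl⟩, rfl⟩
      exact ⟨v, hv, rfl⟩
    · rintro ⟨v, hv, rfl⟩
      exact ⟨_, _, rfl, ⟨_, _, rfl, ⟨_, _, rfl, ⟨v, hv, rfl⟩, rfl⟩, rfl⟩, rfl⟩
  refine ((hinit.comp hstep.iterate).total_comp (OracleTotal.bsnd.subst .bsnd)).of_iff fun s u => ?_
  -- After `n` rounds the triple consists of `n`, the unchanged parameter and the `n`-th value of
  -- the recursion; the initial value and all intermediate ones must be defined on both sides.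
  have key : ∀ n w, (∃ v ∈ G s, RelIter (fun s u => ∃ v ∈ H (bfst s 0) (bfst (bsnd s))
      (Y.decode (bsnd (bsnd s))), u = bpair (hat (bfst s 0 + 1)) (bpair (bfst (bsnd s)) (Y.code v)))
      n (bpair (hat 0) (bpair s (Y.code v))) w) ↔
      ∃ v ∈ (Nat.rec (G s) (fun k ih => ih.bind (H k s)) n : Part Y.Elem),
        w = bpair (hat n) (bpair s (Y.code v)) := by
    intro n
    induction n with
    | zero => intro w; simp [RelIter, eq_comm]
    | succ n ih =>
      intro w
      simp only [relIter_succ', Part.mem_bind_iff]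
      constructor
      · rintro ⟨v, hv, w', hw', hR⟩
        obtain ⟨v', hv', rfl⟩ := (ih w').1 ⟨v, hv, hw'⟩
        obtain ⟨v'', h, rfl⟩ := hR
        simp only [bfst_bpair, bsnd_bpair, hat_apply, Codomain.decode_code] at h ⊢
        exact ⟨v'', ⟨v', hv', h⟩, rfl⟩
      · rintro ⟨v'', ⟨v', hv', h⟩, rfl⟩
        obtain ⟨v, hv, hw⟩ := (ih _).2 ⟨v', hv', rfl⟩
        refine ⟨v, hv, _, hw, v'', ?_, ?_⟩ <;> simp [h]
  constructor
  · rintro ⟨w, ⟨_, ⟨v, hv, rfl⟩, hw⟩, rfl⟩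
    obtain ⟨v', hv', rfl⟩ := (key _ _).1 ⟨v, hv, by simpa using hw⟩
    exact ⟨v', by simpa using hv', by simp⟩
  · rintro ⟨v', hv', rfl⟩
    obtain ⟨v, hv, hw⟩ := (key _ _).2 ⟨v', hv', rfl⟩
    exact ⟨_, ⟨_, ⟨v, hv, rfl⟩, by simpa using hw⟩, by simp⟩

namespace MixedFun

variable {p q : ℕ} {Y : Codomain}

/-- The numerical arguments in a tuple. -/
def natArgs (p : ℕ) (s : Baire) : Fin p → ℕ := fun i => entry i s 0

/-- The sequences in a tuple that begins with `p` numerical arguments. -/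
def baireArgs (p q : ℕ) (s : Baire) : Fin q → Baire := fun j => entry (p + j) s

/-- A partial function of mixed type as a relation on Baire space. -/
def rel (f : MixedFun p q Y) (s u : Baire) : Prop :=
  ∃ v ∈ f (natArgs p s) (baireArgs p q s), u = Y.code v

theorem natArgs_btuple (a : Fin (p + q) → Baire) :
    natArgs p (btuple a) = fun i => a (Fin.castAdd q i) 0 :=
  funext fun i => congrFun (entry_btuple a (Fin.castAdd q i)) 0

theorem baireArgs_btuple (a : Fin (p + q) → Baire) :
    baireArgs p q (btuple a) = fun j => a (Fin.natAdd p j) :=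
  funext fun j => entry_btuple a (Fin.natAdd p j)

/-- Assemble the arguments into a tuple and run the program for `f` on it. Since `natArgs` reads a
number at entry `0`, the sequences `g i s` need not be constant. -/
theorem whileRel_apply {f : MixedFun p q Y} (hf : WhileRel f.rel) {g : Fin p → Baire → Baire}
    (hg : ∀ i, OracleTotal (g i)) {h : Fin q → Baire → Baire} (hh : ∀ j, OracleTotal (h j)) :
    WhileRel fun s u => ∃ v ∈ f (fun i => g i s 0) (fun j => h j s), u = Y.code v := by
  have ht : OracleTotal fun s => btuple fun i => (Fin.append g h : Fin (p + q) → Baire → Baire) i s :=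
    .btuple fun i => Fin.addCases (by simpa using hg) (by simpa using hh) i
  refine (hf.comp_total ht).of_iff fun s u => ?_
  rw [rel, natArgs_btuple, baireArgs_btuple]
  simp

end MixedFun

/-- The component to be consulted depends on `n % q`, while `entry j` is computable for each fixed
`j` only; hence a finite case distinction. -/
theorem OracleTotal.interleave_baireArgs (p q : ℕ) :
    OracleTotal fun s => interleave (MixedFun.baireArgs p q s) := by
  rcases Nat.eq_zero_or_pos q with rfl | hq
  · exact (funext fun s => funext fun n => by simp [interleave] :
      (fun _ _ => 0) = fun s => interleave (MixedFun.baireArgs p 0 s)) ▸ OracleTotal.const 0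
  -- The interleaving of the first `m` tracks, with zeros on the others, so that each induction step
  -- adds one case.
  have key : ∀ m, m ≤ q → OracleTotal fun s n =>
      if n % q < m then _root_.entry (p + n % q) s (n / q) else 0 := by
    intro m
    induction m with
    | zero => intro _; simpa using OracleTotal.const 0
    | succ m ih =>
      intro hm
      have := OracleTotal.cond (fun n => n % q = m) (Primrec.eq.comp (mod_const q) (.const m))
        ((OracleTotal.entry (p + m)).comp (of_primrec (div_const q))) (ih (by omega))
      convert this using 3 with s n
      split_ifs <;> first | omega | simp_all
  convert key q le_rfl using 3 with s n
  simp [interleave, hq, Nat.mod_lt, MixedFun.baireArgs]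

/-- Induction on the schemes. Only `isZero`, the two primitive recursions and `mu` need loops; the
universal function is a single oracle computation. -/
theorem PartRecOverBaire.whileRel {Ψ : ℕ → Baire →. Baire} (hΨ : IsUniversalTTE Ψ) {p q : ℕ}
    {Y : Codomain} {f : MixedFun p q Y} (hf : PartRecOverBaire Ψ p q Y f) : WhileRel f.rel := by
  induction hf with
  | zero =>
    exact (WhileRel.total (OracleTotal.const 0)).of_iff fun s u => by
      simp [MixedFun.rel, Codomain.code]; rfl
  | succ =>
    exact (WhileRel.total (((OracleTotal.entry 0).map Primrec.succ).hat 0)).of_iff fun s u => by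
      simp [MixedFun.rel, Codomain.code, MixedFun.natArgs]
  | projNat p q i =>
    exact (WhileRel.total ((OracleTotal.entry i).hat 0)).of_iff fun s u => by
      simp [MixedFun.rel, Codomain.code, MixedFun.natArgs]
  | projBaire p q j =>
    exact (WhileRel.total (OracleTotal.entry (p + j))).of_iff fun s u => by
      simp [MixedFun.rel, Codomain.code, MixedFun.baireArgs]
  | universal q =>
    obtain ⟨M, hM, hMΨ⟩ := hΨ.computable
    -- The index is not fixed in the program: it is read off the first component of the oracle and
    -- passed to `M` within its numerical argument.
    have h1 : OracleComputable fun s n => M (bsnd s) (Nat.pair (bfst s 0) n) :=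
      (hM.subst .bsnd).comp_total (.map₂ Primrec₂.natPair (OracleTotal.bfst.hat 0) .arg)
    refine ((WhileRel.oracle h1).comp_total
      (.bpair (.entry 0) (.interleave_baireArgs 1 q))).of_iff fun s u => ?_
    simp [MixedFun.rel, Codomain.code, hMΨ, MixedFun.natArgs]
  | isZero =>
    exact (WhileRel.zeroChar (OracleTotal.entry 0)).of_iff fun s u => by
      simp [MixedFun.rel, Codomain.code, MixedFun.baireArgs]
  | @comp p q r s Y f g h _ _ _ hf hg hh =>
    have h1 := WhileRel.tuple (m := p + q)
      (R := fun i => Fin.addCases (fun i => (g i).rel) (fun j => (h j).rel) i)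
      fun i => Fin.addCases (by simpa using hg) (by simpa using hh) i
    refine (h1.comp hf).of_iff fun s u => ?_
    simp only [MixedFun.comp, MixedFun.rel, Part.mem_bind_iff]
    constructor
    · rintro ⟨_, ⟨a, ha, rfl⟩, v, hv, rfl⟩
      have ha1 := fun i => ha (Fin.castAdd q i)
      have ha2 := fun j => ha (Fin.natAdd p j)
      simp only [Fin.addCases_left, Fin.addCases_right, MixedFun.rel, Codomain.code] at ha1 ha2
      choose b hb hab using ha1
      rw [MixedFun.natArgs_btuple, MixedFun.baireArgs_btuple] at hv
      refine ⟨v, ⟨b, ⟨fun i => Part.dom_iff_mem.2 ⟨_, hb i⟩, ?_⟩, fun j => a (Fin.natAdd p j),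
        ⟨fun i => Part.dom_iff_mem.2 ?_, ?_⟩, ?_⟩, rfl⟩
      · exact funext fun i => Part.get_eq_of_mem (hb i) _
      · obtain ⟨c, hc, -⟩ := ha2 i; exact ⟨c, hc⟩
      · refine funext fun i => Part.get_eq_of_mem ?_ _
        obtain ⟨c, hc, hac⟩ := ha2 i
        rwa [hac]
      · simpa [hab] using hv
    · rintro ⟨v, ⟨b, ⟨hb, rfl⟩, c, ⟨hc, rfl⟩, hv⟩, rfl⟩
      refine ⟨_, ⟨Fin.append (fun i => hat ((g i _ _).get (hb i))) (fun j => (h j _ _).get (hc j)),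
        fun i => ?_, rfl⟩, v, ?_, rfl⟩
      · refine Fin.addCases (fun i => ?_) (fun j => ?_) i
        · simp only [Fin.addCases_left, Fin.append_left]
          exact ⟨_, Part.get_mem (hb i), rfl⟩
        · simp only [Fin.addCases_right, Fin.append_right]
          exact ⟨_, Part.get_mem (hc j), rfl⟩
      · rw [MixedFun.natArgs_btuple, MixedFun.baireArgs_btuple]
        simp only [Fin.append_left, Fin.append_right]
        exact hv
  | @primRecNat p q G H _ _ hG hH =>
    -- Entry `0` of the tuple is the recursion argument; so the parameters begin at entry `1` and
    -- the sequences at entry `p + 1`.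
    have hG' := MixedFun.whileRel_apply hG (fun i => OracleTotal.entry (i + 1))
      (fun j => OracleTotal.entry (p + 1 + j))
    -- `WhileRel.natRec` supplies `(k, (s, v))`: the stage comes first, the parameters are entries
    -- of `s`, and the previous value comes last among the numbers.
    have hH' := MixedFun.whileRel_apply (p := p + 2) hH
      (g := Fin.cons bfst (Fin.snoc (fun i s => entry (i + 1) (bfst (bsnd s)))
        (fun s => bsnd (bsnd s)) : Fin (p + 1) → Baire → Baire))
      (h := fun j s => entry (p + 1 + j) (bfst (bsnd s)))
      (by
        refine Fin.cases .bfst (Fin.lastCases ?_ fun i => ?_)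
        · simpa using OracleTotal.bsnd.subst .bsnd
        · simpa using (OracleTotal.entry (i + 1)).subst (OracleTotal.bfst.subst .bsnd))
      (fun j => (OracleTotal.entry _).subst (OracleTotal.bfst.subst .bsnd))
    refine (WhileRel.natRec (Y := .nat) (c := entry 0) (.entry 0)
      (G := fun s => G (fun i => entry (i + 1) s 0) (fun j => entry (p + 1 + j) s))
      (H := fun k s v => H (Fin.cons k (Fin.snoc (fun i => entry (i + 1) s 0) v : Fin (p + 1) → ℕ))
        (fun j => entry (p + 1 + j) s)) hG' (hH'.of_iff fun s u => ?_)).of_iff fun s u => ?_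
    · have : (fun i : Fin (p + 2) => (Fin.cons bfst (Fin.snoc (fun i s =>
          entry (i + 1) (bfst (bsnd s))) (fun s => bsnd (bsnd s)) : Fin (p + 1) → Baire → Baire) :
          Fin (p + 2) → Baire → Baire) i s 0) = Fin.cons (bfst s 0)
          (Fin.snoc (fun i : Fin p => entry (i + 1) (bfst (bsnd s)) 0) (bsnd (bsnd s) 0) :
            Fin (p + 1) → ℕ) := by
        funext i
        refine Fin.cases rfl (fun i => ?_) i
        refine Fin.lastCases ?_ (fun i => ?_) i <;> simp
      rw [this]
      rfl
    · rfl
  | @primRecBaire p q G H _ _ hG hH =>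
    have hG' := MixedFun.whileRel_apply hG (fun i => OracleTotal.entry (i + 1))
      (fun j => OracleTotal.entry (p + 1 + j))
    have hH' := MixedFun.whileRel_apply (p := p + 1) (q := q + 1) hH
      (g := Fin.cons bfst (fun i s => entry (i + 1) (bfst (bsnd s))))
      (h := Fin.snoc (fun j s => entry (p + 1 + j) (bfst (bsnd s))) (fun s => bsnd (bsnd s)))
      (Fin.cases .bfst fun i => (OracleTotal.entry _).subst (OracleTotal.bfst.subst .bsnd))
      (by
        refine Fin.lastCases ?_ fun i => ?_
        · simpa using OracleTotal.bsnd.subst .bsnd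
        · simpa using (OracleTotal.entry _).subst (OracleTotal.bfst.subst .bsnd))
    refine (WhileRel.natRec (Y := .baire) (c := entry 0) (.entry 0)
      (G := fun s => G (fun i => entry (i + 1) s 0) (fun j => entry (p + 1 + j) s))
      (H := fun k s v => H (Fin.cons k (fun i => entry (i + 1) s 0))
        (Fin.snoc (fun j => entry (p + 1 + j) s) v : Fin (q + 1) → Baire)) hG'
        (hH'.of_iff fun s u => ?_)).of_iff fun s u => ?_
    · have h1 : (fun i : Fin (p + 1) => (Fin.cons bfst (fun i s =>
          entry (i + 1) (bfst (bsnd s))) : Fin (p + 1) → Baire → Baire) i s 0) =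
          Fin.cons (bfst s 0) (fun i : Fin p => entry (i + 1) (bfst (bsnd s)) 0) := by
        funext i
        refine Fin.cases rfl (fun i => ?_) i
        simp
      have h2 : (fun j : Fin (q + 1) => (Fin.snoc (fun j s => entry (p + 1 + j) (bfst (bsnd s)))
          (fun s => bsnd (bsnd s)) : Fin (q + 1) → Baire → Baire) j s) =
          Fin.snoc (fun j : Fin q => entry (p + 1 + j) (bfst (bsnd s))) (bsnd (bsnd s)) := by
        funext i
        refine Fin.lastCases ?_ (fun i => ?_) i <;> simp
      rw [h1, h2]
      rfl
    · rfl
  | @mu p q G _ hG =>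
    have hG' := MixedFun.whileRel_apply (p := p + 1) hG
      (g := Fin.cons bfst (fun i s => entry i (bsnd s)))
      (h := fun j s => entry (p + j) (bsnd s))
      (Fin.cases .bfst fun i => (OracleTotal.entry _).subst .bsnd)
      (fun j => (OracleTotal.entry _).subst .bsnd)
    refine (WhileRel.rfind (G := fun k s => G (Fin.cons k (MixedFun.natArgs p s))
      (MixedFun.baireArgs p q s)) (hG'.of_iff fun s u => ?_)).of_iff fun s u => Iff.rfl
    have h1 : (fun i : Fin (p + 1) => (Fin.cons bfst (fun i s => entry i (bsnd s)) :
        Fin (p + 1) → Baire → Baire) i s 0) =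
        Fin.cons (bfst s 0) (fun i : Fin p => entry i (bsnd s) 0) := by
      funext i
      refine Fin.cases rfl (fun i => ?_) i
      simp
    rw [h1]
    rfl

/-! ## Flowcharts -/

/-- A flowchart over a set `I` of instructions whose control depends on observations in `O`. -/
structure FlowChart (O I : Type) where
  /-- The control points. -/
  L : Type
  finL : Finite L
  start : L
  halt : L
  /-- The instruction to be executed, and the next control point. -/
  next : L → O → I × L

namespace FlowChart

variable {D O I : Type} (ex : I → D → D → Prop) (obs : D → O)

/-- One step in a flowchart. -/
inductive Step (F : FlowChart O I) : F.L × D → F.L × D → Prop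
  | mk (q : F.L) (d d' : D) (hq : q ≠ F.halt) (h : ex (F.next q (obs d)).1 d d') :
      Step F (q, d) ((F.next q (obs d)).2, d')

/-- The relations on data computed by flowcharts. -/
def Computable (R : D → D → Prop) : Prop :=
  ∃ F : FlowChart O I, ∀ d d', R d d' ↔
    Relation.ReflTransGen (Step ex obs F) (F.start, d) (F.halt, d')

variable {ex obs}

theorem Step.of_eq {F : FlowChart O I} {q q' : F.L} {i : I} {d d' : D} (hq : q ≠ F.halt)
    (hn : F.next q (obs d) = (i, q')) (h : ex i d d') : Step ex obs F (q, d) (q', d') := by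
  have := Step.mk (ex := ex) (obs := obs) (F := F) q d d' hq (by rw [hn]; exact h)
  rwa [hn] at this

theorem not_step_halt {F : FlowChart O I} {d : D} {c : F.L × D} : ¬ Step ex obs F (F.halt, d) c := by
  intro h
  cases h with
  | mk _ _ _ hq _ => exact hq rfl

theorem eq_of_reflTransGen_halt {F : FlowChart O I} {d : D} {c : F.L × D}
    (h : Relation.ReflTransGen (Step ex obs F) (F.halt, d) c) : c = (F.halt, d) := by
  rcases Relation.ReflTransGen.cases_head h with h | ⟨_, h, -⟩
  · exact h.symm
  · exact absurd h not_step_halt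

namespace Computable

variable {R R' : D → D → Prop}

theorem of_iff (h : Computable ex obs R) (h' : ∀ s u, R s u ↔ R' s u) : Computable ex obs R' :=
  (funext fun s => funext fun u => propext (h' s u) : R = R') ▸ h

theorem instr (i : I) : Computable ex obs (ex i) := by
  refine ⟨⟨Bool, inferInstance, false, true, fun _ _ => (i, true)⟩, fun d d' => ?_⟩
  constructor
  · intro h
    exact .single (Step.of_eq (by simp) rfl h)
  · intro h
    rcases Relation.ReflTransGen.cases_head h with h | ⟨⟨q, u⟩, h, h'⟩
    · simp at h
    · cases h with
      | mk _ _ _ hq h =>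
        have := eq_of_reflTransGen_halt h'
        simp only [Prod.mk.injEq, true_and] at this
        rw [this]
        exact h

/-- The sequential composition of flowcharts. -/
noncomputable def seq (nop : I) (F G : FlowChart O I) : FlowChart O I where
  L := F.L ⊕ G.L
  finL := by have := F.finL; have := G.finL; infer_instance
  start := .inl F.start
  halt := .inr G.halt
  next := fun q o => match q with
    | .inl q =>
      open Classical in
      if q = F.halt then (nop, .inr G.start) else ((F.next q o).1, .inl (F.next q o).2)
    | .inr q => ((G.next q o).1, .inr (G.next q o).2)

/-- The control points are disjoint copies, linked by a `nop` from the halting point of the first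
chart to the start of the second. -/
theorem comp {nop : I} (hnop : ∀ d d', ex nop d d' ↔ d = d') (hR : Computable ex obs R)
    (hR' : Computable ex obs R') : Computable ex obs fun d d' => ∃ u, R d u ∧ R' u d' := by
  obtain ⟨F, hF⟩ := hR
  obtain ⟨G, hG⟩ := hR'
  refine ⟨seq nop F G, fun d d' => ?_⟩
  simp only [hF, hG]
  constructor
  · rintro ⟨u, h1, h2⟩
    have h1' := Relation.ReflTransGen.lift (r := Step ex obs F) (p := Step ex obs (seq nop F G))
      (fun c => ((.inl c.1 : F.L ⊕ G.L), c.2)) (fun a b h => by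
        obtain ⟨q, d, d', hq, h⟩ := h
        exact Step.of_eq (F := seq nop F G) (by simp [seq]) (by simp [seq, hq]) h) _ _ h1
    have h2' := Relation.ReflTransGen.lift (r := Step ex obs G) (p := Step ex obs (seq nop F G))
      (fun c => ((.inr c.1 : F.L ⊕ G.L), c.2)) (fun a b h => by
        obtain ⟨q, d, d', hq, h⟩ := h
        exact Step.of_eq (F := seq nop F G) (by simpa [seq] using hq) (by simp [seq]) h) _ _ h2
    refine (h1'.tail ?_).trans h2'
    exact Step.of_eq (F := seq nop F G) (i := nop) (by simp [seq]) (by simp [seq]) ((hnop _ _).2 rfl)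
  -- For head induction the claim must cover every point of the run: in the first chart both parts
  -- are still ahead, in the second only the rest of that chart.
  · suffices ∀ c : (seq nop F G).L × D, Relation.ReflTransGen (Step ex obs (seq nop F G)) c
        ((seq nop F G).halt, d') → match c with
        | (.inl q, d) => ∃ u, Relation.ReflTransGen (Step ex obs F) (q, d) (F.halt, u) ∧
            Relation.ReflTransGen (Step ex obs G) (G.start, u) (G.halt, d')
        | (.inr q, d) => Relation.ReflTransGen (Step ex obs G) (q, d) (G.halt, d') from
      this ((seq nop F G).start, d)
    intro c h
    induction h using Relation.ReflTransGen.head_induction_on with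
    | refl => exact .refl
    | head h _ ih =>
      obtain ⟨q, d, u, hq, h⟩ := h
      rcases q with q | q
      · by_cases hqF : q = F.halt
        · subst hqF
          simp only [seq, if_true] at h ih
          rw [hnop] at h
          subst h
          exact ⟨d, .refl, ih⟩
        · simp only [seq, hqF, if_false] at h ih
          obtain ⟨w, hw, hw'⟩ := ih
          exact ⟨w, hw.head (Step.mk q d u hqF h), hw'⟩
      · simp only [seq] at h ih
        exact ih.head (Step.mk q d u (by simpa [seq] using hq) h)

/-- A loop around a flowchart; its entry is `false` and its exit is `true`. -/
noncomputable def while_ (nop : I) (c : O → Bool) (F : FlowChart O I) : FlowChart O I where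
  L := F.L ⊕ Bool
  finL := by have := F.finL; infer_instance
  start := .inr false
  halt := .inr true
  next := fun q o => match q with
    | .inl q =>
      open Classical in
      if q = F.halt then (nop, .inr false) else ((F.next q o).1, .inl (F.next q o).2)
    | .inr _ => (nop, if c o = true then .inl F.start else .inr true)

theorem loop {nop : I} (hnop : ∀ d d', ex nop d d' ↔ d = d') (c : O → Bool)
    (hR : Computable ex obs R) : Computable ex obs (LoopRel (fun d => c (obs d) = true) R) := by
  obtain ⟨F, hF⟩ := hR
  refine ⟨while_ nop c F, fun d d' => ?_⟩
  constructor
  · intro h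
    induction h with
    | done d h =>
      exact .single (Step.of_eq (F := while_ nop c F) (i := nop) (by simp [while_])
        (by simp [while_, h]) ((hnop _ _).2 rfl))
    | step d u v h hR _ ih =>
      have h1 := Relation.ReflTransGen.lift (r := Step ex obs F)
        (p := Step ex obs (while_ nop c F))
        (fun c => ((.inl c.1 : F.L ⊕ Bool), c.2)) (fun a b h => by
          obtain ⟨q, d, d', hq, h⟩ := h
          exact Step.of_eq (F := while_ nop c F) (by simp [while_]) (by simp [while_, hq]) h)
        _ _ ((hF _ _).1 hR)
      refine (Relation.ReflTransGen.head ?_ (h1.tail ?_)).trans ih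
      · exact Step.of_eq (F := while_ nop c F) (i := nop) (by simp [while_])
          (by simp [while_, h]) ((hnop _ _).2 rfl)
      · exact Step.of_eq (F := while_ nop c F) (i := nop) (by simp [while_])
          (by simp [while_]) ((hnop _ _).2 rfl)
  -- Inside the body, what remains is the rest of the current round followed by a full loop from its
  -- result; at the entry a full loop remains, and at the exit nothing.
  · suffices ∀ C : (while_ nop c F).L × D, Relation.ReflTransGen (Step ex obs (while_ nop c F)) C
        ((while_ nop c F).halt, d') → match C with
        | (.inl q, d) => ∃ u, Relation.ReflTransGen (Step ex obs F) (q, d) (F.halt, u) ∧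
            LoopRel (fun d => c (obs d) = true) R u d'
        | (.inr false, d) => LoopRel (fun d => c (obs d) = true) R d d'
        | (.inr true, d) => d = d' from
      this ((while_ nop c F).start, d)
    intro C h
    induction h using Relation.ReflTransGen.head_induction_on with
    | refl => rfl
    | head h _ ih =>
      obtain ⟨q, d, u, hq, h⟩ := h
      rcases q with q | (_ | _)
      · by_cases hqF : q = F.halt
        · subst hqF
          simp only [while_, if_true] at h ih
          rw [hnop] at h
          subst h
          exact ⟨d, .refl, ih⟩
        · simp only [while_, hqF, if_false] at h ih
          obtain ⟨w, hw, hw'⟩ := ih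
          exact ⟨w, hw.head (Step.mk q d u hqF h), hw'⟩
      · simp only [while_] at h ih
        rw [hnop] at h
        subst h
        by_cases hc : c (obs d) = true
        · simp only [hc, if_true] at ih
          obtain ⟨w, hw, hw'⟩ := ih
          exact .step _ w _ hc ((hF _ _).2 hw) hw'
        · simp only [hc] at ih
          subst ih
          exact .done _ hc
      · exact absurd rfl hq

end Computable

end FlowChart

/-! ## Runs of master-slave machines -/

namespace MSMachine

open Turing

/-- Positions beyond the list carry `default`, so a symbol other than the blank occurs only within
the list. -/
theorem ncard_getI_eq {Γ : Type} [Inhabited Γ] [DecidableEq Γ] {a : Γ} (ha : a ≠ default)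
    (l : List Γ) : {i | l.getI i = a}.Finite ∧ {i | l.getI i = a}.ncard = l.count a := by
  induction l with
  | nil => simp [List.getI_nil, ha.symm]
  | cons b l ih =>
    have h : {i | (b :: l).getI i = a} = (if b = a then {0} else ∅) ∪ Nat.succ '' {i | l.getI i = a} := by
      ext i
      cases i with
      | zero => split_ifs with h <;> simp [h]
      | succ i => split_ifs with h <;> simp
    have hfin : (Nat.succ '' {i | l.getI i = a}).Finite := ih.1.image _
    rw [h]
    refine ⟨Set.Finite.union (by split_ifs <;> simp) hfin, ?_⟩
    rw [Set.ncard_union_eq ?_ (by split_ifs <;> simp) hfin,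
      Set.ncard_image_of_injective _ Nat.succ_injective, ih.2, List.count_cons]
    · split_ifs with h1 h2 h2 <;> simp_all [add_comm]
    · rw [Set.disjoint_right]
      rintro _ ⟨i, -, rfl⟩
      split_ifs <;> simp

theorem number_mk₂ (M : MSMachine) [DecidableEq M.Γ] (l r : List M.Γ) :
    M.number (Tape.mk₂ l r) = l.count M.one + r.count M.one := by
  obtain ⟨hl, hl'⟩ := ncard_getI_eq M.one_ne_blank l
  obtain ⟨hr, hr'⟩ := ncard_getI_eq M.one_ne_blank r
  -- The left half of a tape is listed outward from the head: its `i`-th symbol sits in cell `-(i +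
  -- 1)`, the right half starting at cell `0`.
  have hinj : Function.Injective fun i : ℕ => -((i : ℤ) + 1) := fun a b h => by
    simp only at h; omega
  have h : {z : ℤ | (Tape.mk₂ l r).nth z = M.one} =
      (fun i : ℕ => -((i : ℤ) + 1)) '' {i | l.getI i = M.one} ∪
        (fun i : ℕ => (i : ℤ)) '' {i | r.getI i = M.one} := by
    ext z
    simp only [Set.mem_ofPred_eq, Set.mem_union, Set.mem_image]
    rcases z with n | n
    · have : (Tape.mk₂ l r).nth (Int.ofNat n) = r.getI n := Tape.mk'_nth_nat _ _ n
      rw [this]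
      constructor
      · intro h; exact .inr ⟨n, h, rfl⟩
      · rintro (⟨i, -, h⟩ | ⟨i, h, h'⟩)
        · simp only [Int.ofNat_eq_natCast] at h; omega
        · obtain rfl : i = n := by simpa using h'
          exact h
    · have : (Tape.mk₂ l r).nth (Int.negSucc n) = l.getI n := rfl
      rw [this]
      constructor
      · intro h; exact .inl ⟨n, h, by rw [Int.negSucc_eq]⟩
      · rintro (⟨i, h, h'⟩ | ⟨i, -, h⟩)
        · obtain rfl : i = n := by rw [Int.negSucc_eq] at h'; omega
          exact h
        · rw [Int.negSucc_eq] at h; omega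
  rw [number, h, Set.ncard_union_eq _ (hl.image _) (hr.image _),
    Set.ncard_image_of_injective _ hinj, Set.ncard_image_of_injective _ Nat.cast_injective, hl', hr']
  rw [Set.disjoint_left]
  rintro _ ⟨i, -, rfl⟩ ⟨j, -, h⟩
  simp only at h
  omega

/-- A slave call has at most one result and the bit is determined by the zero-test tape. Determinism
allows a given halting run to be compared with the run produced by a simulation. -/
theorem yields_rightUnique (M : MSMachine) (Ψ : ℕ → Baire →. Baire) :
    Relator.RightUnique (M.Yields Ψ) := by
  intro C D D' h h'
  cases h with
  | std q hC hq =>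
    cases h' with
    | std q' hC' hq' =>
      obtain rfl : q = q' := by simpa [hC] using hC'
      rfl
    | call z hC' => simp [hC] at hC'
    | test b hC' => simp [hC] at hC'
  | call z hC hz =>
    cases h' with
    | std q' hC' hq' => simp [hC] at hC'
    | call z' hC' hz' => rw [Part.mem_unique hz hz']
    | test b hC' => simp [hC] at hC'
  | test b hC hb =>
    cases h' with
    | std q' hC' hq' => simp [hC] at hC'
    | call z hC' => simp [hC] at hC'
    | test b' hC' hb' =>
      obtain rfl : b = b' := Bool.eq_iff_iff.2 (hb.trans hb'.symm)
      rfl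

theorem not_yields_of_halt {M : MSMachine} {Ψ : ℕ → Baire →. Baire} {C D : M.Config}
    (hC : C.state = .std M.halt) : ¬ M.Yields Ψ C D := by
  intro h
  cases h with
  | std q hC' hq => simp_all
  | call z hC' => simp [hC] at hC'
  | test b hC' => simp [hC] at hC'

end MSMachine

/-- A run of a deterministic relation that ends in a terminal point can be continued from each
point that is reached. -/
theorem Relation.ReflTransGen.of_terminal {α : Type} {r : α → α → Prop} (hr : Relator.RightUnique r)
    {a b t : α} (ht : ∀ c, ¬ r t c) (hab : Relation.ReflTransGen r a b)
    (hat : Relation.ReflTransGen r a t) : Relation.ReflTransGen r b t := by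
  rcases Relation.ReflTransGen.total_of_right_unique hr hab hat with h | h
  · exact h
  · rcases Relation.ReflTransGen.cases_head h with rfl | ⟨c, h, -⟩
    · exact .refl
    · exact absurd h (ht c)

/-- Accessibility replaces induction on the length of a halting run, which would be awkward when one
simulated step takes several steps. -/
theorem Relation.ReflTransGen.acc_of_terminal {α : Type} {r : α → α → Prop}
    (hr : Relator.RightUnique r) {a t : α} (ht : ∀ c, ¬ r t c) (hat : Relation.ReflTransGen r a t) :
    Acc (fun x y => r y x) a := by
  induction hat using Relation.ReflTransGen.head_induction_on with
  | refl => exact ⟨_, fun c h => absurd h (ht c)⟩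
  | head h _ ih => exact ⟨_, fun c h' => hr h h' ▸ ih⟩

/-! ## Flowcharts for master-slave machines -/

/-- The data on which the flowchart of a master-slave machine works: the rest of the input of the
master, the numbers on its billboard and on its output tape, its bit, and the tapes of the
slaves. -/
structure Env where
  input : List Bool
  board : ℕ
  out : ℕ
  bit : Bool
  slaveInput : Baire
  slaveWork : Baire
  zeroTest : Baire
  slaveOutput : Baire

/-- The instructions of flowcharts for master-slave machines. -/
inductive EnvInstr : Type
  | nop | next | up | down | emit | call | test

namespace Env

/-- The effect of an instruction. -/
def Exec (Ψ : ℕ → Baire →. Baire) : EnvInstr → Env → Env → Prop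
  | .nop, d, d' => d = d'
  | .next, d, d' => d' = { d with input := d.input.tail }
  | .up, d, d' => d' = { d with board := d.board + 1 }
  | .down, d, d' => d' = { d with board := d.board - 1 }
  | .emit, d, d' => d' = { d with out := d.out + 1 }
  | .call, d, d' => ∃ z ∈ Ψ d.board (interleave ![d.slaveInput, d.slaveWork]),
      d' = { d with slaveWork := track 3 0 z, zeroTest := track 3 1 z, slaveOutput := track 3 2 z }
  | .test, d, d' => ∃ b : Bool, (b = true ↔ d.zeroTest = 0) ∧ d' = { d with bit := b }

/-- What the master observes. -/
def obs (d : Env) : Bool × Bool := (d.input.headI, d.bit)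

/-- The initial data. -/
def init {p q : ℕ} (n : Fin p → ℕ) (x : Fin q → Baire) : Env where
  input := (List.ofFn n).flatMap fun a => List.replicate (a + 1) true ++ [false]
  board := 0
  out := 0
  bit := false
  slaveInput := interleave x
  slaveWork := 0
  zeroTest := 0
  slaveOutput := 0

/-- The output. -/
def output (d : Env) : (Y : Codomain) → Y.Elem
  | .nat => d.out
  | .baire => d.slaveOutput

end Env

namespace FlowChart

open Turing

variable (F : FlowChart (Bool × Bool) EnvInstr)

/-- The symbols of the machine that executes a flowchart: control points with the phase of the
current instruction, the blank and the symbol for numbers. -/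
abbrev Symbol : Type := (F.L × Bool) ⊕ Bool

instance : Inhabited F.Symbol := ⟨.inr false⟩

/-- The control point stored in a symbol. -/
def control : F.Symbol → F.L × Bool
  | .inl c => c
  | .inr _ => (F.start, false)

/-- Whether a symbol is the symbol for numbers. -/
def isOne : F.Symbol → Bool
  | .inl _ => false
  | .inr b => b

/-- The commands for the input tape, the billboard and the output tape, the next control point and
the next state, in terms of the current control point and the observations. -/
noncomputable def action (c : F.L × Bool) (o : Bool × Bool) :
    (Option (TM0.Stmt F.Symbol) × Option (TM0.Stmt F.Symbol) × Option (TM0.Stmt F.Symbol)) ×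
      (F.L × Bool) × MasterState Bool :=
  open Classical in
  if c.1 = F.halt then ((none, none, none), c, .std true)
  else match F.next c.1 o, c.2 with
    | (.nop, q), _ => ((none, none, none), (q, false), .std false)
    | (.next, q), _ => ((some (.move .right), none, none), (q, false), .std false)
    | (.up, _), false => ((none, some (.write (.inr true)), none), (c.1, true), .std false)
    | (.up, q), true => ((none, some (.move .right), none), (q, false), .std false)
    | (.down, _), false => ((none, some (.move .left), none), (c.1, true), .std false)
    | (.down, q), true => ((none, some (.write (.inr false)), none), (q, false), .std false)
    | (.emit, _), false => ((none, none, some (.write (.inr true))), (c.1, true), .std false)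
    | (.emit, q), true => ((none, none, some (.move .right)), (q, false), .std false)
    | (.call, q), _ => ((none, none, none), (q, false), .call)
    | (.test, q), _ => ((none, none, none), (q, false), .test)

/-- The master-slave machine that executes a flowchart. Its current control point is written on its
work tape. -/
noncomputable def machine : MSMachine where
  Q := Bool
  finQ := inferInstance
  Γ := F.Symbol
  finΓ := by have := F.finL; infer_instance
  blank := inferInstance
  one := .inr true
  one_ne_blank := by simp [default]
  start := false
  halt := true
  workTapes := 1
  trans := fun _ h b =>
    let A := F.action (F.control (h (.work 0))) (F.isOne (h .input), b)
    (fun t => match t with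
      | .input => A.1.1.getD (.write (h .input))
      | .billboard => A.1.2.1.getD (.write (h .billboard))
      | .output => A.1.2.2.getD (.write (h .output))
      | .work _ => .write (.inl A.2.1), A.2.2)
  afterCall := .std false
  afterTest := .std false

variable {F} {Ψ : ℕ → Baire →. Baire}

/-- The contents of a configuration of the machine of a flowchart. -/
structure Shows (st : MasterState Bool) (c : F.L × Bool) (T₁ T₂ T₃ : Tape F.Symbol) (b : Bool)
    (x w z o : Baire) (C : F.machine.Config) : Prop where
  state : C.state = st
  control : F.control (C.tape (.work (0 : Fin 1))).head = c
  input : C.tape .input = T₁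
  billboard : C.tape .billboard = T₂
  output : C.tape .output = T₃
  bit : C.bit = b
  slaveInput : C.slaveInput = x
  slaveWork : C.slaveWork = w
  zeroTest : C.zeroTest = z
  slaveOutput : C.slaveOutput = o

/-- Executing an optional command. -/
def execOpt (T : Tape F.Symbol) : Option (TM0.Stmt F.Symbol) → Tape F.Symbol
  | none => T
  | some s => T.exec s

theorem exec_getD (T : Tape F.Symbol) (s : Option (TM0.Stmt F.Symbol)) :
    T.exec (s.getD (.write T.head)) = execOpt T s := by
  cases s with
  | none => exact T.write_self
  | some s => rfl

/-- All standard steps at once: only the value of `action` has to be computed in each case. A tape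
without a command gets its scanned symbol rewritten. -/
theorem Shows.yields {c : F.L × Bool} {T₁ T₂ T₃ : Tape F.Symbol} {b : Bool} {x w z o : Baire}
    {C : F.machine.Config} (hC : Shows (.std false) c T₁ T₂ T₃ b x w z o C)
    {A : (Option (TM0.Stmt F.Symbol) × Option (TM0.Stmt F.Symbol) × Option (TM0.Stmt F.Symbol)) ×
      (F.L × Bool) × MasterState Bool} (hA : F.action c (F.isOne T₁.head, b) = A) :
    ∃ C', F.machine.Yields Ψ C C' ∧ Shows A.2.2 A.2.1 (execOpt T₁ A.1.1) (execOpt T₂ A.1.2.1)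
      (execOpt T₃ A.1.2.2) b x w z o C' := by
  obtain ⟨h1, rfl, rfl, rfl, rfl, rfl, h7, h8, h9, h10⟩ := hC
  subst hA
  refine ⟨_, .std C false h1 (by simp [machine]), rfl, rfl, ?_, ?_, ?_, rfl, h7, h8, h9, h10⟩
  · exact exec_getD (C.tape .input) _
  · exact exec_getD (C.tape .billboard) _
  · exact exec_getD (C.tape .output) _

/-- A tape with `n` symbols for numbers to the left of its head. -/
def ones (F : FlowChart (Bool × Bool) EnvInstr) (n : ℕ) : Tape F.Symbol :=
  Tape.mk₂ (List.replicate n (.inr true)) []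

theorem number_ones (n : ℕ) : F.machine.number (ones F n) = n := by
  classical
  have h : ∀ {α : Type} [DecidableEq α] (a : α),
      (List.replicate n a).count a + ([] : List α).count a = n := by simp
  exact (F.machine.number_mk₂ _ _).trans (h _)

theorem blank_cons_nil : (ListBlank.mk ([] : List F.Symbol)).cons default = ListBlank.mk [] := by
  have := ListBlank.cons_head_tail (ListBlank.mk ([] : List F.Symbol))
  simpa using this

theorem ones_up (n : ℕ) :
    ((ones F n).exec (.write (.inr true))).exec (.move .right) = ones F (n + 1) := by
  simp [ones, Tape.exec, Tape.mk₂, List.replicate_succ]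

/-- For `n = 0` the head moves onto a blank and writes a blank. The tape stays empty, in accordance
with truncated subtraction. -/
theorem ones_down (n : ℕ) :
    ((ones F n).exec (.move .left)).exec (.write (.inr false)) = ones F (n - 1) := by
  simp only [ones, Tape.exec, Tape.mk₂, Tape.move_left_mk', Tape.write_mk', ListBlank.tail_cons,
    ListBlank.tail_mk, List.tail_replicate]
  rw [show (Sum.inr false : F.Symbol) = default from rfl, blank_cons_nil]

/-- The configurations that represent a point of a run of a flowchart. -/
def Rep (q : F.L) (d : Env) (C : F.machine.Config) : Prop :=
  ∃ L, Shows (.std false) (q, false) (Tape.mk' L (ListBlank.mk (d.input.map .inr)))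
    (ones F d.board) (ones F d.out) d.bit d.slaveInput d.slaveWork d.zeroTest d.slaveOutput C

theorem isOne_headI (l : List Bool) : F.isOne (l.map Sum.inr).headI = l.headI := by
  cases l <;> rfl

/-- Separated from `Rep.step` because it does not presuppose that the slaves halt: the machine
reaches the state `call` in any case. -/
theorem Rep.call {q : F.L} {d : Env} {C : F.machine.Config} (hC : Rep q d C) (hq : q ≠ F.halt)
    (hi : (F.next q d.obs).1 = .call) : ∃ L C', F.machine.Yields Ψ C C' ∧
      Shows .call ((F.next q d.obs).2, false) (Tape.mk' L (ListBlank.mk (d.input.map .inr)))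
        (ones F d.board) (ones F d.out) d.bit d.slaveInput d.slaveWork d.zeroTest d.slaveOutput C' := by
  obtain ⟨L, hC⟩ := hC
  obtain ⟨i, q', hn⟩ : ∃ i q', F.next q d.obs = (i, q') := ⟨_, _, rfl⟩
  rw [hn] at hi ⊢
  subst hi
  have ho : (F.isOne (Tape.mk' L (ListBlank.mk (d.input.map (.inr : Bool → F.Symbol)))).head, d.bit) =
      d.obs := by simp [isOne_headI, Env.obs]
  exact ⟨L, hC.yields (A := ((none, none, none), (q', false), .call)) (by rw [ho]; simp [action, hq, hn])⟩

/-- An instruction takes one or two steps of the machine. At least one is needed (`TransGen`) for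
the well-founded induction in `Rep.of_reaches`. -/
theorem Rep.step {q q' : F.L} {d d' : Env} {C : F.machine.Config} (hC : Rep q d C)
    (h : Step (Env.Exec Ψ) Env.obs F (q, d) (q', d')) :
    ∃ C', Relation.TransGen (F.machine.Yields Ψ) C C' ∧ Rep q' d' C' := by
  have hC' := hC
  obtain ⟨L, hC⟩ := hC
  have ho : (F.isOne (Tape.mk' L (ListBlank.mk (d.input.map (.inr : Bool → F.Symbol)))).head, d.bit) =
      d.obs := by simp [isOne_headI, Env.obs]
  cases h with
  | mk _ _ _ hq h =>
    obtain ⟨i, q', hn⟩ : ∃ i q', F.next q d.obs = (i, q') := ⟨_, _, rfl⟩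
    have hcall := Rep.call (Ψ := Ψ) hC' hq
    rw [hn] at h hcall ⊢
    cases i with
    | nop =>
      obtain rfl : d = d' := h
      obtain ⟨C', hy, hC'⟩ := hC.yields (Ψ := Ψ) (A := ((none, none, none), (q', false), .std false))
        (by rw [ho]; simp [action, hq, hn])
      exact ⟨C', .single hy, L, hC'⟩
    | next =>
      obtain rfl : d' = _ := h
      obtain ⟨C', hy, hC'⟩ := hC.yields (Ψ := Ψ)
        (A := ((some (.move .right), none, none), (q', false), .std false))
        (by rw [ho]; simp [action, hq, hn])
      refine ⟨C', .single hy, L.cons (ListBlank.mk (d.input.map .inr)).head, ?_⟩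
      simpa [execOpt, Tape.exec] using hC'
    | up =>
      obtain rfl : d' = _ := h
      obtain ⟨C', hy, hC'⟩ := hC.yields (Ψ := Ψ)
        (A := ((none, some (.write (.inr true)), none), (q, true), .std false))
        (by rw [ho]; simp [action, hq, hn])
      obtain ⟨C'', hy', hC''⟩ := hC'.yields (Ψ := Ψ)
        (A := ((none, some (.move .right), none), (q', false), .std false))
        (by simp only [execOpt]; rw [ho]; simp [action, hq, hn])
      refine ⟨C'', .head hy (.single hy'), L, ?_⟩
      simpa only [execOpt, ones_up] using hC''
    | down =>
      obtain rfl : d' = _ := h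
      obtain ⟨C', hy, hC'⟩ := hC.yields (Ψ := Ψ)
        (A := ((none, some (.move .left), none), (q, true), .std false))
        (by rw [ho]; simp [action, hq, hn])
      obtain ⟨C'', hy', hC''⟩ := hC'.yields (Ψ := Ψ)
        (A := ((none, some (.write (.inr false)), none), (q', false), .std false))
        (by simp only [execOpt]; rw [ho]; simp [action, hq, hn])
      refine ⟨C'', .head hy (.single hy'), L, ?_⟩
      simpa only [execOpt, ones_down] using hC''
    | emit =>
      obtain rfl : d' = _ := h
      obtain ⟨C', hy, hC'⟩ := hC.yields (Ψ := Ψ)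
        (A := ((none, none, some (.write (.inr true))), (q, true), .std false))
        (by rw [ho]; simp [action, hq, hn])
      obtain ⟨C'', hy', hC''⟩ := hC'.yields (Ψ := Ψ)
        (A := ((none, none, some (.move .right)), (q', false), .std false))
        (by simp only [execOpt]; rw [ho]; simp [action, hq, hn])
      refine ⟨C'', .head hy (.single hy'), L, ?_⟩
      simpa only [execOpt, ones_up] using hC''
    | call =>
      obtain ⟨z, hz, rfl⟩ := h
      obtain ⟨L, C', hy, hC'⟩ := hcall rfl
      obtain ⟨h1, h2, h3, h4, h5, h6, h7, h8, h9, h10⟩ := hC'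
      refine ⟨_, .head hy (.single (.call C' z h1 ?_)), L, rfl, h2, h3, h4, h5, h6, h7, rfl, rfl, rfl⟩
      rw [h4, h7, h8, number_ones]
      exact hz
    | test =>
      obtain ⟨b, hb, rfl⟩ := h
      obtain ⟨C', hy, hC'⟩ := hC.yields (Ψ := Ψ) (A := ((none, none, none), (q', false), .test))
        (by rw [ho]; simp [action, hq, hn])
      obtain ⟨h1, h2, h3, h4, h5, h6, h7, h8, h9, h10⟩ := hC'
      refine ⟨_, .head hy (.single (.test C' b h1 ?_)), L, rfl, h2, h3, h4, h5, rfl, h7, h8, h9, h10⟩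
      rw [h9]
      exact hb

theorem Rep.halt {d : Env} {C : F.machine.Config} (hC : Rep F.halt d C) :
    ∃ C', F.machine.Yields Ψ C C' ∧ C'.state = .std F.machine.halt ∧
      ∀ Y, F.machine.output C' Y = d.output Y := by
  obtain ⟨L, hC⟩ := hC
  obtain ⟨C', hy, hC'⟩ := hC.yields (Ψ := Ψ)
    (A := ((none, none, none), (F.halt, false), .std true)) (by simp [action])
  refine ⟨C', hy, hC'.state, fun Y => ?_⟩
  cases Y with
  | nat =>
    change F.machine.number (C'.tape .output) = d.out
    rw [hC'.output]
    exact number_ones _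
  | baire => exact hC'.slaveOutput

theorem Rep.reaches {q : F.L} {d d' : Env} {C : F.machine.Config} (hC : Rep q d C)
    (h : Relation.ReflTransGen (Step (Env.Exec Ψ) Env.obs F) (q, d) (F.halt, d')) :
    ∃ C', Relation.ReflTransGen (F.machine.Yields Ψ) C C' ∧ C'.state = .std F.machine.halt ∧
      ∀ Y, F.machine.output C' Y = d'.output Y := by
  generalize hc : (q, d) = c at h
  induction h using Relation.ReflTransGen.head_induction_on generalizing q d C with
  | refl =>
    obtain ⟨rfl, rfl⟩ := by simpa using hc
    obtain ⟨C', hy, h⟩ := hC.halt (Ψ := Ψ)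
    exact ⟨C', .single hy, h⟩
  | @head a c h _ ih =>
    subst hc
    obtain ⟨C', hy, hC'⟩ := hC.step h
    obtain ⟨C'', hy', h⟩ := ih hC' rfl
    exact ⟨C'', hy.to_reflTransGen.trans hy', h⟩

/-- Well-founded induction along the halting run. A flowchart step is simulated by the machine, and
determinism keeps the halting configuration reachable from the simulated point. -/
theorem Rep.of_reaches {q : F.L} {d : Env} {C C' : F.machine.Config} (hC : Rep q d C)
    (h : Relation.ReflTransGen (F.machine.Yields Ψ) C C') (hC' : C'.state = .std F.machine.halt) :
    ∃ d', Relation.ReflTransGen (Step (Env.Exec Ψ) Env.obs F) (q, d) (F.halt, d') ∧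
      ∀ Y, F.machine.output C' Y = d'.output Y := by
  have hu := F.machine.yields_rightUnique Ψ
  have ht : ∀ D, ¬ F.machine.Yields Ψ C' D := fun D => MSMachine.not_yields_of_halt hC'
  have hacc := (h.acc_of_terminal hu ht).transGen
  induction hacc generalizing q d with
  | intro C _ ih =>
    by_cases hq : q = F.halt
    · subst hq
      obtain ⟨C₁, hy, h1, h2⟩ := hC.halt (Ψ := Ψ)
      have h3 := h.of_terminal hu (fun D => MSMachine.not_yields_of_halt h1) (.single hy)
      rcases Relation.ReflTransGen.cases_head h3 with rfl | ⟨_, h3, -⟩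
      · exact ⟨d, .refl, h2⟩
      · exact absurd h3 (ht _)
    -- Every instruction except `call` can always be executed.
    · have hstep : ∃ d', Env.Exec Ψ (F.next q d.obs).1 d d' := by
        rcases hi : (F.next q d.obs).1 with _ | _ | _ | _ | _ | _ | _
        · exact ⟨_, rfl⟩
        · exact ⟨_, rfl⟩
        · exact ⟨_, rfl⟩
        · exact ⟨_, rfl⟩
        · exact ⟨_, rfl⟩
        -- The machine is now in state `call`, which is not terminal. Since it does reach the
        -- halting state, it must leave `call`, and the step by which it does so provides the result
        -- of the slaves.
        · obtain ⟨L, C₁, hy, h1⟩ := hC.call (Ψ := Ψ) hq hi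
          have h3 := Relation.ReflTransGen.of_terminal hu ht (.single hy) h
          rcases Relation.ReflTransGen.cases_head h3 with rfl | ⟨_, h3, -⟩
          · have := h1.state
            rw [hC'] at this
            cases this
          · cases h3 with
            | std q' hC' hq' => rw [h1.state] at hC'; cases hC'
            | call z _ hz =>
              rw [h1.billboard, h1.slaveInput, h1.slaveWork, number_ones] at hz
              exact ⟨_, z, hz, rfl⟩
            | test b hC' => rw [h1.state] at hC'; cases hC'
        · classical
          exact ⟨_, decide (d.zeroTest = 0), by simp, rfl⟩
      obtain ⟨d₁, hd₁⟩ := hstep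
      have hs := Step.mk (obs := Env.obs) q d d₁ hq hd₁
      obtain ⟨C₁, hy, hC₁⟩ := hC.step hs
      obtain ⟨d', h1, h2⟩ := ih C₁ (Relation.transGen_swap.2 hy) hC₁
        (.of_terminal hu ht hy.to_reflTransGen h)
      exact ⟨d', h1.head hs, h2⟩

/-- The work tape is blank at the beginning, and `control` reads a symbol without a control point as
the start. -/
theorem rep_init {p q : ℕ} (n : Fin p → ℕ) (x : Fin q → Baire) :
    Rep F.start (Env.init n x) (F.machine.init n x) := by
  refine ⟨ListBlank.mk [], rfl, rfl, ?_, rfl, rfl, rfl, rfl, rfl, rfl, rfl⟩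
  change Tape.mk₁ (F.machine.inputWord n) = Tape.mk₁ _
  congr 1
  simp only [MSMachine.inputWord, Env.init, List.map_flatMap]
  congr 1
  funext a
  simp
  rfl

end FlowChart

/-- The functions computed by flowcharts are MS-computable. -/
theorem FlowChart.Computable.msComputable {Ψ : ℕ → Baire →. Baire} {p q : ℕ} {Y : Codomain}
    {f : MixedFun p q Y} {R : Env → Env → Prop} (hR : FlowChart.Computable (Env.Exec Ψ) Env.obs R)
    (hf : ∀ n x v, v ∈ f n x ↔ ∃ d, R (Env.init n x) d ∧ d.output Y = v) : MSComputable Ψ f := by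
  obtain ⟨F, hF⟩ := hR
  refine ⟨F.machine, fun n x v => ?_⟩
  rw [hf]
  constructor
  · rintro ⟨d, hd, rfl⟩
    obtain ⟨C, h1, h2, h3⟩ := (FlowChart.rep_init n x).reaches ((hF _ _).1 hd)
    exact ⟨C, h1, h2, h3 Y⟩
  · rintro ⟨C, h1, h2, rfl⟩
    obtain ⟨d, h3, h4⟩ := (FlowChart.rep_init n x).of_reaches h1 h2
    exact ⟨d, (hF _ _).2 h3, (h4 Y).symm⟩

/-! ## From while programs to master-slave machines -/

/-- From `d`, the relation `P` leads to `d₁` and nowhere else. -/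
def RunsTo {D : Type} (P : D → D → Prop) (d d₁ : D) : Prop := ∀ d', P d d' ↔ d' = d₁

namespace RunsTo

variable {D : Type} {P P' : D → D → Prop} {d d₁ d₂ : D}

theorem comp (h : RunsTo P d d₁) (h' : RunsTo P' d₁ d₂) :
    RunsTo (fun d d' => ∃ u, P d u ∧ P' u d') d d₂ := fun d' => by
  simp only [h _, exists_eq_left, h' d']

theorem loop_stop {c : D → Prop} (hc : ¬ c d) : RunsTo (LoopRel c P) d d := fun d' => by
  rw [loopRel_iff]
  simp [hc, eq_comm]

theorem loop_step {c : D → Prop} (hc : c d) (h : RunsTo P d d₁) (h' : RunsTo (LoopRel c P) d₁ d₂) :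
    RunsTo (LoopRel c P) d d₂ := fun d' => by
  rw [loopRel_iff]
  simp [hc, h _, h' d']

end RunsTo

theorem track_three (a b c : Baire) :
    track 3 0 (interleave ![a, b, c]) = a ∧ track 3 1 (interleave ![a, b, c]) = b ∧
      track 3 2 (interleave ![a, b, c]) = c :=
  ⟨interleave_track ![a, b, c] 0, interleave_track ![a, b, c] 1, interleave_track ![a, b, c] 2⟩

theorem interleave_three_apply (a b c : Baire) (n : ℕ) : interleave ![a, b, c] n =
    if n % 3 = 0 then a (n / 3) else if n % 3 = 1 then b (n / 3) else c (n / 3) := by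
  have : n % 3 = 0 ∨ n % 3 = 1 ∨ n % 3 = 2 := by omega
  rcases this with h | h | h <;> simp [interleave, h]

theorem OracleTotal.interleave_three {f g h : Baire → Baire} (hf : OracleTotal f)
    (hg : OracleTotal g) (hh : OracleTotal h) :
    OracleTotal fun x => interleave ![f x, g x, h x] := by
  have hd : OracleTotal fun _ n => n / 3 := of_primrec (div_const 3)
  have := cond (fun n => n % 3 = 0) (Primrec.eq.comp (mod_const 3) (.const 0)) (hf.comp hd)
    (cond (fun n => n % 3 = 1) (Primrec.eq.comp (mod_const 3) (.const 1)) (hg.comp hd) (hh.comp hd))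
  convert this using 3
  rw [interleave_three_apply]

namespace Env

variable {Ψ : ℕ → Baire →. Baire}

/-- The relations on data computed by flowcharts. -/
abbrev Programmable (Ψ : ℕ → Baire →. Baire) (P : Env → Env → Prop) : Prop :=
  FlowChart.Computable (Exec Ψ) obs P

/-- New contents for the tapes of the slaves, with equal work and output tapes. -/
def set (d : Env) (s z : Baire) (b : Bool) : Env :=
  { d with slaveWork := s, zeroTest := z, slaveOutput := s, bit := b }

theorem set_self {d : Env} (h : d.slaveOutput = d.slaveWork) :
    d.set d.slaveWork d.zeroTest d.bit = d := by
  cases d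
  simp_all [set]

namespace Programmable

variable {P P' : Env → Env → Prop}

theorem seq (hP : Programmable Ψ P) (hP' : Programmable Ψ P') :
    Programmable Ψ fun d d' => ∃ u, P d u ∧ P' u d' :=
  FlowChart.Computable.comp (nop := .nop) (fun _ _ => Iff.rfl) hP hP'

theorem whileOne (hP : Programmable Ψ P) :
    Programmable Ψ (LoopRel (fun d => d.input.headI = true) P) :=
  FlowChart.Computable.loop (nop := .nop) (fun _ _ => Iff.rfl) (fun o => o.1) hP

theorem whileBit (hP : Programmable Ψ P) :
    Programmable Ψ (LoopRel (fun d => d.bit = false) P) :=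
  (FlowChart.Computable.loop (nop := .nop) (fun _ _ => Iff.rfl) (fun o => !o.2) hP).of_iff
    fun s u => by simp [obs]

theorem up (e : ℕ) : Programmable Ψ fun d d' => d' = { d with board := d.board + e } := by
  induction e with
  | zero =>
    exact (FlowChart.Computable.instr EnvInstr.nop).of_iff fun s u => (eq_comm : s = u ↔ u = s)
  | succ e ih =>
    exact (ih.seq (.instr EnvInstr.up)).of_iff fun s u => by simp [Exec, add_assoc]

theorem down (e : ℕ) : Programmable Ψ fun d d' => d' = { d with board := d.board - e } := by
  induction e with
  | zero =>
    exact (FlowChart.Computable.instr EnvInstr.nop).of_iff fun s u => (eq_comm : s = u ↔ u = s)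
  | succ e ih =>
    exact (ih.seq (.instr EnvInstr.down)).of_iff fun s u => by simp [Exec, Nat.sub_sub]

/-- The billboard is lowered again after the call, so that programs can be composed under the
invariant that it shows `0`. -/
theorem call (e : ℕ) : Programmable Ψ fun d d' =>
    ∃ z ∈ Ψ (d.board + e) (bpair d.slaveInput d.slaveWork),
      d' = { d with slaveWork := track 3 0 z, zeroTest := track 3 1 z, slaveOutput := track 3 2 z } := by
  refine (((up e).seq (.instr EnvInstr.call)).seq (down e)).of_iff fun s u => ?_
  simp only [Exec, exists_eq_left, bpair]
  constructor
  · rintro ⟨_, ⟨z, hz, rfl⟩, rfl⟩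
    exact ⟨z, hz, by simp⟩
  · rintro ⟨z, hz, rfl⟩
    exact ⟨_, ⟨z, hz, rfl⟩, by simp⟩

/-- The slaves compute a partial function of their input and their work tape. -/
theorem compute (hΨ : IsUniversalTTE Ψ) {M : Baire → ℕ →. ℕ} (hM : OracleComputable M) :
    ∃ P, Programmable Ψ P ∧ ∀ d d', d.board = 0 → (P d d' ↔
      ∃ s : Baire, (∀ i, s i ∈ M (bpair d.slaveInput d.slaveWork) i) ∧ d' = d.set s s d.bit) := by
  -- With argument `n / 3` the program repeats each entry three times, which puts the same sequence
  -- on all three tracks.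
  obtain ⟨e, he⟩ := hΨ.exists_index (hM.comp_total (.of_primrec (OracleTotal.div_const 3)))
  refine ⟨_, call e, fun d d' hd => ?_⟩
  simp only [hd, zero_add, he]
  constructor
  · rintro ⟨z, hz, rfl⟩
    have h : ∀ j < 3, ∀ i, track 3 j z i ∈ M (bpair d.slaveInput d.slaveWork) i := fun j hj i => by
      have := hz (3 * i + j)
      rwa [show (3 * i + j) / 3 = i by omega] at this
    have h' : ∀ j < 3, track 3 j z = track 3 0 z := fun j hj =>
      funext fun i => Part.mem_unique (h j hj i) (h 0 (by omega) i)
    refine ⟨track 3 0 z, h 0 (by omega), ?_⟩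
    rw [h' 1 (by omega), h' 2 (by omega)]
    simp [set, hd]
  · rintro ⟨s, hs, rfl⟩
    refine ⟨fun n => s (n / 3), fun i => hs _, ?_⟩
    have h : ∀ j < 3, track 3 j (fun n => s (n / 3)) = s := fun j hj => funext fun i => by
      rw [track, show (3 * i + j) / 3 = i by omega]
    rw [h 0 (by omega), h 1 (by omega), h 2 (by omega)]
    simp [set, hd]

theorem computeTotal (hΨ : IsUniversalTTE Ψ) {g : Baire → Baire} (hg : OracleTotal g) :
    ∃ P, Programmable Ψ P ∧ ∀ d, d.board = 0 →
      RunsTo P d (d.set (g (bpair d.slaveInput d.slaveWork))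
        (g (bpair d.slaveInput d.slaveWork)) d.bit) := by
  obtain ⟨P, hP, h⟩ := compute hΨ hg
  refine ⟨P, hP, fun d hd d' => ?_⟩
  rw [h d d' hd]
  simp [← funext_iff]

/-- The zero-test of a total function of the work tape. -/
theorem zeroTest (hΨ : IsUniversalTTE Ψ) {t : Baire → Baire} (ht : OracleTotal t) :
    ∃ P, Programmable Ψ P ∧ ∀ d, d.board = 0 →
      ∃ b : Bool, (b = true ↔ t d.slaveWork = 0) ∧
        RunsTo P d (d.set d.slaveWork (t d.slaveWork) b) := by
  -- In the oracle `bsnd` is the work tape. It is copied to the work and output tapes, and only the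
  -- zero-test tape receives `t` of it.
  obtain ⟨e, he⟩ := hΨ.exists_index_total
    (OracleTotal.interleave_three .bsnd (ht.subst .bsnd) .bsnd)
  refine ⟨_, (call e).seq (.instr EnvInstr.test), fun d hd => ?_⟩
  classical
  refine ⟨decide (t d.slaveWork = 0), by simp, fun d' => ?_⟩
  simp only [hd, zero_add, he, Part.mem_some_iff, exists_eq_left, bsnd_bpair, (track_three _ _ _).1,
    (track_three _ _ _).2.1, (track_three _ _ _).2.2, Exec]
  constructor
  · rintro ⟨b, hb, rfl⟩
    obtain rfl : b = decide (t d.slaveWork = 0) := by rw [Bool.eq_iff_iff]; simpa using hb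
    simp [set, hd]
  · rintro rfl
    exact ⟨_, decide_eq_true_iff, by simp [set, hd]⟩

end Programmable

/-- The relation `P` on data implements the relation `R` on the work tape of the slaves. -/
def Implements (P : Env → Env → Prop) (R : Baire → Baire → Prop) : Prop :=
  ∀ d : Env, d.board = 0 → d.slaveOutput = d.slaveWork →
    (∀ d', P d d' → ∃ s z b, R d.slaveWork s ∧ d' = d.set s z b) ∧
      ∀ s, R d.slaveWork s → ∃ z b, P d (d.set s z b)

/-- Slave calls serve as basic instructions. Equality of the output and work tapes is maintained
throughout, so that the result of the last instruction is also the output. -/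
theorem exists_implements (hΨ : IsUniversalTTE Ψ) {R : Baire → Baire → Prop} (hR : WhileRel R) :
    ∃ P, Programmable Ψ P ∧ Implements P R := by
  induction hR with
  | oracle hM =>
    obtain ⟨P, hP, h⟩ := Programmable.compute hΨ (hM.subst .bsnd)
    simp only [bsnd_bpair] at h
    refine ⟨P, hP, fun d hd _ => ⟨fun d' hd' => ?_, fun s hs => ?_⟩⟩
    · obtain ⟨s, hs, rfl⟩ := (h d d' hd).1 hd'
      exact ⟨s, _, _, hs, rfl⟩
    · exact ⟨_, _, (h d _ hd).2 ⟨s, hs, rfl⟩⟩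
  | comp _ _ h h' =>
    obtain ⟨P, hP, h⟩ := h
    obtain ⟨P', hP', h'⟩ := h'
    refine ⟨_, hP.seq hP', fun d hd ho => ⟨?_, ?_⟩⟩
    · rintro d' ⟨u, hu, hu'⟩
      obtain ⟨s, z, b, hs, rfl⟩ := (h d hd ho).1 u hu
      obtain ⟨s', z', b', hs', rfl⟩ := (h' (d.set s z b) hd rfl).1 d' hu'
      exact ⟨s', z', b', ⟨s, hs, hs'⟩, rfl⟩
    · rintro s' ⟨s, hs, hs'⟩
      obtain ⟨z, b, hu⟩ := (h d hd ho).2 s hs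
      obtain ⟨z', b', hu'⟩ := (h' (d.set s z b) hd rfl).2 s' hs'
      exact ⟨z', b', _, hu, hu'⟩
  | @loop t ht R _ h =>
    obtain ⟨P, hP, h⟩ := h
    obtain ⟨T, hT, hT'⟩ := Programmable.zeroTest hΨ ht
    -- The body may change the bit, so the test is repeated after each round. At each loop entry the
    -- bit is `true` iff `t` of the work tape is zero.
    refine ⟨_, hT.seq (hP.seq hT).whileBit, fun d hd ho => ?_⟩
    obtain ⟨b, hb, hd₁⟩ := hT' d hd
    simp only [hd₁ _, exists_eq_left]
    constructor
    · intro d' hL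
      have key : ∀ d d', LoopRel (fun d : Env => d.bit = false) (fun d d' => ∃ u, P d u ∧ T u d') d d' →
          d.board = 0 → d.slaveOutput = d.slaveWork → (d.bit = true ↔ t d.slaveWork = 0) →
          ∃ s z b, LoopRel (fun s => t s ≠ 0) R d.slaveWork s ∧ d' = d.set s z b := by
        intro d d' hL
        induction hL with
        | done d hc =>
          intro hd ho hb
          exact ⟨_, _, _, .done _ (by simpa [hb] using hc), (set_self ho).symm⟩
        | step d u d' hc hu _ ih =>
          intro hd ho hb
          obtain ⟨w, hw, hu⟩ := hu
          obtain ⟨s, z, b, hs, rfl⟩ := (h d hd ho).1 w hw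
          obtain ⟨b', hb', hT''⟩ := hT' (d.set s z b) hd
          obtain rfl := (hT'' _).1 hu
          obtain ⟨s', z', b'', hs', rfl⟩ := ih hd rfl hb'
          exact ⟨s', z', b'', .step _ s _ (by simp [← hb, hc]) hs hs', rfl⟩
      exact key (d.set d.slaveWork (t d.slaveWork) b) _ hL hd rfl hb
    · intro s hs
      have key : ∀ w s, LoopRel (fun s => t s ≠ 0) R w s → ∀ d : Env, d.slaveWork = w →
          d.board = 0 → d.slaveOutput = d.slaveWork → (d.bit = true ↔ t d.slaveWork = 0) →
          ∃ z b, LoopRel (fun d : Env => d.bit = false) (fun d d' => ∃ u, P d u ∧ T u d') d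
            (d.set s z b) := by
        intro w s hL
        induction hL with
        | done w hw =>
          rintro d rfl hd ho hb
          refine ⟨d.zeroTest, d.bit, ?_⟩
          rw [set_self ho]
          exact .done _ (by simpa [hb] using hw)
        | step w v s hw hR _ ih =>
          rintro d rfl hd ho hb
          obtain ⟨z, b, hP'⟩ := (h d hd ho).2 v hR
          obtain ⟨b', hb', hT''⟩ := hT' (d.set v z b) hd
          obtain ⟨z', b'', hL⟩ := ih ((d.set v z b).set v (t v) b') rfl hd rfl hb'
          refine ⟨z', b'', .step _ _ _ ?_ ⟨_, hP', (hT'' _).2 rfl⟩ hL⟩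
          have : ¬ d.bit = true := fun h => hw (hb.1 h)
          simpa using this
      exact key _ _ hs (d.set d.slaveWork (t d.slaveWork) b) rfl hd rfl hb

/-! ### Reading the input -/

/-- A block of the input. -/
def block (a : ℕ) : List Bool := List.replicate (a + 1) true ++ [false]

/-- For each scanned symbol the slaves increase entry `i` of the work tape and the master moves on;
the final `next` skips the blank that ends the block. -/
theorem Programmable.readBlock (hΨ : IsUniversalTTE Ψ) (i : ℕ) : ∃ P, Programmable Ψ P ∧
    ∀ d r m, d.board = 0 → d.slaveOutput = d.slaveWork →
      d.input = List.replicate m true ++ false :: r → ∃ z,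
        RunsTo P d { d.set (Function.update d.slaveWork i (d.slaveWork i + m)) z d.bit with
          input := r } := by
  have hinc : OracleTotal fun s n => if n = i then bsnd s n + 1 else bsnd s n :=
    .cond (fun n => n = i) (Primrec.eq.comp .id (.const i)) (OracleTotal.bsnd.map .succ) .bsnd
  obtain ⟨P, hP, h⟩ := Programmable.computeTotal hΨ hinc
  simp only [bsnd_bpair] at h
  have hnext : Programmable Ψ (Exec Ψ EnvInstr.next) := .instr EnvInstr.next
  refine ⟨_, ((hP.seq hnext).whileOne).seq hnext, fun d r m hd ho hr => ?_⟩
  induction m generalizing d with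
  | zero =>
    refine ⟨d.zeroTest, RunsTo.comp (RunsTo.loop_stop (by simp [hr])) fun d' => ?_⟩
    have hu : Function.update d.slaveWork i (d.slaveWork i + 0) = d.slaveWork := by simp
    rw [hu, set_self ho]
    simp [Exec, hr]
  | succ m ih =>
    have h1 := (h d hd).comp (P' := Exec Ψ EnvInstr.next) (fun d' => Iff.rfl)
    set w : Baire := fun n => if n = i then d.slaveWork n + 1 else d.slaveWork n with hw
    obtain ⟨z, h2⟩ := ih { d.set w w d.bit with input := d.input.tail } hd rfl (by rw [hr]; rfl)
    have hwi : Function.update w i (w i + m) =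
        Function.update d.slaveWork i (d.slaveWork i + (m + 1)) := by
      funext k
      by_cases hk : k = i
      · subst hk; simp [hw, add_assoc, add_comm 1]
      · simp [hw, hk]
    change RunsTo _ _ { d.set (Function.update w i (w i + m)) z d.bit with input := r } at h2
    rw [hwi] at h2
    refine ⟨z, fun d' => ?_⟩
    have h3 := h2 d'
    constructor
    · rintro ⟨u, hu, hu'⟩
      -- The first round has only one possible result, so the remaining rounds start from the data
      -- treated by the induction hypothesis.
      have h5 : LoopRel (fun d => d.input.headI = true) (fun d d' => ∃ u, P d u ∧ Exec Ψ EnvInstr.next u d')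
          { d.set w w d.bit with input := d.input.tail } u := by
        rcases loopRel_iff.1 hu with ⟨hc, -⟩ | ⟨_, w, hw, hL⟩
        · simp [hr, List.replicate_succ] at hc
        · rw [(h1 w).1 hw] at hL
          exact hL
      exact h3.1 ⟨u, h5, hu'⟩
    · rintro rfl
      obtain ⟨u, hu, hu'⟩ := h3.2 rfl
      exact ⟨u, .step _ _ _ (by simp [hr, List.replicate_succ]) ((h1 _).2 rfl) hu, hu'⟩

/-- One reading loop per argument, each for its own entry. A block for `a` has `a + 1` symbols; this
excess is removed later by `Nat.pred`. -/
theorem Programmable.readBlocks (hΨ : IsUniversalTTE Ψ) (k i : ℕ) : ∃ P, Programmable Ψ P ∧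
    ∀ (d : Env) (l : List ℕ), l.length = k → d.board = 0 → d.slaveOutput = d.slaveWork →
      d.input = l.flatMap block → ∃ (s z : Baire),
        RunsTo P d { d.set s z d.bit with input := [] } ∧
        (∀ j < i, s j = d.slaveWork j) ∧
        ∀ j (h : j < l.length), s (i + j) = d.slaveWork (i + j) + (l[j] + 1) := by
  induction k generalizing i with
  | zero =>
    refine ⟨_, .instr EnvInstr.nop, fun d l hl hd ho hi => ⟨d.slaveWork, d.zeroTest, fun d' => ?_, by simp,
      fun j hj => by omega⟩⟩
    rw [set_self ho]
    obtain rfl := List.length_eq_zero_iff.1 hl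
    have : { d with input := [] } = d := by
      cases d; simp_all
    rw [this]
    exact eq_comm
  | succ k ih =>
    obtain ⟨P, hP, h⟩ := Programmable.readBlock hΨ i
    obtain ⟨P', hP', h'⟩ := ih (i + 1)
    refine ⟨_, hP.seq hP', fun d l hl hd ho hi => ?_⟩
    obtain ⟨a, l, rfl⟩ := List.exists_cons_of_length_eq_add_one hl
    obtain ⟨z, h1⟩ := h d (l.flatMap block) (a + 1) hd ho (by rw [hi]; simp [block])
    obtain ⟨s, z', h2, h3, h4⟩ := h'
      { d.set (Function.update d.slaveWork i (d.slaveWork i + (a + 1))) z d.bit with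
        input := l.flatMap block } l (by simpa using hl) hd rfl rfl
    refine ⟨s, z', h1.comp h2, fun j hj => ?_, fun j hj => ?_⟩
    · rw [h3 j (by omega)]
      simp [set, show j ≠ i by omega]
    · cases j with
      | zero =>
        rw [add_zero, h3 i (by omega)]
        simp [set]
      | succ j =>
        have := h4 j (by simpa using hj)
        rw [show i + (j + 1) = i + 1 + j by omega, this]
        simp [set, show i + 1 + j ≠ i by omega]

/-! ### Writing the output -/

/-- A countdown: the slaves lower all entries of `hat v` by one and the master emits a symbol, until
the zero-test succeeds. -/
theorem Programmable.writeOutput (hΨ : IsUniversalTTE Ψ) : ∃ P, Programmable Ψ P ∧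
    ∀ (d : Env) (v : ℕ), d.board = 0 → d.slaveWork = hat v →
      ∃ d₁, RunsTo P d d₁ ∧ d₁.out = d.out + v := by
  obtain ⟨T, hT, hT'⟩ := Programmable.zeroTest hΨ OracleTotal.id
  obtain ⟨P, hP, h⟩ := Programmable.computeTotal hΨ (OracleTotal.bsnd.map Primrec.pred)
  simp only [bsnd_bpair] at h
  have hemit : Programmable Ψ (Exec Ψ EnvInstr.emit) := .instr EnvInstr.emit
  refine ⟨_, hT.seq (((hemit.seq hP).seq hT).whileBit), ?_⟩
  have key : ∀ (v : ℕ) (d : Env), d.board = 0 → d.slaveWork = hat v →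
      (d.bit = true ↔ d.slaveWork = 0) →
      ∃ d₁, RunsTo (LoopRel (fun d : Env => d.bit = false)
        (fun d v => ∃ u, (∃ u', Exec Ψ EnvInstr.emit d u' ∧ P u' u) ∧ T u v)) d d₁ ∧ d₁.out = d.out + v := by
    intro v
    induction v with
    | zero =>
      intro d hd hv hb
      refine ⟨d, RunsTo.loop_stop ?_, rfl⟩
      have : d.bit = true := hb.2 (hv.trans rfl)
      simp [this]
    | succ v ih =>
      intro d hd hv hb
      have h1 : RunsTo (Exec Ψ EnvInstr.emit) d { d with out := d.out + 1 } := fun d' => Iff.rfl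
      have h2 := h1.comp (h { d with out := d.out + 1 } hd)
      have hp : (fun n => (d.slaveWork n).pred) = hat v := by rw [hv]; rfl
      simp only [hp] at h2
      obtain ⟨b, hb', h3⟩ := hT' ({ d with out := d.out + 1 }.set (hat v) (hat v) d.bit) hd
      obtain ⟨d₁, h4, h5⟩ := ih
        (({ d with out := d.out + 1 }.set (hat v) (hat v) d.bit).set (hat v) (hat v) b) hd rfl hb'
      have hc : d.bit = false := by
        rw [← Bool.not_eq_true, hb, hv, hat_eq_zero]; simp
      refine ⟨d₁, RunsTo.loop_step hc (h2.comp h3) h4, ?_⟩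
      rw [h5]
      simp only [set]
      omega
  intro d v hd hv
  obtain ⟨b, hb, h1⟩ := hT' d hd
  obtain ⟨d₁, h2, h3⟩ := key v (d.set d.slaveWork d.slaveWork b) hd hv hb
  exact ⟨d₁, h1.comp h2, h3⟩

end Env

/-- Functions computed by while programs are MS-computable. -/
theorem MixedFun.msComputable_of_whileRel {Ψ : ℕ → Baire →. Baire} (hΨ : IsUniversalTTE Ψ)
    {p q : ℕ} {Y : Codomain} {f : MixedFun p q Y} (hf : WhileRel f.rel) : MSComputable Ψ f := by
  obtain ⟨P₁, hP₁, h₁⟩ := Env.Programmable.readBlocks hΨ p 0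
  -- The transition to tuples: `bsnd s` is the work tape with `n_i + 1` at entry `i`, and `bfst s`
  -- is the input tape of the slaves, whose tracks are the given sequences.
  have ht : OracleTotal fun s => btuple fun i => (Fin.append (fun i s => hat ((bsnd s i).pred))
      (fun j s => track q j (bfst s)) : Fin (p + q) → Baire → Baire) i s := by
    refine .btuple fun i => Fin.addCases (fun i => ?_) (fun j => ?_) i
    · simp only [Fin.append_left]
      exact (OracleTotal.bsnd.map Primrec.pred).hat i
    · simp only [Fin.append_right]
      exact OracleTotal.bfst.comp (.of_primrec (Primrec.nat_add.comp
        (Primrec.nat_mul.comp (.const q) .id) (.const (j : ℕ))))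
  obtain ⟨P₂, hP₂, h₂⟩ := Env.Programmable.computeTotal hΨ ht
  obtain ⟨P₃, hP₃, h₃⟩ := Env.exists_implements hΨ hf
  -- A numerical result must be transferred to the master's output tape; a sequence is already on
  -- the output tape of the slaves.
  obtain ⟨P₄, hP₄, h₄⟩ : ∃ P, Env.Programmable Ψ P ∧ ∀ (d : Env) (v : Y.Elem), d.board = 0 →
      d.out = 0 → d.slaveWork = Y.code v → d.slaveOutput = Y.code v →
        ∃ d₁, RunsTo P d d₁ ∧ d₁.output Y = v := by
    cases Y with
    | nat =>
      obtain ⟨P, hP, h⟩ := Env.Programmable.writeOutput hΨ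
      refine ⟨P, hP, fun d v hd ho hv _ => ?_⟩
      obtain ⟨d₁, h1, h2⟩ := h d v hd hv
      exact ⟨d₁, h1, h2.trans (by rw [ho, zero_add])⟩
    | baire =>
      exact ⟨_, .instr EnvInstr.nop, fun d v _ _ _ hv => ⟨d, fun d' => eq_comm, hv⟩⟩
  refine ((hP₁.seq hP₂).seq (hP₃.seq hP₄)).msComputable fun n x v => ?_
  obtain ⟨s, z, h5, -, h6⟩ := h₁ (Env.init n x) (List.ofFn n) (by simp) rfl rfl rfl
  have h7 := h5.comp (h₂ _ rfl)
  set d₁ := Env.set { Env.set (Env.init n x) s z (Env.init n x).bit with input := [] }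
    (btuple fun i => (Fin.append (fun i s => hat ((bsnd s i).pred))
      (fun j s => track q j (bfst s)) : Fin (p + q) → Baire → Baire) i
        (bpair (interleave x) s))
    (btuple fun i => (Fin.append (fun i s => hat ((bsnd s i).pred))
      (fun j s => track q j (bfst s)) : Fin (p + q) → Baire → Baire) i
        (bpair (interleave x) s)) false with hd₁
  have h8 : RunsTo _ _ d₁ := h7
  have hn : MixedFun.natArgs p d₁.slaveWork = n := by
    have : d₁.slaveWork = btuple _ := rfl
    rw [this, MixedFun.natArgs_btuple]
    funext i
    have := h6 i (by simp)
    simp only [zero_add] at this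
    simp [this, Env.init]
  have hx : MixedFun.baireArgs p q d₁.slaveWork = x := by
    have : d₁.slaveWork = btuple _ := rfl
    rw [this, MixedFun.baireArgs_btuple]
    funext j
    simp [interleave_track]
  have h9 := h₃ d₁ rfl rfl
  simp only [MixedFun.rel, hn, hx] at h9
  constructor
  · intro hv
    obtain ⟨z, b, h10⟩ := h9.2 _ ⟨v, hv, rfl⟩
    obtain ⟨d₂, h11, h12⟩ := h₄ (d₁.set (Y.code v) z b) v rfl rfl rfl rfl
    exact ⟨d₂, ⟨d₁, (h8 _).2 rfl, _, h10, (h11 _).2 rfl⟩, h12⟩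
  · rintro ⟨d, ⟨u, hu, w, hw, hwd⟩, rfl⟩
    rw [(h8 u).1 hu] at hw
    obtain ⟨s, z, b, ⟨v, hv, rfl⟩, rfl⟩ := h9.1 w hw
    obtain ⟨d₂, h11, h12⟩ := h₄ (d₁.set (Y.code v) z b) v rfl rfl rfl rfl
    rw [(h11 d).1 hwd, h12]
    exact hv

theorem PartRecOverBaire.msComputable {Ψ : ℕ → Baire →. Baire} (hΨ : IsUniversalTTE Ψ) {p q : ℕ}
    {Y : Codomain} {f : MixedFun p q Y} (hf : PartRecOverBaire Ψ p q Y f) : MSComputable Ψ f :=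
  MixedFun.msComputable_of_whileRel hΨ (hf.whileRel hΨ)

/-! ## Toolkit for partial recursive functions over Baire space -/

theorem Part.mem_tuple {α : Type} {n : ℕ} {u : Fin n → Part α} {v : Fin n → α} :
    v ∈ Part.tuple u ↔ ∀ i, v i ∈ u i := by
  constructor
  · rintro ⟨h, rfl⟩ i
    exact Part.get_mem (h i)
  · intro h
    exact ⟨fun i => Part.dom_iff_mem.2 ⟨_, h i⟩, funext fun i => Part.get_eq_of_mem (h i) _⟩

theorem Part.tuple_some {α : Type} {n : ℕ} (v : Fin n → α) :
    (Part.tuple fun i => Part.some (v i)) = Part.some v :=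
  Part.eq_some_iff.2 (Part.mem_tuple.2 fun i => Part.mem_some (v i))

namespace PartRecOverBaire

variable {Ψ : ℕ → Baire →. Baire} {p q r s : ℕ} {Y : Codomain}

theorem of_eq {f g : MixedFun p q Y} (hf : PartRecOverBaire Ψ p q Y f)
    (h : ∀ n x, f n x = g n x) : PartRecOverBaire Ψ p q Y g :=
  (funext fun n => funext fun x => h n x : f = g) ▸ hf

theorem comp_total {f : MixedFun p q Y} (hf : PartRecOverBaire Ψ p q Y f)
    {a : Fin p → (Fin r → ℕ) → (Fin s → Baire) → ℕ}
    (ha : ∀ i, PartRecOverBaire Ψ r s .nat fun n x => Part.some (a i n x))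
    {b : Fin q → (Fin r → ℕ) → (Fin s → Baire) → Baire}
    (hb : ∀ j, PartRecOverBaire Ψ r s .baire fun n x => Part.some (b j n x)) :
    PartRecOverBaire Ψ r s Y fun n x => f (fun i => a i n x) (fun j => b j n x) :=
  (hf.comp ha hb).of_eq fun n x => by
    simp only [MixedFun.comp]
    have h1 : (Part.tuple fun i => (Part.some (a i n x) : Part (Codomain.Elem .nat))) =
        Part.some fun i => a i n x := Part.tuple_some _
    have h2 : (Part.tuple fun j => (Part.some (b j n x) : Part (Codomain.Elem .baire))) =
        Part.some fun j => b j n x := Part.tuple_some _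
    rw [h1, h2, Part.bind_some, Part.bind_some]

/-- Composition with one partial function whose values are sequences. -/
theorem bind {f : MixedFun 0 1 Y} (hf : PartRecOverBaire Ψ 0 1 Y f) {h : MixedFun r s .baire}
    (hh : PartRecOverBaire Ψ r s .baire h) :
    PartRecOverBaire Ψ r s Y fun n x => (h n x).bind fun y => f Fin.elim0 (fun _ => y) :=
  (hf.comp (g := Fin.elim0) (h := fun _ => h) (fun i => i.elim0) (fun _ => hh)).of_eq fun n x => by
    ext v
    simp only [MixedFun.comp, Part.mem_bind_iff, Part.mem_tuple]
    constructor
    · rintro ⟨a, -, b, hb, hv⟩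
      refine ⟨b 0, hb 0, ?_⟩
      convert hv using 2
      exact funext fun i => by rw [Fin.eq_zero i]
    · rintro ⟨y, hy, hv⟩
      exact ⟨Fin.elim0, fun i => i.elim0, fun _ => y, fun _ => hy, hv⟩

/-- The zero function has one numerical argument, which need not be available when `r = 0`. A
`μ`-search supplies one: the least `k` at which the zero function vanishes is `0`. -/
theorem const (c : ℕ) : PartRecOverBaire Ψ r s .nat fun _ _ => Part.some c := by
  induction c with
  | zero =>
    have h := PartRecOverBaire.mu (p := r) (q := s)
      ((PartRecOverBaire.zero (Ψ := Ψ)).comp_total (r := r + 1) (s := s)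
        (b := Fin.elim0) (fun _ => .projNat (r + 1) s 0) (·.elim0))
    refine h.of_eq fun n x => ?_
    refine Part.eq_some_iff.2 (Nat.mem_rfind.2 ⟨?_, fun {m} hm => by omega⟩)
    simp
  | succ c ih => exact PartRecOverBaire.succ.comp_total (b := Fin.elim0) (fun _ => ih) (·.elim0)

theorem univ {a : (Fin r → ℕ) → (Fin s → Baire) → ℕ}
    (ha : PartRecOverBaire Ψ r s .nat fun n x => Part.some (a n x))
    {b : Fin q → (Fin r → ℕ) → (Fin s → Baire) → Baire}
    (hb : ∀ j, PartRecOverBaire Ψ r s .baire fun n x => Part.some (b j n x)) :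
    PartRecOverBaire Ψ r s .baire fun n x => Ψ (a n x) (interleave fun j => b j n x) :=
  (PartRecOverBaire.universal q).comp_total (fun _ => ha) hb

variable {a : (Fin r → ℕ) → (Fin s → Baire) → ℕ} {b b' : (Fin r → ℕ) → (Fin s → Baire) → Baire}

theorem interleave_total (hΨ : IsUniversalTTE Ψ) {b : Fin q → (Fin r → ℕ) → (Fin s → Baire) → Baire}
    (hb : ∀ j, PartRecOverBaire Ψ r s .baire fun n x => Part.some (b j n x)) :
    PartRecOverBaire Ψ r s .baire fun n x => Part.some (interleave fun j => b j n x) := by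
  obtain ⟨e, he⟩ := hΨ.exists_index_total .id
  exact (univ (const e) hb).of_eq fun n x => he _

theorem tte (hΨ : IsUniversalTTE Ψ) {g : Baire → Baire} (hg : OracleTotal g)
    (hb : PartRecOverBaire Ψ r s .baire fun n x => Part.some (b n x)) :
    PartRecOverBaire Ψ r s .baire fun n x => Part.some (g (b n x)) := by
  obtain ⟨e, he⟩ := hΨ.exists_index_total hg
  exact (univ (q := 1) (const e) fun _ => hb).of_eq fun n x => by rw [he, interleave_one]

theorem bpair (hΨ : IsUniversalTTE Ψ)
    (hb : PartRecOverBaire Ψ r s .baire fun n x => Part.some (b n x))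
    (hb' : PartRecOverBaire Ψ r s .baire fun n x => Part.some (b' n x)) :
    PartRecOverBaire Ψ r s .baire fun n x => Part.some (bpair (b n x) (b' n x)) :=
  (interleave_total hΨ (q := 2) (b := ![b, b']) (Fin.cases hb (Fin.cases hb' (·.elim0)))).of_eq
    fun n x => by
      rw [_root_.bpair]
      congr 2
      funext j
      refine Fin.cases rfl (Fin.cases rfl (·.elim0)) j

/-- The universal function for `q = 0` needs no argument in Baire space, so this works for every
arity. -/
theorem constBaire (hΨ : IsUniversalTTE Ψ) (c : ℕ) :
    PartRecOverBaire Ψ r s .baire fun _ _ => Part.some (hat c) := by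
  obtain ⟨e, he⟩ := hΨ.exists_index_total (OracleTotal.hat_const c)
  exact (univ (q := 0) (b := Fin.elim0) (const e) (·.elim0)).of_eq fun n x => he _

/-- Primitive recursion with values in Baire space: start with the zero sequence and add one to
every entry. -/
theorem hat (hΨ : IsUniversalTTE Ψ) (ha : PartRecOverBaire Ψ r s .nat fun n x => Part.some (a n x)) :
    PartRecOverBaire Ψ r s .baire fun n x => Part.some (hat (a n x)) := by
  have h := (constBaire hΨ (r := 0) (s := 0) 0).primRecBaire
    (tte hΨ (b := fun _ x => x 0) (OracleTotal.oracle.map Primrec.succ) (.projBaire 1 1 0))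
  have h' := h.comp_total (r := r) (s := s) (b := Fin.elim0) (fun _ => ha) (·.elim0)
  refine h'.of_eq fun n x => ?_
  simp only [MixedFun.primRecBaire]
  induction a n x with
  | zero => rfl
  | succ k ih =>
    simp only [ih, Part.bind_some]
    rfl

theorem zeroChar (hb : PartRecOverBaire Ψ r s .baire fun n x => Part.some (b n x)) :
    PartRecOverBaire Ψ r s .nat fun n x => Part.some (zeroChar (b n x)) :=
  PartRecOverBaire.isZero.comp_total (a := Fin.elim0) (b := fun _ => b) (·.elim0) (fun _ => hb)

/-- The universal function has values in Baire space only, so a number is recovered by search: it is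
the least `m` that equals entry `0`, and this equality is decided by an oracle computation followed
by zero-tests. -/
theorem head (hΨ : IsUniversalTTE Ψ)
    (hb : PartRecOverBaire Ψ r s .baire fun n x => Part.some (b n x)) :
    PartRecOverBaire Ψ r s .nat fun n x => Part.some (b n x 0) := by
  have hφ : Primrec₂ fun a b : ℕ => if a = b then 0 else 1 :=
    Primrec.ite (Primrec.eq.comp .fst .snd) (.const 0) (.const 1)
  have hg : OracleTotal fun y => _root_.hat (if bfst y 0 = bsnd y 0 then 0 else 1) :=
    .map₂ hφ (OracleTotal.bfst.hat 0) (OracleTotal.bsnd.hat 0)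
  -- The inner `zeroChar` is `1` in case of equality, whereas `mu` looks for a zero; the outer one
  -- negates it.
  have h := (zeroChar (hat hΨ (zeroChar (tte hΨ hg (bpair hΨ (hat hΨ (a := fun n _ => n 0)
    (.projNat 1 1 0)) (b' := fun _ x => x 0) (.projBaire 1 1 0)))))).mu
  have h' : PartRecOverBaire Ψ 0 1 .nat fun _ x => Part.some (x 0 0) := by
    refine h.of_eq fun n x => Part.eq_some_iff.2 (Nat.mem_rfind.2 ?_)
    simp only [Fin.cons_zero, bfst_bpair, bsnd_bpair, hat_apply, _root_.zeroChar, hat_eq_zero]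
    constructor
    · simp
    · intro m hm
      have : m ≠ x 0 0 := hm.ne
      simp [this]
  exact h'.comp_total (a := Fin.elim0) (b := fun _ => b) (·.elim0) (fun _ => hb)

/-- The universal function evaluates `φ` on constant sequences, which spares a derivation of `φ`
from the recursion schemes. -/
theorem map (hΨ : IsUniversalTTE Ψ) {φ : ℕ → ℕ} (hφ : Primrec φ)
    (ha : PartRecOverBaire Ψ r s .nat fun n x => Part.some (a n x)) :
    PartRecOverBaire Ψ r s .nat fun n x => Part.some (φ (a n x)) :=
  head hΨ (tte hΨ ((OracleTotal.oracle.map hφ).hat 0) (hat hΨ ha))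

end PartRecOverBaire

/-! ## From master-slave machines to partial recursive functions -/

theorem PartRecOverBaire.bind_head {Ψ : ℕ → Baire →. Baire} {p q : ℕ} {Y : Codomain}
    {f : MixedFun (p + 1) q Y} (hf : PartRecOverBaire Ψ (p + 1) q Y f) {g : MixedFun p q .nat}
    (hg : PartRecOverBaire Ψ p q .nat g) :
    PartRecOverBaire Ψ p q Y fun n x => (g n x).bind fun k => f (Fin.cons k n) x :=
  (hf.comp (r := p) (s := q) (g := Fin.cons g fun i n _ => Part.some (n i))
    (h := fun j _ x => Part.some (x j)) (Fin.cases hg (fun i => .projNat p q i))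
    (fun j => .projBaire p q j)).of_eq fun n x => by
    ext v
    simp only [MixedFun.comp, Part.mem_bind_iff, Part.mem_tuple, Fin.forall_fin_succ, Fin.cons_zero,
      Fin.cons_succ, Part.mem_some_iff]
    constructor
    · rintro ⟨a, ⟨h0, ha⟩, b, hb, hv⟩
      obtain rfl : b = x := funext hb
      obtain rfl : Fin.tail a = n := funext ha
      exact ⟨a 0, h0, by rwa [Fin.cons_self_tail]⟩
    · rintro ⟨k, hk, hv⟩
      exact ⟨Fin.cons k n, ⟨hk, fun _ => rfl⟩, x, fun _ => rfl, hv⟩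

namespace MSMachine

open Turing

/-! ### Finite types, codes of tapes and codes of the master -/

theorem finite_stmt (Γ : Type) [Finite Γ] : Finite (TM0.Stmt Γ) := by
  refine Finite.of_injective (β := Bool ⊕ Γ) (fun s => match s with
    | .move .left => .inl true
    | .move .right => .inl false
    | .write a => .inr a) ?_
  rintro (⟨_ | _⟩ | _) (⟨_ | _⟩ | _) h <;> simp_all

theorem finite_masterState (Q : Type) [Finite Q] : Finite (MasterState Q) := by
  refine Finite.of_injective (β := Option (Option Q)) (fun s => match s with
    | .std q => some (some q)
    | .call => some none
    | .test => none) ?_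
  rintro (_ | _ | _) (_ | _ | _) h <;> simp_all

theorem finite_masterTape (k : ℕ) : Finite (MasterTape k) := by
  refine Finite.of_injective (β := Option (Option (Option (Fin k)))) (fun t => match t with
    | .work i => some (some (some i))
    | .input => some (some none)
    | .billboard => some none
    | .output => none) ?_
  rintro (_ | _ | _ | _) (_ | _ | _ | _) h <;> simp_all

/-- A primitive recursive coding of a finite type. -/
@[reducible] noncomputable def primcodableOfFinite (α : Type) [Finite α] : Primcodable α :=
  Primcodable.ofEquiv (Fin (Nat.card α)) (Finite.equivFin α)

/-- A tape with finitely many non-blank symbols: the part to the left of the head, in reversed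
order, the symbol under the head, and the part to the right. -/
abbrev TapeCode (Γ : Type) : Type := List Γ × Γ × List Γ

namespace TapeCode

variable {Γ : Type} [Inhabited Γ]

/-- The tape with a given code. -/
def toTape (c : TapeCode Γ) : Tape Γ := Tape.mk₂ c.1 (c.2.1 :: c.2.2)

/-- Executing a command on a code of a tape. -/
def exec (c : TapeCode Γ) : TM0.Stmt Γ → TapeCode Γ
  | .move .left => (c.1.tail, c.1.headI, c.2.1 :: c.2.2)
  | .move .right => (c.2.1 :: c.1, c.2.2.headI, c.2.2.tail)
  | .write a => (c.1, a, c.2.2)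

/-- A code of the tape `Turing.Tape.mk₁ l`. -/
def ofList (l : List Γ) : TapeCode Γ := ([], l.headI, l.tail)

theorem mk_headI_cons_tail (l : List Γ) : ListBlank.mk (l.headI :: l.tail) = ListBlank.mk l := by
  have := ListBlank.cons_head_tail (ListBlank.mk l)
  simpa using this

theorem toTape_ofList (l : List Γ) : toTape (ofList l) = Tape.mk₁ l := by
  rw [toTape, ofList, Tape.mk₁, Tape.mk₂, Tape.mk₂, mk_headI_cons_tail]

theorem toTape_exec (c : TapeCode Γ) (s : TM0.Stmt Γ) : toTape (exec c s) = (toTape c).exec s := by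
  rcases s with (_ | _) | a
  · simp [toTape, exec, Tape.exec, Tape.mk₂]
  · simp only [toTape, exec, Tape.exec, Tape.mk₂, Tape.move_right_mk', mk_headI_cons_tail]
    simp
  · simp [toTape, exec, Tape.exec, Tape.mk₂]

theorem head_toTape (c : TapeCode Γ) : (toTape c).head = c.2.1 := by
  simp [toTape, Tape.mk₂]

theorem primrec_exec [Finite Γ] [Primcodable Γ] [Primcodable (TM0.Stmt Γ)] :
    Primrec₂ (exec (Γ := Γ)) := by
  have := finite_stmt Γ
  -- There are finitely many commands, so kind and symbol of a command are primitive recursive for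
  -- trivial reasons, and a case distinction on the kind remains.
  let kind : TM0.Stmt Γ → ℕ := fun s => match s with
    | .move .left => 0
    | .move .right => 1
    | .write _ => 2
  let symbol : TM0.Stmt Γ → Γ := fun s => match s with
    | .move _ => default
    | .write a => a
  have hk : Primrec kind := .dom_finite _
  have hs : Primrec symbol := .dom_finite _
  have hl : Primrec fun c : TapeCode Γ × TM0.Stmt Γ => c.1.1 := Primrec.fst.comp .fst
  have hh : Primrec fun c : TapeCode Γ × TM0.Stmt Γ => c.1.2.1 :=
    Primrec.fst.comp (Primrec.snd.comp .fst)
  have hr : Primrec fun c : TapeCode Γ × TM0.Stmt Γ => c.1.2.2 :=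
    Primrec.snd.comp (Primrec.snd.comp .fst)
  have h : Primrec fun c : TapeCode Γ × TM0.Stmt Γ =>
      if kind c.2 = 0 then (c.1.1.tail, c.1.1.headI, c.1.2.1 :: c.1.2.2)
      else if kind c.2 = 1 then (c.1.2.1 :: c.1.1, c.1.2.2.headI, c.1.2.2.tail)
      else (c.1.1, symbol c.2, c.1.2.2) := by
    refine Primrec.ite (Primrec.eq.comp (hk.comp .snd) (.const 0)) ?_
      (Primrec.ite (Primrec.eq.comp (hk.comp .snd) (.const 1)) ?_ ?_)
    · exact (Primrec.list_tail.comp hl).pair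
        ((Primrec.list_headI.comp hl).pair (Primrec.list_cons.comp hh hr))
    · exact (Primrec.list_cons.comp hh hl).pair
        ((Primrec.list_headI.comp hr).pair (Primrec.list_tail.comp hr))
    · exact hl.pair ((hs.comp .snd).pair hr)
  refine h.of_eq ?_
  rintro ⟨c, (_ | _) | a⟩ <;> simp [kind, symbol, exec]

open Classical in
/-- The number written on a tape with a given code. -/
noncomputable def count (a : Γ) (c : TapeCode Γ) : ℕ := c.1.count a + (c.2.1 :: c.2.2).count a

theorem primrec_count [Primcodable Γ] (a : Γ) : Primrec (count a) := by
  classical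
  have hc : Primrec fun l : List Γ => l.count a := by
    have h : PrimrecPred fun b : Γ => b = a := Primrec.eq.comp .id (.const a)
    refine (Primrec.list_length.comp (Primrec.listFilter h)).of_eq fun l => ?_
    rw [List.count_eq_length_filter]
    congr 2
  exact Primrec.nat_add.comp (hc.comp .fst) (hc.comp (Primrec.list_cons.comp
    (Primrec.fst.comp .snd) (Primrec.snd.comp .snd)))

end TapeCode

variable (M : MSMachine)

/-- The number of tapes of the master. -/
noncomputable abbrev tapes : ℕ := Nat.card (MasterTape M.workTapes)

/-- Codes of the state, the bit and the tapes of the master. -/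
abbrev MasterCode : Type :=
  MasterState M.Q × Bool × (Fin M.tapes → TapeCode M.Γ)

/-- The numbering of the tapes of the master. -/
noncomputable def tapeIndex : MasterTape M.workTapes ≃ Fin M.tapes :=
  have := finite_masterTape M.workTapes
  Finite.equivFin _

/-- The action of the master as a finite table. -/
noncomputable def table (x : (MasterState M.Q × (Fin M.tapes → M.Γ) × Bool) × Bool) :
    MasterState M.Q × Bool × (Fin M.tapes → TM0.Stmt M.Γ) :=
  match x.1.1 with
  | .std q =>
    let A := M.trans q (fun t => x.1.2.1 (M.tapeIndex t)) x.1.2.2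
    (A.2, x.1.2.2, fun i => A.1 (M.tapeIndex.symm i))
  | .call => (M.afterCall, x.1.2.2, fun i => .write (x.1.2.1 i))
  | .test => (M.afterTest, x.2, fun i => .write (x.1.2.1 i))

/-- One step of the master, where `t` is the result of the zero-test. -/
noncomputable def masterStep (c : M.MasterCode) (t : Bool) : M.MasterCode :=
  let A := M.table ((c.1, (fun i => (c.2.2 i).2.1), c.2.1), t)
  (A.1, A.2.1, fun i => (c.2.2 i).exec (A.2.2 i))

/-- The configuration with a given code of the master and given tapes of the slaves. -/
noncomputable def toConfig (x : Baire) (c : M.MasterCode) (y : Baire) : M.Config where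
  state := c.1
  tape := fun t => (c.2.2 (M.tapeIndex t)).toTape
  bit := c.2.1
  slaveInput := x
  slaveWork := track 3 0 y
  zeroTest := track 3 1 y
  slaveOutput := track 3 2 y

/-- The number on a tape. -/
noncomputable def codeNumber (t : MasterTape M.workTapes) (c : M.MasterCode) : ℕ :=
  (c.2.2 (M.tapeIndex t)).count M.one

theorem number_toConfig (t : MasterTape M.workTapes) (x : Baire) (c : M.MasterCode) (y : Baire) :
    M.number ((M.toConfig x c y).tape t) = M.codeNumber t c := by
  classical
  exact M.number_mk₂ _ _

/-- The initial code of the master for given numerical arguments. -/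
noncomputable def initCode (l : List ℕ) : M.MasterCode :=
  open Classical in
  (.std M.start, false, fun i => if M.tapeIndex.symm i = .input then
    TapeCode.ofList (l.flatMap fun a => List.replicate (a + 1) M.one ++ [default])
    else TapeCode.ofList [])

theorem toConfig_initCode {p q : ℕ} (n : Fin p → ℕ) (x : Fin q → Baire) :
    M.toConfig (interleave x) (M.initCode (List.ofFn n)) 0 = M.init n x := by
  have h : (M.toConfig (interleave x) (M.initCode (List.ofFn n)) 0).tape = (M.init n x).tape := by
    funext t
    cases t <;> simp [toConfig, initCode, init, TapeCode.toTape_ofList, inputWord]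
  have h' : M.toConfig (interleave x) (M.initCode (List.ofFn n)) 0 =
      { M.init n x with tape := (M.toConfig (interleave x) (M.initCode (List.ofFn n)) 0).tape } := rfl
  rw [h', h]

open Classical in
/-- The index of the slaves in a step: the number on the billboard in a slave call, and a fixed
index of a total function otherwise. -/
noncomputable def slaveIndex (e : ℕ) (c : M.MasterCode) : ℕ :=
  if c.1 = .call then M.codeNumber .billboard c else e

open Classical in
/-- The tapes of the slaves after a step. -/
noncomputable def slaveStep (c : M.MasterCode) (y z : Baire) : Baire :=
  if c.1 = .call then z else y

-- All kinds of steps get one form: the universal function produces `z`, then codes are updated.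
-- Outside slave calls the index is that of the identity, so `z` exists and is discarded; hence `z`
-- can be missing only in a slave call in which some slave does not halt.
open Classical in
theorem yields_toConfig_iff {Ψ : ℕ → Baire →. Baire} {e : ℕ} (he : ∀ x, Ψ e x = Part.some x)
    (x : Baire) (c : M.MasterCode) (y : Baire) (D : M.Config) :
    M.Yields Ψ (M.toConfig x c y) D ↔ c.1 ≠ .std M.halt ∧
      ∃ z ∈ Ψ (M.slaveIndex e c) (bpair x (track 3 0 y)),
        D = M.toConfig x (M.masterStep c (decide (track 3 1 y = 0))) (M.slaveStep c y z) := by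
  obtain ⟨st, b, T⟩ := c
  -- In the states `call` and `test` the table rewrites the scanned symbols, which leaves the codes
  -- of the tapes unchanged.
  have hw : ∀ (i : Fin M.tapes), (T i).exec (.write (T i).2.1) = T i := fun i => rfl
  constructor
  · intro h
    generalize hC : M.toConfig x (st, b, T) y = C at h
    cases h with
    | std q hst hq =>
      subst hC
      obtain rfl : st = .std q := hst
      refine ⟨by simpa using hq, ?_⟩
      simp only [slaveIndex, slaveStep, reduceCtorEq, if_false, he, Part.mem_some_iff, exists_eq_left]
      simp only [toConfig, masterStep, table, TapeCode.toTape_exec, TapeCode.head_toTape,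
        Equiv.symm_apply_apply]
    | call z hst hz =>
      have hz' := hz
      subst hC
      obtain rfl : st = .call := hst
      refine ⟨by simp, z, ?_, ?_⟩
      · rw [number_toConfig] at hz'
        simpa [slaveIndex, bpair, toConfig] using hz'
      · simp only [slaveStep, if_true, toConfig, masterStep, table, hw]
    | test b' hst hb =>
      subst hC
      obtain rfl : st = .test := hst
      refine ⟨by simp, ?_⟩
      have : b' = decide (track 3 1 y = 0) := by
        rw [Bool.eq_iff_iff, hb]
        simp [toConfig]
      subst this
      simp only [slaveIndex, slaveStep, reduceCtorEq, if_false, he, Part.mem_some_iff, exists_eq_left]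
      simp only [toConfig, masterStep, table, hw]
  · rintro ⟨hc, z, hz, rfl⟩
    rcases st with q | _ | _
    · have := Yields.std (Ψ := Ψ) (M.toConfig x (.std q, b, T) y) q rfl (by simpa using hc)
      convert this using 1
      simp only [slaveStep, reduceCtorEq, if_false]
      simp only [toConfig, masterStep, table, TapeCode.toTape_exec, TapeCode.head_toTape,
        Equiv.symm_apply_apply]
    · have := Yields.call (Ψ := Ψ) (M.toConfig x (.call, b, T) y) z rfl (by
        rw [number_toConfig]
        simpa [slaveIndex, bpair, toConfig] using hz)
      convert this using 1
      simp only [slaveStep, if_true, toConfig, masterStep, table, hw]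
    · have := Yields.test (Ψ := Ψ) (M.toConfig x (.test, b, T) y) (decide (track 3 1 y = 0)) rfl
        (by simp [toConfig])
      convert this using 1
      simp only [slaveStep, reduceCtorEq, if_false, toConfig, masterStep, table, hw]

/-! ### The master is primitive recursive -/

section Primrec

variable [Primcodable M.Γ] [Primcodable (MasterState M.Q)]

/-- The table has a finite domain, the commands act on each tape primitive recursively, and the
number of tapes is fixed. -/
theorem primrec_masterStep : Primrec₂ M.masterStep := by
  have := M.finΓ
  have := M.finQ
  have := finite_stmt M.Γ
  have := finite_masterState M.Q
  let _ := primcodableOfFinite (TM0.Stmt M.Γ)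
  have htab : Primrec M.table := .dom_finite _
  have hget : ∀ i, Primrec fun a : M.MasterCode × Bool => a.1.2.2 i := fun i =>
    Primrec.fin_app.comp (Primrec.snd.comp (Primrec.snd.comp .fst)) (.const i)
  have hheads : Primrec fun a : M.MasterCode × Bool => fun i => (a.1.2.2 i).2.1 :=
    Primrec.fin_curry.2 (Primrec₂.swap (Primrec.fin_curry₁.2 fun i =>
      Primrec.fst.comp (Primrec.snd.comp (hget i))))
  have hA : Primrec fun a : M.MasterCode × Bool =>
      M.table ((a.1.1, (fun i => (a.1.2.2 i).2.1), a.1.2.1), a.2) :=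
    htab.comp (((Primrec.fst.comp .fst).pair
      (hheads.pair (Primrec.fst.comp (Primrec.snd.comp .fst)))).pair .snd)
  refine (Primrec.fst.comp hA).pair ((Primrec.fst.comp (Primrec.snd.comp hA)).pair ?_)
  refine Primrec.fin_curry.2 (Primrec₂.swap (Primrec.fin_curry₁.2 fun i => ?_))
  exact TapeCode.primrec_exec.comp (hget i)
    (Primrec.fin_app.comp (Primrec.snd.comp (Primrec.snd.comp hA)) (.const i))

theorem primrec_codeNumber (t : MasterTape M.workTapes) : Primrec (M.codeNumber t) :=
  (TapeCode.primrec_count M.one).comp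
    (Primrec.fin_app.comp (Primrec.snd.comp .snd) (.const (M.tapeIndex t)))

open Classical in
theorem primrec_isState (st : MasterState M.Q) : PrimrecPred fun c : M.MasterCode => c.1 = st :=
  Primrec.eq.comp .fst (.const st)

open Classical in
theorem primrec_slaveIndex (e : ℕ) : Primrec (M.slaveIndex e) :=
  Primrec.ite (M.primrec_isState .call) (M.primrec_codeNumber .billboard) (.const e)

theorem primrec_initCode : Primrec M.initCode := by
  classical
  refine (Primrec.const _).pair ((Primrec.const _).pair (Primrec.fin_curry.2 (Primrec₂.swap
    (Primrec.fin_curry₁.2 fun i => ?_))))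
  have hrep : Primrec fun a : ℕ => List.replicate (a + 1) M.one ++ [default] := by
    refine Primrec.list_append.comp (.of_eq (Primrec.list_map (g := fun _ _ => M.one)
      (Primrec.list_range.comp Primrec.succ) (Primrec.const _).to₂) fun a => ?_) (.const _)
    simp
  have hword : Primrec fun l : List ℕ =>
      l.flatMap fun a => List.replicate (a + 1) M.one ++ [default] :=
    Primrec.list_flatMap .id (hrep.comp .snd)
  by_cases h : M.tapeIndex.symm i = .input
  · simp only [h, if_true]
    exact (Primrec.const _).pair ((Primrec.list_headI.comp hword).pair
      (Primrec.list_tail.comp hword))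
  · simp only [h, if_false]
    exact .const _

/-- The number of a code of the master. -/
noncomputable def godel (c : M.MasterCode) : ℕ := @Encodable.encode _ Primcodable.toEncodable c

/-- The code of the master with a given number. -/
noncomputable def ungodel (n : ℕ) : Option M.MasterCode :=
  @Encodable.decode _ Primcodable.toEncodable n

theorem ungodel_godel (c : M.MasterCode) : M.ungodel (M.godel c) = some c :=
  @Encodable.encodek _ Primcodable.toEncodable c

theorem primrec_godel : Primrec M.godel := Primrec.encode

theorem primrec_ungodel : Primrec M.ungodel := Primrec.decode

/-- A function of codes of the master as a function of numbers. -/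
noncomputable def onCodes (F : M.MasterCode → ℕ) (n : ℕ) : ℕ := ((M.ungodel n).map F).getD 0

/-- Values at numbers that code nothing are irrelevant, since snapshots contain only numbers of
codes. -/
theorem onCodes_godel (F : M.MasterCode → ℕ) (c : M.MasterCode) :
    M.onCodes F (M.godel c) = F c := by
  simp [onCodes, ungodel_godel]

theorem primrec_onCodes {F : M.MasterCode → ℕ} (hF : Primrec F) : Primrec (M.onCodes F) :=
  Primrec.option_getD.comp (Primrec.option_map M.primrec_ungodel (hF.comp .snd)) (.const 0)

theorem primrec₂_onCodes {F : M.MasterCode → ℕ → ℕ} (hF : Primrec₂ F) :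
    Primrec₂ fun n t => M.onCodes (fun c => F c t) n :=
  Primrec.option_getD.comp (Primrec.option_map (M.primrec_ungodel.comp .fst)
    (hF.comp .snd (Primrec.snd.comp .fst))) (.const 0)

/-- The sequence that represents a configuration. -/
noncomputable def snapshot (x : Baire) (c : M.MasterCode) (y : Baire) : Baire :=
  bpair (hat (M.godel c)) (bpair x y)

/-! ### Machine steps on snapshots -/

variable {M} {Ψ : ℕ → Baire →. Baire}

variable (M) in
open Classical in
/-- The next snapshot, computed from the snapshot, the result of a slave call, and the result of
the zero-test. -/
noncomputable def nextSnapshot (s z t : Baire) : Baire :=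
  bpair (hat (M.onCodes (fun c => M.godel (M.masterStep c (decide (t 0 = 1)))) (bfst s 0)))
    (bpair (bfst (bsnd s)) fun i =>
      if M.onCodes (fun c => if c.1 = .call then 1 else 0) (bfst s 0) = 0 then bsnd (bsnd s) i
      else z i)

open Classical in
theorem nextSnapshot_snapshot (x : Baire) (c : M.MasterCode) (y z : Baire) :
    M.nextSnapshot (M.snapshot x c y) z (hat (zeroChar (track 3 1 y))) =
      M.snapshot x (M.masterStep c (decide (track 3 1 y = 0))) (M.slaveStep c y z) := by
  simp only [nextSnapshot, snapshot, bfst_bpair, bsnd_bpair, hat_apply, onCodes_godel, slaveStep]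
  by_cases h : c.1 = .call <;> by_cases h' : track 3 1 y = 0 <;> simp [zeroChar, h, h']

-- The two ingredients that this oracle computation could not provide in this form, the possibly
-- divergent slave call and the discontinuous zero-test, enter as the arguments `z` and `t`. The
-- rest is primitive recursive in the number of the code, which is read at entry `0`.
open Classical in
theorem oracleTotal_nextSnapshot :
    OracleTotal fun v => M.nextSnapshot (bfst (bfst v)) (bsnd (bfst v)) (bsnd v) := by
  have hφ : Primrec₂ fun n t => M.onCodes
      (fun c => M.godel (M.masterStep c (decide (t = 1)))) n :=
    M.primrec₂_onCodes (F := fun c t => M.godel (M.masterStep c (decide (t = 1))))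
      (M.primrec_godel.comp (M.primrec_masterStep.comp .fst
        (PrimrecPred.decide (Primrec.eq.comp .snd (.const 1)))))
  have hκ : Primrec (M.onCodes fun c => if c.1 = .call then 1 else 0) :=
    M.primrec_onCodes (Primrec.ite (M.primrec_isState .call) (.const 1) (.const 0))
  have hs : OracleTotal fun v => bfst (bfst v) := OracleTotal.bfst.subst .bfst
  have hz : OracleTotal fun v => bsnd (bfst v) := OracleTotal.bsnd.subst .bfst
  have hc : OracleTotal fun v _ => bfst (bfst (bfst v)) 0 := (OracleTotal.bfst.subst hs).hat 0
  have ht : OracleTotal fun v _ => bsnd v 0 := OracleTotal.bsnd.hat 0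
  have h1 := OracleTotal.map₂ hφ hc ht
  have h2 : OracleTotal fun v => bfst (bsnd (bfst (bfst v))) :=
    (OracleTotal.bfst.subst .bsnd).subst hs
  have h3 : OracleTotal fun v => bsnd (bsnd (bfst (bfst v))) :=
    (OracleTotal.bsnd.subst .bsnd).subst hs
  exact .bpair h1 (.bpair h2 (.ite (hc.map hκ) h3 hz))

-- The slave call is the universal function at an index computed from the snapshot, and the
-- zero-test is `zeroChar` of the old zero-test track. Both are evaluated in every step, whether or
-- not the master asks for them.
open Classical in
theorem exists_step (hΨ : IsUniversalTTE Ψ) (e : ℕ) : ∃ f : MixedFun 0 1 .baire,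
    PartRecOverBaire Ψ 0 1 .baire f ∧ ∀ n x c y, f n (fun _ => M.snapshot x c y) =
      (Ψ (M.slaveIndex e c) (bpair x (track 3 0 y))).map fun z =>
        M.snapshot x (M.masterStep c (decide (track 3 1 y = 0))) (M.slaveStep c y z) := by
  have hs : PartRecOverBaire Ψ 0 1 .baire fun _ x => Part.some (x 0) := .projBaire 0 1 0
  have htrack : ∀ j, OracleTotal (track 3 j) := fun j =>
    .oracle_at (φ := fun i => 3 * i + j) (Primrec.nat_add.comp
      (Primrec.nat_mul.comp (.const 3) .id) (.const j))
  have hcode := PartRecOverBaire.head hΨ (PartRecOverBaire.tte hΨ .bfst hs)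
  have hidx := PartRecOverBaire.map hΨ (M.primrec_onCodes (M.primrec_slaveIndex e)) hcode
  have hx := PartRecOverBaire.tte hΨ (OracleTotal.bfst.subst .bsnd) hs
  have hw := PartRecOverBaire.tte hΨ ((htrack 0).subst (OracleTotal.bsnd.subst .bsnd)) hs
  have hZ := PartRecOverBaire.univ (q := 1) hidx fun _ => PartRecOverBaire.bpair hΨ hx hw
  have hs' : PartRecOverBaire Ψ 0 2 .baire fun _ x => Part.some (x 0) := .projBaire 0 2 0
  have hz' : PartRecOverBaire Ψ 0 2 .baire fun _ x => Part.some (x 1) := .projBaire 0 2 1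
  have ht := PartRecOverBaire.zeroChar (PartRecOverBaire.tte hΨ
    ((htrack 1).subst (OracleTotal.bsnd.subst .bsnd)) hs')
  have hT := PartRecOverBaire.tte hΨ M.oracleTotal_nextSnapshot (PartRecOverBaire.bpair hΨ
    (PartRecOverBaire.bpair hΨ hs' hz') (PartRecOverBaire.hat hΨ ht))
  obtain ⟨B, hB, hB'⟩ : ∃ B, PartRecOverBaire Ψ 0 1 .baire B ∧ ∀ n x,
      B n x = Ψ (M.onCodes (M.slaveIndex e) (bfst (x 0) 0))
        (bpair (bfst (bsnd (x 0))) (track 3 0 (bsnd (bsnd (x 0))))) :=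
    ⟨_, hZ, fun n x => by rw [interleave_one]⟩
  obtain ⟨T, hT, hT'⟩ : ∃ T, PartRecOverBaire Ψ 0 2 .baire T ∧ ∀ n x, T n x = Part.some
      (M.nextSnapshot (x 0) (x 1) (hat (zeroChar (track 3 1 (bsnd (bsnd (x 0))))))) :=
    ⟨_, hT, fun n x => by simp only [bfst_bpair, bsnd_bpair]⟩
  -- Composition is defined only if `B` is, so the step is undefined precisely when the call of the
  -- universal function is.
  refine ⟨_, hT.comp (g := Fin.elim0) (h := ![fun _ x => Part.some (x 0), B]) (·.elim0)
    (Fin.cases hs (Fin.cases hB (·.elim0))), fun n x c y => ?_⟩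
  ext v
  simp only [MixedFun.comp, Part.mem_bind_iff, Part.mem_tuple, Part.mem_map_iff, Part.mem_some_iff,
    Fin.forall_fin_two, Matrix.cons_val_zero, Matrix.cons_val_one, hB', hT']
  have h1 : bsnd (bsnd (M.snapshot x c y)) = y := by simp [snapshot]
  have h2 : bfst (bsnd (M.snapshot x c y)) = x := by simp [snapshot]
  have h3 : M.onCodes (M.slaveIndex e) (bfst (M.snapshot x c y) 0) = M.slaveIndex e c := by
    simp [snapshot, onCodes_godel]
  simp only [h1, h2, h3]
  constructor
  · rintro ⟨a, -, b, ⟨hb, hz⟩, rfl⟩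
    exact ⟨b 1, hz, by rw [hb, h1, nextSnapshot_snapshot]⟩
  · rintro ⟨z, hz, rfl⟩
    refine ⟨Fin.elim0, (·.elim0), ![M.snapshot x c y, z], ⟨rfl, hz⟩, ?_⟩
    rw [Matrix.cons_val_zero, Matrix.cons_val_one, Matrix.cons_val_zero, h1, nextSnapshot_snapshot]

/-- The first `p` entries of the interleaving of `p` constant sequences are the numbers themselves,
so an oracle computation can collect the numerical input from an initial segment. -/
theorem exists_init (hΨ : IsUniversalTTE Ψ) (p q : ℕ) :
    PartRecOverBaire Ψ p q .baire fun n x =>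
      Part.some (M.snapshot (interleave x) (M.initCode (List.ofFn n)) 0) := by
  have hn := PartRecOverBaire.interleave_total hΨ (q := p) (r := p) (s := q)
    (b := fun i n _ => hat (n i)) fun i => PartRecOverBaire.hat hΨ (.projNat p q i)
  have hx := PartRecOverBaire.interleave_total hΨ (q := q) (r := p) (s := q)
    (b := fun j _ x => x j) fun j => .projBaire p q j
  have hφ : Primrec fun m : ℕ => M.godel (M.initCode
      ((Encodable.decode (α := List ℕ) m).getD []).reverse) :=
    M.primrec_godel.comp (M.primrec_initCode.comp (Primrec.list_reverse.comp
      (Primrec.option_getD.comp .decode (.const []))))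
  -- `initialSegment` lists the entries from the last to the first; hence the reversal.
  have hg : OracleTotal fun v => hat (M.godel (M.initCode
      (OracleComputable.initialSegment v p).reverse)) := by
    have h1 : OracleTotal fun v n => Encodable.encode (OracleComputable.initialSegment v n) :=
      OracleComputable.computable_initialSegment
    have := (h1.map hφ).hat p
    simpa using this
  refine (PartRecOverBaire.bpair hΨ (PartRecOverBaire.tte hΨ hg hn)
    (PartRecOverBaire.bpair hΨ hx (PartRecOverBaire.constBaire hΨ 0))).of_eq fun n x => ?_
  have : (OracleComputable.initialSegment (interleave fun i => hat (n i)) p).reverse =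
      List.ofFn n := by
    refine List.ext_getElem? fun i => ?_
    rw [OracleComputable.getElem?_initialSegment, List.getElem?_ofFn]
    split_ifs with h
    · simp [interleave, Nat.mod_eq_of_lt h, show 0 < p by omega]
    · rfl
  rw [this]
  rfl

theorem exists_output (hΨ : IsUniversalTTE Ψ) (Y : Codomain) : ∃ f : MixedFun 0 1 Y,
    PartRecOverBaire Ψ 0 1 Y f ∧ ∀ n x c y, f n (fun _ => M.snapshot x c y) =
      Part.some (M.output (M.toConfig x c y) Y) := by
  have hs : PartRecOverBaire Ψ 0 1 .baire fun _ x => Part.some (x 0) := .projBaire 0 1 0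
  cases Y with
  | nat =>
    refine ⟨_, PartRecOverBaire.map hΨ (M.primrec_onCodes (M.primrec_codeNumber .output))
      (PartRecOverBaire.head hΨ (PartRecOverBaire.tte hΨ .bfst hs)), fun n x c y => ?_⟩
    simp only [snapshot, bfst_bpair, hat_apply, onCodes_godel]
    exact congrArg Part.some (M.number_toConfig .output x c y).symm
  | baire =>
    have htrack : OracleTotal (track 3 2) :=
      .oracle_at (φ := fun i => 3 * i + 2) (Primrec.nat_add.comp
        (Primrec.nat_mul.comp (.const 3) .id) (.const 2))
    refine ⟨_, PartRecOverBaire.tte hΨ (htrack.subst (OracleTotal.bsnd.subst .bsnd)) hs,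
      fun n x c y => ?_⟩
    simp only [snapshot, bsnd_bpair]
    rfl

open Classical in
theorem exists_flag (hΨ : IsUniversalTTE Ψ) : ∃ f : MixedFun 0 1 .nat,
    PartRecOverBaire Ψ 0 1 .nat f ∧ ∀ n x c y, f n (fun _ => M.snapshot x c y) =
      Part.some (if c.1 = .std M.halt then 0 else 1) := by
  have hs : PartRecOverBaire Ψ 0 1 .baire fun _ x => Part.some (x 0) := .projBaire 0 1 0
  refine ⟨_, PartRecOverBaire.map hΨ (M.primrec_onCodes (Primrec.ite
    (M.primrec_isState (.std M.halt)) (.const 0) (.const 1)))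
      (PartRecOverBaire.head hΨ (PartRecOverBaire.tte hΨ .bfst hs)), fun n x c y => ?_⟩
  simp [snapshot, onCodes_godel]

/-- A run of the machine, as an iteration of a partial function on Baire space. -/
def run (f : MixedFun 0 1 .baire) (s : Baire) (k : ℕ) : Part Baire :=
  Nat.rec (Part.some s) (fun _ ih => ih.bind fun y => f Fin.elim0 (fun _ => y)) k

theorem run_succ (f : MixedFun 0 1 .baire) (s : Baire) (k : ℕ) :
    run f s (k + 1) = (run f s k).bind fun y => f Fin.elim0 (fun _ => y) := rfl

-- Kleene normal form: the output at the first stage at which the flag is `0`. The iterated step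
-- ignores the halting state, so `run` and the machine agree only up to the first halting stage.
-- This suffices, because `mu` requires all earlier flags to be defined and nonzero.
open Classical in
theorem computes_partRecOverBaire (hΨ : IsUniversalTTE Ψ) {p q : ℕ} {Y : Codomain}
    {f : MixedFun p q Y} (hf : M.Computes Ψ f) : PartRecOverBaire Ψ p q Y f := by
  obtain ⟨e, he⟩ := hΨ.exists_index_total .id
  obtain ⟨st, hst, hst'⟩ := exists_step (M := M) hΨ e
  obtain ⟨out, hout, hout'⟩ := exists_output (M := M) hΨ Y
  obtain ⟨flag, hflag, hflag'⟩ := exists_flag (M := M) hΨ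
  -- The recursion places the previous snapshot last among the sequences, and the step uses nothing
  -- else.
  have hF := (exists_init (M := M) hΨ p q).primRecBaire
    (PartRecOverBaire.bind hst (.projBaire (p + 1) (q + 1) (Fin.last q)))
  have hF' : PartRecOverBaire Ψ (p + 1) q .baire fun n x =>
      run st (M.snapshot (interleave x) (M.initCode (List.ofFn (Fin.tail n))) 0) (n 0) := by
    refine hF.of_eq fun n x => ?_
    simp only [MixedFun.primRecBaire, run, Part.bind_some, Fin.snoc_last]
  -- The stage found by `mu` is inserted as the recursion argument of the run, and the output is
  -- read from the resulting snapshot.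
  have hres := PartRecOverBaire.bind hout
    (hF'.bind_head (PartRecOverBaire.bind hflag hF').mu)
  refine hres.of_eq fun n x => ?_
  simp only [MixedFun.mu, Fin.tail_cons, Fin.cons_zero]
  set s₀ := M.snapshot (interleave x) (M.initCode (List.ofFn n)) 0 with hs₀
  set X := interleave x with hX
  -- runs of the machine give runs of the iteration
  have hA : ∀ D, Relation.ReflTransGen (M.Yields Ψ) (M.init n x) D → ∃ k c y,
      D = M.toConfig X c y ∧ M.snapshot X c y ∈ run st s₀ k ∧
        ∀ j < k, ∃ c' y', c'.1 ≠ .std M.halt ∧ M.snapshot X c' y' ∈ run st s₀ j := by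
    intro D hD
    induction hD with
    | refl => exact ⟨0, _, _, (M.toConfig_initCode n x).symm, Part.mem_some _, by simp⟩
    | tail _ h ih =>
      obtain ⟨k, c, y, rfl, hk, hj⟩ := ih
      obtain ⟨hc, z, hz, rfl⟩ := (M.yields_toConfig_iff he X c y _).1 h
      refine ⟨k + 1, _, _, rfl, ?_, fun j hjk => ?_⟩
      · rw [run_succ]
        refine Part.mem_bind_iff.2 ⟨_, hk, ?_⟩
        rw [hst']
        exact (Part.mem_map_iff _).2 ⟨z, hz, rfl⟩
      · rcases Nat.lt_succ_iff_lt_or_eq.1 hjk with hjk | rfl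
        · exact hj j hjk
        · exact ⟨c, y, hc, hk⟩
  -- and conversely
  have hB : ∀ k s, s ∈ run st s₀ k → (∀ j < k, ∀ c' y', M.snapshot X c' y' ∈ run st s₀ j →
      c'.1 ≠ .std M.halt) → ∃ c y, s = M.snapshot X c y ∧
        Relation.ReflTransGen (M.Yields Ψ) (M.init n x) (M.toConfig X c y) := by
    intro k
    induction k with
    | zero =>
      intro s hs _
      refine ⟨_, _, Part.mem_some_iff.1 hs, ?_⟩
      rw [M.toConfig_initCode n x]
    | succ k ih =>
      intro s hs hj
      obtain ⟨s', hs', hs⟩ := Part.mem_bind_iff.1 hs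
      obtain ⟨c, y, rfl, hr⟩ := ih s' hs' fun j hjk => hj j (by omega)
      rw [hst'] at hs
      obtain ⟨z, hz, rfl⟩ := (Part.mem_map_iff _).1 hs
      exact ⟨_, _, rfl, hr.tail ((M.yields_toConfig_iff he X c y _).2
        ⟨hj k (by omega) c y hs', z, hz, rfl⟩)⟩
  have hfl : ∀ k c y, M.snapshot X c y ∈ run st s₀ k →
      ∀ m, m ∈ ((run st s₀ k).bind fun y => flag Fin.elim0 fun _ => y) ↔
        m = if c.1 = .std M.halt then 0 else 1 := by
    intro k c y hk m
    rw [Part.eq_some_iff.2 hk, Part.bind_some, hflag', Part.mem_some_iff]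
  ext v
  rw [hf n x v]
  constructor
  · intro hv
    obtain ⟨s, hs, hv⟩ := Part.mem_bind_iff.1 hv
    obtain ⟨K, hK, hs⟩ := Part.mem_bind_iff.1 hs
    obtain ⟨hK, hlt⟩ := Nat.mem_rfind.1 hK
    obtain ⟨c, y, rfl, hr⟩ := hB K s hs fun j hj c' y' hc' hh => by
      obtain ⟨m, hm, hm'⟩ := (Part.mem_map_iff _).1 (hlt hj)
      rw [(hfl j c' y' hc' m).1 hm, if_pos hh] at hm'
      simp at hm'
    obtain ⟨m, hm, hm'⟩ := (Part.mem_map_iff _).1 hK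
    rw [hout', Part.mem_some_iff] at hv
    refine ⟨_, hr, ?_, hv.symm⟩
    by_contra hh
    change ¬ c.1 = _ at hh
    rw [(hfl K c y hs m).1 hm, if_neg hh] at hm'
    simp at hm'
  · rintro ⟨C, hC, hh, rfl⟩
    obtain ⟨K, c, y, rfl, hK, hlt⟩ := hA C hC
    refine Part.mem_bind_iff.2 ⟨_, Part.mem_bind_iff.2 ⟨K, Nat.mem_rfind.2 ⟨?_, fun {j} hj => ?_⟩,
      hK⟩, ?_⟩
    · exact (Part.mem_map_iff _).2 ⟨0, (hfl K c y hK 0).2 (if_pos hh).symm, rfl⟩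
    · obtain ⟨c', y', hc', hj⟩ := hlt j hj
      exact (Part.mem_map_iff _).2 ⟨1, (hfl j c' y' hj 1).2 (if_neg hc').symm, rfl⟩
    · rw [hout']
      exact Part.mem_some _

end Primrec

end MSMachine

theorem MSComputable.partRecOverBaire {Ψ : ℕ → Baire →. Baire} (hΨ : IsUniversalTTE Ψ) {p q : ℕ}
    {Y : Codomain} {f : MixedFun p q Y} (hf : MSComputable Ψ f) : PartRecOverBaire Ψ p q Y f := by
  obtain ⟨M, hM⟩ := hf
  have := M.finΓ
  have := M.finQ
  have := MSMachine.finite_masterState M.Q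
  let _ := MSMachine.primcodableOfFinite M.Γ
  let _ := MSMachine.primcodableOfFinite (MasterState M.Q)
  exact MSMachine.computes_partRecOverBaire hΨ hM

theorem mainTheorem1 (Ψ : ℕ → Baire →. Baire) (hΨ : IsUniversalTTE Ψ) (p q : ℕ) (Y : Codomain)
    (f : MixedFun p q Y) : MSComputable Ψ f ↔ PartRecOverBaire Ψ p q Y f :=
  ⟨MSComputable.partRecOverBaire hΨ, PartRecOverBaire.msComputable hΨ⟩
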